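/- Let $S$ be a non-empty complex surface (a Hausdorff, second countable complex manifold of complex dimension $2$) with Kähler form $\omega_S$, and let $\omega_{\mathbb P^1}$ be the Fubini--Study form on $\mathbb P^1=\mathbb P(\mathbb C^2)$, given by $\frac{i}{2}\,\frac{dz\wedge d\bar z}{(1+|z|^2)^2}$ in an affine coordinate $z$. Write $\omega_S$ and $\omega_{\mathbb P^1}$ also for the pullbacks of these forms to $\mathbb P^1\times S$. Then for every $N\in\mathbb N$ there is $\varepsilon_0>0$ such that for every $\varepsilon$ with $0<\varepsilon<\varepsilon_0$ the symplectic manifold $(\mathbb P^1\times S,\ \omega_S+\varepsilon\,\omega_{\mathbb P^1})$ contains $N$ pairwise disjoint, smoothly embedded Lagrangian $3$-spheres $f_i:S^3\to\mathbb P^1\times S$ ($1\le i\le N$), each of which is null-homologous, i.e. $(f_i)_*[S^3]=0$ in $H_3(\mathbb P^1\times S;\mathbb Z)$. Moreover they can be taken of the form $$f_i(v)=\bigl(a(h(v)),\ \psi_i(\sqrt{\varepsilon}\,v)\bigr),\qquad v\in S^3\subset\mathbb C^2,\ |v|=1,$$ where $h:S^3\to\mathbb P^1$, $h(v)=[v]$,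 is the Hopf map, $a([z:w])=[-\bar w:\bar z]$ is the antipodal map of $\mathbb P^1$, and $\psi_i$ is a Darboux embedding of an open ball of radius $R_i>\sqrt{\varepsilon}$ about $0$ in $\mathbb C^2$ into $S$, that is, a smooth injective map on this ball which pulls $\omega_S$ back to the standard symplectic form $\frac{i}{2}(dz\wedge d\bar z+dw\wedge d\bar w)$. -/

import Mathlib

open scoped Manifold ContDiff LinearAlgebra.Projectivization ComplexConjugate

noncomputable section

/-! ### The complex projective line as a complex manifold -/

/-- The complex projective line: lines through the origin in `ℂ²`. -/
abbrev P1 : Type := ℙ ℂ (Fin 2 → ℂ)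

/-- The quotient topology from `ℂ² ∖ {0}`. -/
instance P1.instTopologicalSpace : TopologicalSpace P1 :=
  inferInstanceAs (TopologicalSpace (Quotient (projectivizationSetoid ℂ (Fin 2 → ℂ))))

/-- The set of points `[v₀ : v₁]` with `v i ≠ 0`. -/
def P1.affineSet (i : Fin 2) : Set P1 := {p | p.rep i ≠ 0}

/-- The affine coordinate `[v₀ : v₁] ↦ v (i + 1) / v i` (so `v₁ / v₀` for `i = 0`, and `v₀ / v₁`
for `i = 1`). -/
def P1.affineCoord (i : Fin 2) (p : P1) : ℂ := p.rep (i + 1) / p.rep i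

/-- The vector whose `i`-th coordinate is `1` and whose other coordinate is `z`. -/
def P1.affineVec (i : Fin 2) (z : ℂ) : Fin 2 → ℂ := fun k => if k = i then 1 else z

theorem P1.affineVec_self (i : Fin 2) (z : ℂ) : P1.affineVec i z i = 1 := by
  simp [P1.affineVec]

theorem P1.affineVec_other (i : Fin 2) (z : ℂ) : P1.affineVec i z (i + 1) = z := by
  fin_cases i <;> simp [P1.affineVec]

theorem P1.affineVec_ne_zero (i : Fin 2) (z : ℂ) : P1.affineVec i z ≠ 0 := fun h => by
  simpa [P1.affineVec] using congrFun h i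

theorem P1.mk_mem_affineSet (i : Fin 2) (v : Fin 2 → ℂ) (hv : v ≠ 0) :
    Projectivization.mk ℂ v hv ∈ P1.affineSet i ↔ v i ≠ 0 := by
  obtain ⟨a, ha⟩ := Projectivization.exists_smul_eq_mk_rep ℂ v hv
  simp [P1.affineSet, ← ha, Units.smul_def]

theorem P1.affineCoord_mk (i : Fin 2) (v : Fin 2 → ℂ) (hv : v ≠ 0) :
    P1.affineCoord i (Projectivization.mk ℂ v hv) = v (i + 1) / v i := by
  obtain ⟨a, ha⟩ := Projectivization.exists_smul_eq_mk_rep ℂ v hv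
  simp only [P1.affineCoord, ← ha, Units.smul_def, Pi.smul_apply, smul_eq_mul]
  exact mul_div_mul_left _ _ a.ne_zero

theorem P1.isQuotientMap_mk' :
    Topology.IsQuotientMap (Projectivization.mk' ℂ : {v : Fin 2 → ℂ // v ≠ 0} → P1) :=
  isQuotientMap_quotient_mk'

theorem P1.isOpen_affineSet (i : Fin 2) : IsOpen (P1.affineSet i) := by
  rw [← P1.isQuotientMap_mk'.isOpen_preimage]
  have h : (Projectivization.mk' ℂ : {v : Fin 2 → ℂ // v ≠ 0} → P1) ⁻¹' P1.affineSet i =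
      {v | v.1 i ≠ 0} := by
    ext v
    simp [Projectivization.mk'_eq_mk, P1.mk_mem_affineSet]
  rw [h]
  exact isOpen_ne_fun ((continuous_apply i).comp continuous_subtype_val) continuous_const

/-- The affine chart of the projective line on the set `v i ≠ 0`. -/
def P1.affineChart (i : Fin 2) : OpenPartialHomeomorph P1 ℂ where
  toFun := P1.affineCoord i
  invFun z := Projectivization.mk ℂ (P1.affineVec i z) (P1.affineVec_ne_zero i z)
  source := P1.affineSet i
  target := Set.univ
  map_source' _ _ := Set.mem_univ _
  map_target' z _ := by
    rw [P1.mk_mem_affineSet, P1.affineVec_self]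
    exact one_ne_zero
  left_inv' p hp := by
    induction p using Projectivization.ind with
    | h v hv =>
      rw [P1.mk_mem_affineSet] at hp
      rw [P1.affineCoord_mk, Projectivization.mk_eq_mk_iff']
      refine ⟨(v i)⁻¹, ?_⟩
      ext k
      by_cases hk : k = i
      · subst hk
        simp [P1.affineVec, hp]
      · have hk' : k = i + 1 := by omega
        simp only [P1.affineVec, hk, if_false, Pi.smul_apply, smul_eq_mul]
        rw [hk', div_eq_inv_mul]
  right_inv' z _ := by
    rw [P1.affineCoord_mk, P1.affineVec_self, P1.affineVec_other, div_one]
  open_source := P1.isOpen_affineSet i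
  open_target := isOpen_univ
  continuousOn_toFun := by
    rw [P1.isQuotientMap_mk'.continuousOn_isOpen_iff (P1.isOpen_affineSet i)]
    have h : P1.affineCoord i ∘ (Projectivization.mk' ℂ : {v : Fin 2 → ℂ // v ≠ 0} → P1) =
        fun v => v.1 (i + 1) / v.1 i := by
      ext v
      simp [Projectivization.mk'_eq_mk, P1.affineCoord_mk]
    rw [h]
    refine ContinuousOn.div ((continuous_apply _).comp continuous_subtype_val).continuousOn
      ((continuous_apply _).comp continuous_subtype_val).continuousOn fun v hv => ?_
    simpa [Projectivization.mk'_eq_mk, P1.mk_mem_affineSet] using hv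
  continuousOn_invFun := by
    have h : Continuous fun z : ℂ =>
        (⟨P1.affineVec i z, P1.affineVec_ne_zero i z⟩ : {v : Fin 2 → ℂ // v ≠ 0}) := by
      refine Continuous.subtype_mk (continuous_pi fun k => ?_) _
      by_cases hk : k = i
      · simpa [P1.affineVec, hk] using continuous_const
      · simpa [P1.affineVec, hk] using continuous_id'
    exact (P1.isQuotientMap_mk'.continuous.comp h).continuousOn

open Classical in
/-- The projective line with the atlas of its two affine charts. -/
instance P1.instChartedSpace : ChartedSpace ℂ P1 where
  atlas := Set.range P1.affineChart
  chartAt p := if p.rep 0 ≠ 0 then P1.affineChart 0 else P1.affineChart 1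
  mem_chart_source p := by
    split_ifs with h
    · exact h
    · change p.rep 1 ≠ 0
      intro h1
      refine p.rep_nonzero (funext fun k => ?_)
      fin_cases k
      · simpa using h
      · exact h1
  chart_mem_atlas p := by
    split_ifs <;> exact Set.mem_range_self _

/-- The projective line is a complex manifold. -/
instance P1.instIsManifold : IsManifold 𝓘(ℂ, ℂ) ω P1 := by
  refine isManifold_of_contDiffOn 𝓘(ℂ, ℂ) ω P1 ?_
  rintro _ _ ⟨i, rfl⟩ ⟨j, rfl⟩
  have hs : ∀ z ∈ ((P1.affineChart i).symm.trans (P1.affineChart j)).source,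
      P1.affineVec i z j ≠ 0 := by
    intro z hz
    have h2 : Projectivization.mk ℂ (P1.affineVec i z) (P1.affineVec_ne_zero i z) ∈
        P1.affineSet j := by
      simpa [P1.affineChart] using hz
    exact (P1.mk_mem_affineSet _ _ _).1 h2
  have hf : ∀ z, ((P1.affineChart i).symm.trans (P1.affineChart j)) z =
      P1.affineVec i z (j + 1) / P1.affineVec i z j := fun z => P1.affineCoord_mk _ _ _
  have hv : ∀ k, ContDiff ℂ ω fun z => P1.affineVec i z k := by
    intro k
    by_cases hk : k = i
    · simpa [P1.affineVec, hk] using contDiff_const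
    · simpa [P1.affineVec, hk] using contDiff_fun_id
  have h : ContDiffOn ℂ ω ((P1.affineChart i).symm.trans (P1.affineChart j))
      ((P1.affineChart i).symm.trans (P1.affineChart j)).source :=
    ((hv (j + 1)).contDiffOn.div (hv j).contDiffOn hs).congr fun z _ => hf z
  simpa using h

/-! ### Differential 2-forms -/

section Forms

variable {E : Type*} [NormedAddCommGroup E] [NormedSpace ℝ E] {H : Type*} [TopologicalSpace H]
  {E' : Type*} [NormedAddCommGroup E'] [NormedSpace ℝ E'] {H' : Type*} [TopologicalSpace H']

/-- A (not necessarily smooth) real 2-form on a manifold `M`: an alternating bilinear form on each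
tangent space. -/
abbrev TwoForm (I : ModelWithCorners ℝ E H) (M : Type*) [TopologicalSpace M] [ChartedSpace H M] :=
  ∀ x : M, TangentSpace I x [⋀^Fin 2]→L[ℝ] ℝ

/-- The pullback `f^* η` of a 2-form along a map of manifolds. -/
def TwoForm.pullback (I : ModelWithCorners ℝ E H) (J : ModelWithCorners ℝ E' H')
    {M N : Type*} [TopologicalSpace M] [ChartedSpace H M] [TopologicalSpace N] [ChartedSpace H' N]
    (f : M → N) (η : TwoForm J N) : TwoForm I M :=
  fun x => (η (f x)).compContinuousLinearMap (mfderiv I J f x)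

/-- The 2-form on a vector space given by an alternating bilinear form. -/
def alternatingOfBilin (B : E →L[ℝ] E →L[ℝ] ℝ) (hB : ∀ u, B u u = 0) : E [⋀^Fin 2]→L[ℝ] ℝ where
  toFun v := B (v 0) (v 1)
  map_update_add' v i x y := by fin_cases i <;> simp [Function.update]
  map_update_smul' v i c x := by fin_cases i <;> simp [Function.update]
  cont := by fun_prop
  map_eq_zero_of_eq' v i j hij hne := by
    have h : v 0 = v 1 := by
      fin_cases i <;> fin_cases j <;> simp_all
    rw [h, hB]

end Forms

/-! ### Kähler forms -/

section Kahler

variable {E : Type*} [NormedAddCommGroup E] [NormedSpace ℂ E]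
  {S : Type*} [TopologicalSpace S] [ChartedSpace E S]

/-- The complex structure on the real tangent spaces of a complex manifold. A tangent vector is
represented by a vector of `E` through the preferred chart; on a complex manifold the coordinate
changes are holomorphic, so that multiplication by `i` does not depend on the chart. -/
def complexStructure (x : S) (u : TangentSpace 𝓘(ℝ, E) x) : TangentSpace 𝓘(ℝ, E) x :=
  (Complex.I • (show E from u) : E)

/-- The coordinate expression on `E` of a 2-form in the chart `e`, i.e. its pullback along the
inverse of `e`. It is meaningful on `e.target`. -/
def TwoForm.inChart (η : TwoForm 𝓘(ℝ, E) S) (e : OpenPartialHomeomorph S E) :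
    E → E [⋀^Fin 2]→L[ℝ] ℝ :=
  fun y => TwoForm.pullback 𝓘(ℝ, E) 𝓘(ℝ, E) e.symm η y

/-- `η` is a Kähler form on the complex manifold `S`: a smooth closed real 2-form of type `(1,1)`
such that `η (u, J u) > 0` for every nonzero tangent vector `u`. -/
structure IsKahlerForm (η : TwoForm 𝓘(ℝ, E) S) : Prop where
  smooth : ∀ e ∈ atlas E S, ContDiffOn ℝ ∞ (η.inChart e) e.target
  closed : ∀ e ∈ atlas E S, ∀ y ∈ e.target, extDeriv (η.inChart e) y = 0
  compatible : ∀ (x : S) (u v : TangentSpace 𝓘(ℝ, E) x),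
    η x ![complexStructure x u, complexStructure x v] = η x ![u, v]
  positive : ∀ (x : S) (u : TangentSpace 𝓘(ℝ, E) x), u ≠ 0 → 0 < η x ![u, complexStructure x u]

end Kahler

/-! ### The Fubini–Study form -/

/-- The standard area form `dx ∧ dy` on `ℂ`, `(u, v) ↦ Im (ū v)`. -/
def areaForm : ℂ [⋀^Fin 2]→L[ℝ] ℝ :=
  alternatingOfBilin
    (LinearMap.mkContinuous₂
      (LinearMap.mk₂ ℝ (fun u v : ℂ => u.re * v.im - u.im * v.re)
        (by intros; simp; ring) (by intros; simp; ring) (by intros; simp; ring)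
        (by intros; simp; ring)) 2
      (fun u v => by
        have h1 := Complex.abs_re_le_norm u
        have h2 := Complex.abs_im_le_norm u
        have h3 := Complex.abs_re_le_norm v
        have h4 := Complex.abs_im_le_norm v
        simp only [LinearMap.mk₂_apply, Real.norm_eq_abs]
        calc |u.re * v.im - u.im * v.re| ≤ |u.re| * |v.im| + |u.im| * |v.re| := by
              rw [← abs_mul, ← abs_mul]; exact abs_sub _ _
          _ ≤ ‖u‖ * ‖v‖ + ‖u‖ * ‖v‖ := by gcongr
          _ = 2 * ‖u‖ * ‖v‖ := by ring))
    (fun u => by simp [mul_comm])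

/-- The Fubini–Study form on the projective line, `(i/2) dz ∧ dz̄ / (1 + |z|²)²` in either affine
coordinate `z`. It is the reduction of the standard symplectic form by the unit sphere of `ℂ²`. -/
def fubiniStudy : TwoForm 𝓘(ℝ, ℂ) P1 := fun p =>
  ((1 + ‖chartAt ℂ p p‖ ^ 2) ^ 2)⁻¹ •
    areaForm.compContinuousLinearMap (mfderiv 𝓘(ℝ, ℂ) 𝓘(ℝ, ℂ) (chartAt ℂ p) p)

/-! ### The product of the projective line with a complex surface -/

section Product

variable {E : Type*} [NormedAddCommGroup E] [NormedSpace ℂ E]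
  {S : Type*} [TopologicalSpace S] [ChartedSpace E S]

/-- The form `ω_S + ε ω_{ℙ¹}` on `ℙ¹ × S`, the pullbacks under the two projections being implicit
in the notation; `ω_{ℙ¹}` is the Fubini–Study form. -/
def productForm (ωS : TwoForm 𝓘(ℝ, E) S) (ε : ℝ) :
    TwoForm ((𝓘(ℝ, ℂ)).prod 𝓘(ℝ, E)) (P1 × S) := fun x =>
  TwoForm.pullback ((𝓘(ℝ, ℂ)).prod 𝓘(ℝ, E)) 𝓘(ℝ, E) (Prod.snd : P1 × S → S) ωS x +
  ε • TwoForm.pullback ((𝓘(ℝ, ℂ)).prod 𝓘(ℝ, E)) 𝓘(ℝ, ℂ) (Prod.fst : P1 × S → P1) fubiniStudy x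

end Product

/-! ### Lagrangian and null-homologous 3-spheres -/

/-- The unit sphere of `ℝ⁴`. -/
abbrev S3 : Type := Metric.sphere (0 : EuclideanSpace ℝ (Fin 4)) 1

/-- `f` parametrizes an embedded Lagrangian 3-sphere in the 6-dimensional manifold `M` with
symplectic form `η`: it is a smooth embedding with `f^* η = 0`. -/
structure IsLagrangianSphere {E : Type*} [NormedAddCommGroup E] [NormedSpace ℝ E]
    {H : Type*} [TopologicalSpace H] (I : ModelWithCorners ℝ E H)
    {M : Type*} [TopologicalSpace M] [ChartedSpace H M]
    (η : TwoForm I M) (f : S3 → M) : Prop where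
  dim : Module.finrank ℝ E = 6
  isSmoothEmbedding : Manifold.IsSmoothEmbedding (𝓡 3) I ∞ f
  isotropic : TwoForm.pullback (𝓡 3) I f η = 0

universe u

/-- The image of the fundamental class of the 3-sphere in `H₃(X; ℤ)` vanishes. As `H₃(S³; ℤ)` is
generated by the fundamental class, this says that the map which `f` induces on the third singular
homology is zero. -/
def IsNullHomologous {X : Type u} [TopologicalSpace X] (f : C(S3, X)) : Prop :=
  ((AlgebraicTopology.singularHomologyFunctor (ModuleCat.{u} ℤ) 3).obj
    (ModuleCat.of ℤ (ULift.{u} ℤ))).map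
      (TopCat.ofHom (f.comp ⟨ULift.down, continuous_uliftDown⟩ : C(ULift.{u} S3, X))) = 0

/-! ### The Hopf map and Darboux embeddings -/

/-- The point of `ℂ²` with real coordinates `x`. -/
def toC2 (x : EuclideanSpace ℝ (Fin 4)) : Fin 2 → ℂ := ![⟨x 0, x 1⟩, ⟨x 2, x 3⟩]

theorem toC2_ne_zero (x : S3) : toC2 x.1 ≠ 0 := by
  intro h
  have h0 := congrFun h 0
  have h1 := congrFun h 1
  simp only [toC2, Matrix.cons_val_zero, Matrix.cons_val_one, Pi.zero_apply, Complex.ext_iff,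
    Complex.zero_re, Complex.zero_im] at h0 h1
  have hx : x.1 = 0 := by
    ext k
    fin_cases k
    · exact h0.1
    · exact h0.2
    · exact h1.1
    · exact h1.2
  have := norm_eq_of_mem_sphere x
  rw [hx, norm_zero] at this
  exact zero_ne_one this

/-- The Hopf map `v ↦ [v]` from the unit sphere of `ℂ²` to the projective line. -/
def hopf (x : S3) : P1 := Projectivization.mk ℂ (toC2 x.1) (toC2_ne_zero x)

/-- The conjugate-linear map `(z, w) ↦ (-w̄, z̄)`. -/
def antipodalLift : (Fin 2 → ℂ) →ₛₗ[starRingEnd ℂ] (Fin 2 → ℂ) where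
  toFun v := ![-conj (v 1), conj (v 0)]
  map_add' v w := by ext k; fin_cases k <;> simp; ring
  map_smul' c v := by ext k; fin_cases k <;> simp

theorem antipodalLift_injective : Function.Injective antipodalLift := by
  intro v w h
  have h0 := congrFun h 0
  have h1 := congrFun h 1
  simp only [antipodalLift, LinearMap.coe_mk, AddHom.coe_mk, Matrix.cons_val_zero,
    Matrix.cons_val_one, neg_inj] at h0 h1
  ext k
  fin_cases k
  · exact (starRingEnd ℂ).injective h1
  · exact (starRingEnd ℂ).injective h0

/-- The antipodal map `[z : w] ↦ [-w̄ : z̄]` of the projective line. -/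
def antipodal : P1 → P1 := Projectivization.map antipodalLift antipodalLift_injective

/-- The standard symplectic form `dx₀ ∧ dx₁ + dx₂ ∧ dx₃` on `ℝ⁴ = ℂ²`. -/
def standardSymplecticForm :
    EuclideanSpace ℝ (Fin 4) [⋀^Fin 2]→L[ℝ] ℝ :=
  areaForm.compContinuousLinearMap
    (LinearMap.toContinuousLinearMap
      { toFun := fun x => toC2 x 0
        map_add' := fun x y => by simp [toC2, Complex.ext_iff]
        map_smul' := fun c x => by simp [toC2, Complex.ext_iff] }) +
  areaForm.compContinuousLinearMap
    (LinearMap.toContinuousLinearMap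
      { toFun := fun x => toC2 x 1
        map_add' := fun x y => by simp [toC2, Complex.ext_iff]
        map_smul' := fun c x => by simp [toC2, Complex.ext_iff] })

section Darboux

variable {E : Type*} [NormedAddCommGroup E] [NormedSpace ℂ E]
  {S : Type*} [TopologicalSpace S] [ChartedSpace E S]

/-- `ψ` is a Darboux parametrization by the open ball of radius `R` in `ℂ²`: a smooth injective
map on this ball which pulls the form `ωS` back to the standard symplectic form. -/
structure IsDarbouxBall (ωS : TwoForm 𝓘(ℝ, E) S) (R : ℝ) (ψ : EuclideanSpace ℝ (Fin 4) → S) :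
    Prop where
  contMDiffOn : ContMDiffOn (𝓡 4) 𝓘(ℝ, E) ∞ ψ (Metric.ball 0 R)
  injOn : Set.InjOn ψ (Metric.ball 0 R)
  pullback_eq : ∀ x ∈ Metric.ball (0 : EuclideanSpace ℝ (Fin 4)) R,
    TwoForm.pullback (𝓡 4) 𝓘(ℝ, E) ψ ωS x = standardSymplecticForm

/-- `f` is the product of the Hopf map, followed by the antipodal map, and of the inclusion of the
sphere of radius `r` in a Darboux chart of `S`. -/
def IsHopfSphere (ωS : TwoForm 𝓘(ℝ, E) S) (r : ℝ) (f : S3 → P1 × S) : Prop :=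
  ∃ (R : ℝ) (ψ : EuclideanSpace ℝ (Fin 4) → S), r < R ∧ IsDarbouxBall ωS R ψ ∧
    ∀ x : S3, f x = (antipodal (hopf x), ψ (r • x.1))

end Darboux

end

/-! Geometry. By Darboux's theorem a ball of ℂ² embeds symplectically in S, and N disjoint balls of
a common radius ρ fit inside it; the bound is ε₀ = ρ². On the sphere of radius √ε in one of these
balls, ω_S pulls back to ε times the restriction of the standard form to S³
(`IsDarbouxBall.pullback_sphere`). The Hopf map exhibits ℙ¹ as a symplectic reduction, so it pulls
the Fubini–Study form back to that same restriction, and the antipodal map reverses the sign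
(`pullback_fubiniStudy`). The two contributions to the pullback of ω_S + ε ω_{ℙ¹} therefore cancel.
The S-component alone is already an embedding with injective differentials, hence so is the pair,
whatever its ℙ¹-component.

Topology. Shrinking the sphere to the centre of its ball deforms the map into ℙ¹ × {pt}. Since
H₃(ℙ¹; ℤ) = 0, the induced map on H₃ vanishes (`isNullHomologous_of_homotopic`). This vanishing
comes from Mayer–Vietoris (`AcyclicIn.union`): ℙ¹ is the union of two affine lines meeting in ℂ ∖
{0}, which is the union of two slit planes meeting in two disjoint half-planes. Mayer–Vietoris rests
on barycentric subdivision, first treated formally on tuples of points, then transported to singular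
chains. A comparison of chain complexes brings the result to the singular homology functor.

Darboux. Moser's method is run without flows: the velocity of the path issuing from x is the unknown
of an equation in the Banach space of continuous paths, solved smoothly in x by the implicit
function theorem (`exists_moser_velocity`). Its time-one map straightens the form
(`exists_constant_coordinates`), the Poincaré lemma supplying the required primitive. -/

noncomputable section

/-! ### Chains of tuples -/

section TupleChains

open Finsupp

variable {Y Y' : Type*}

/-- Formal integral combinations of `k`-tuples of elements of `Y`. -/
abbrev TupleChain (Y : Type*) (k : ℕ) : Type _ := (Fin k → Y) →₀ ℤ

/-- The alternating sum of the faces of a tuple. The complex is augmented: the empty tuple is the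
only face of a tuple of length one. -/
def tupleBoundary (Y : Type*) (k : ℕ) : TupleChain Y (k + 1) →ₗ[ℤ] TupleChain Y k :=
  linearCombination ℤ fun v => ∑ i : Fin (k + 1), (-1 : ℤ) ^ (i : ℕ) • single (v ∘ i.succAbove) 1

theorem tupleBoundary_single (k : ℕ) (v : Fin (k + 1) → Y) :
    tupleBoundary Y k (single v 1) =
      ∑ i : Fin (k + 1), (-1 : ℤ) ^ (i : ℕ) • single (v ∘ i.succAbove) 1 := by
  simp [tupleBoundary]

/-- The cone with apex `b` over a chain of tuples. -/
def tupleCone (b : Y) (k : ℕ) : TupleChain Y k →ₗ[ℤ] TupleChain Y (k + 1) :=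
  lmapDomain ℤ ℤ fun v => (Fin.cons b v : Fin (k + 1) → Y)

theorem tupleCone_single (b : Y) (k : ℕ) (v : Fin k → Y) :
    tupleCone b k (single v 1) = single (Fin.cons b v : Fin (k + 1) → Y) 1 := by
  simp [tupleCone]

theorem tupleBoundary_cone_zero (b : Y) (c : TupleChain Y 0) :
    tupleBoundary Y 0 (tupleCone b 0 c) = c := by
  suffices h : (tupleBoundary Y 0).comp (tupleCone b 0) = LinearMap.id from LinearMap.congr_fun h c
  ext v : 2
  simp only [LinearMap.comp_apply, lsingle_apply, tupleCone_single, tupleBoundary_single]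
  simp

/-- The face opposite the apex is the base, and each other face is the cone over a face of the base
with its sign shifted by one. This relation drives all the inductions on tuples. -/
theorem tupleBoundary_cone (b : Y) (k : ℕ) (c : TupleChain Y (k + 1)) :
    tupleBoundary Y (k + 1) (tupleCone b (k + 1) c) = c - tupleCone b k (tupleBoundary Y k c) := by
  suffices h : (tupleBoundary Y (k + 1)).comp (tupleCone b (k + 1)) =
      LinearMap.id - (tupleCone b k).comp (tupleBoundary Y k) from LinearMap.congr_fun h c
  ext v : 2
  simp only [LinearMap.comp_apply, lsingle_apply, tupleCone_single, tupleBoundary_single,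
    LinearMap.sub_apply, LinearMap.id_apply]
  rw [Fin.sum_univ_succ, map_sum, sub_eq_add_neg, ← Finset.sum_neg_distrib]
  congr 1
  · simp only [Fin.val_zero, pow_zero, one_smul]
    congr 1
  · refine Finset.sum_congr rfl fun i _ => ?_
    rw [map_zsmul, tupleCone_single, Fin.val_succ, pow_succ, mul_neg_one, neg_smul]
    congr 3
    funext j
    refine Fin.cases ?_ (fun j => ?_) j
    · simp
    · simp

/-- Every tuple is the cone from its first entry over its tail, so the cone formula reduces the
claim to one dimension lower. -/
theorem tupleBoundary_boundary (k : ℕ) (c : TupleChain Y (k + 2)) :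
    tupleBoundary Y k (tupleBoundary Y (k + 1) c) = 0 := by
  induction k with
  | zero =>
    suffices h : (tupleBoundary Y 0).comp (tupleBoundary Y 1) = 0 from LinearMap.congr_fun h c
    ext v : 2
    simp only [LinearMap.comp_apply, lsingle_apply, LinearMap.zero_apply]
    rw [← Fin.cons_self_tail v, ← tupleCone_single, tupleBoundary_cone, map_sub,
      tupleBoundary_cone_zero, sub_self]
  | succ k ih =>
    suffices h : (tupleBoundary Y (k + 1)).comp (tupleBoundary Y (k + 2)) = 0 from
      LinearMap.congr_fun h c
    ext v : 2
    simp only [LinearMap.comp_apply, lsingle_apply, LinearMap.zero_apply]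
    rw [← Fin.cons_self_tail v, ← tupleCone_single, tupleBoundary_cone, map_sub,
      tupleBoundary_cone, ih, map_zero, sub_zero, sub_self]

/-! ### Barycentric subdivision of tuples, for an arbitrary choice of apexes. -/

variable (b : ∀ k, (Fin (k + 1) → Y) → Y)

/-- Barycentric subdivision of tuples, with barycentres given by `b`. -/
def tupleSubdiv : ∀ k, TupleChain Y k →ₗ[ℤ] TupleChain Y k
  | 0 => LinearMap.id
  | k + 1 => linearCombination ℤ fun v =>
      tupleCone (b k v) k (tupleSubdiv k (tupleBoundary Y k (single v 1)))

/-- The chain homotopy from the identity to barycentric subdivision. -/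
def tupleHomotopy : ∀ k, TupleChain Y k →ₗ[ℤ] TupleChain Y (k + 1)
  | 0 => 0
  | k + 1 => linearCombination ℤ fun v =>
      tupleCone (b k v) (k + 1) (single v 1 - tupleHomotopy k (tupleBoundary Y k (single v 1)))

theorem tupleSubdiv_single (k : ℕ) (v : Fin (k + 1) → Y) :
    tupleSubdiv b (k + 1) (single v 1) =
      tupleCone (b k v) k (tupleSubdiv b k (tupleBoundary Y k (single v 1))) := by
  simp [tupleSubdiv]

theorem tupleHomotopy_single (k : ℕ) (v : Fin (k + 1) → Y) :
    tupleHomotopy b (k + 1) (single v 1) = tupleCone (b k v) (k + 1)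
      (single v 1 - tupleHomotopy b k (tupleBoundary Y k (single v 1))) := by
  simp [tupleHomotopy]

theorem tupleBoundary_subdiv (k : ℕ) (c : TupleChain Y (k + 1)) :
    tupleBoundary Y k (tupleSubdiv b (k + 1) c) = tupleSubdiv b k (tupleBoundary Y k c) := by
  induction k with
  | zero =>
    suffices h : (tupleBoundary Y 0).comp (tupleSubdiv b 1) =
        (tupleSubdiv b 0).comp (tupleBoundary Y 0) from LinearMap.congr_fun h c
    ext v : 2
    simp only [LinearMap.comp_apply, lsingle_apply, tupleSubdiv_single, tupleBoundary_cone_zero]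
  | succ k ih =>
    suffices h : (tupleBoundary Y (k + 1)).comp (tupleSubdiv b (k + 2)) =
        (tupleSubdiv b (k + 1)).comp (tupleBoundary Y (k + 1)) from LinearMap.congr_fun h c
    ext v : 2
    simp only [LinearMap.comp_apply, lsingle_apply, tupleSubdiv_single, tupleBoundary_cone, ih,
      tupleBoundary_boundary, map_zero, sub_zero]

/-- Write D for the homotopy, Sd for the subdivision and C for the cone with apex `b`. Then ∂C(v −
D∂v) = v − D∂v − C∂(v − D∂v), and by induction ∂(v − D∂v) = Sd ∂v, whose cone is Sd v. No property
of `b` is needed. -/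
theorem tupleBoundary_homotopy (k : ℕ) (c : TupleChain Y (k + 1)) :
    tupleBoundary Y (k + 1) (tupleHomotopy b (k + 1) c) =
      c - tupleSubdiv b (k + 1) c - tupleHomotopy b k (tupleBoundary Y k c) := by
  induction k with
  | zero =>
    suffices h : (tupleBoundary Y 1).comp (tupleHomotopy b 1) =
        LinearMap.id - tupleSubdiv b 1 - (tupleHomotopy b 0).comp (tupleBoundary Y 0) from
      LinearMap.congr_fun h c
    ext v : 2
    simp only [LinearMap.comp_apply, lsingle_apply, tupleSubdiv_single, tupleHomotopy_single,
      tupleBoundary_cone, LinearMap.sub_apply, LinearMap.id_apply]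
    simp [tupleHomotopy, tupleSubdiv]
  | succ k ih =>
    suffices h : (tupleBoundary Y (k + 2)).comp (tupleHomotopy b (k + 2)) =
        LinearMap.id - tupleSubdiv b (k + 2) -
          (tupleHomotopy b (k + 1)).comp (tupleBoundary Y (k + 1)) from LinearMap.congr_fun h c
    ext v : 2
    simp only [LinearMap.comp_apply, lsingle_apply, tupleSubdiv_single (k := k + 1),
      tupleHomotopy_single (k := k + 1),
      tupleBoundary_cone, LinearMap.sub_apply, LinearMap.id_apply, map_sub, ih,
      tupleBoundary_boundary, map_zero, sub_zero]
    abel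

/-- The map on chains of tuples induced by a map. -/
def tupleMap (f : Y → Y') (k : ℕ) : TupleChain Y k →ₗ[ℤ] TupleChain Y' k :=
  lmapDomain ℤ ℤ fun v => f ∘ v

theorem tupleMap_single (f : Y → Y') (k : ℕ) (v : Fin k → Y) :
    tupleMap f k (single v 1) = single (f ∘ v) 1 := by
  simp [tupleMap]

theorem tupleMap_boundary (f : Y → Y') (k : ℕ) (c : TupleChain Y (k + 1)) :
    tupleMap f k (tupleBoundary Y k c) = tupleBoundary Y' k (tupleMap f (k + 1) c) := by
  suffices h : (tupleMap f k).comp (tupleBoundary Y k) =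
      (tupleBoundary Y' k).comp (tupleMap f (k + 1)) from LinearMap.congr_fun h c
  ext v : 2
  simp only [LinearMap.comp_apply, lsingle_apply, tupleBoundary_single, tupleMap_single, map_sum,
    map_zsmul]
  rfl

theorem tupleMap_cone (f : Y → Y') (x : Y) (k : ℕ) (c : TupleChain Y k) :
    tupleMap f (k + 1) (tupleCone x k c) = tupleCone (f x) k (tupleMap f k c) := by
  suffices h : (tupleMap f (k + 1)).comp (tupleCone x k) =
      (tupleCone (f x) k).comp (tupleMap f k) from LinearMap.congr_fun h c
  ext v : 2
  simp only [LinearMap.comp_apply, lsingle_apply, tupleCone_single, tupleMap_single]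
  congr 1
  funext j
  refine Fin.cases ?_ (fun j => ?_) j <;> simp

variable {b} {b' : ∀ k, (Fin (k + 1) → Y') → Y'}

/-- Naturality, unlike the boundary formulas, needs a condition on the apexes: `f` must carry chosen
apexes to chosen apexes, as affine maps do with barycentres. -/
theorem tupleMap_subdiv {f : Y → Y'} (hf : ∀ k v, f (b k v) = b' k (f ∘ v)) (k : ℕ)
    (c : TupleChain Y k) :
    tupleMap f k (tupleSubdiv b k c) = tupleSubdiv b' k (tupleMap f k c) := by
  induction k with
  | zero => rfl
  | succ k ih =>
    suffices h : (tupleMap f (k + 1)).comp (tupleSubdiv b (k + 1)) =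
        (tupleSubdiv b' (k + 1)).comp (tupleMap f (k + 1)) from LinearMap.congr_fun h c
    ext v : 2
    simp only [LinearMap.comp_apply, lsingle_apply, tupleSubdiv_single, tupleMap_single,
      tupleMap_cone, ih, tupleMap_boundary, hf]

theorem tupleMap_homotopy {f : Y → Y'} (hf : ∀ k v, f (b k v) = b' k (f ∘ v)) (k : ℕ)
    (c : TupleChain Y k) :
    tupleMap f (k + 1) (tupleHomotopy b k c) = tupleHomotopy b' k (tupleMap f k c) := by
  induction k with
  | zero => simp [tupleHomotopy]
  | succ k ih =>
    suffices h : (tupleMap f (k + 2)).comp (tupleHomotopy b (k + 1)) =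
        (tupleHomotopy b' (k + 1)).comp (tupleMap f (k + 1)) from LinearMap.congr_fun h c
    ext v : 2
    simp only [LinearMap.comp_apply, lsingle_apply, tupleHomotopy_single, tupleMap_single,
      tupleMap_cone, ih, tupleMap_boundary, hf, map_sub]

end TupleChains

/-! ### Affine maps between standard simplices -/

section AffineSimplex

/-- The standard simplex with `k` vertices. -/
abbrev Simp (k : ℕ) : Type := stdSimplex ℝ (Fin k)

/-- The `i`-th vertex of the standard simplex. -/
def Simp.vertex (k : ℕ) (i : Fin k) : Simp k := ⟨Pi.single i 1, single_mem_stdSimplex ℝ i⟩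

/-- The affine map which sends the vertices to the points `p i`. -/
def Simp.aff {m k : ℕ} (p : Fin m → Simp k) : C(Simp m, Simp k) where
  toFun t := ⟨∑ i, t.1 i • (p i).1,
    (convex_stdSimplex ℝ (Fin k)).sum_mem (fun i _ => t.2.1 i) t.2.2 fun i _ => (p i).2⟩
  continuous_toFun := Continuous.subtype_mk (continuous_finsetSum _ fun i _ =>
    ((continuous_apply i).comp continuous_subtype_val).smul continuous_const) _

theorem Simp.aff_apply {m k : ℕ} (p : Fin m → Simp k) (t : Simp m) (j : Fin k) :
    Simp.aff p t j = ∑ i, t i * p i j := by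
  change (∑ i, t.1 i • (p i).1) j = _
  rw [Finset.sum_apply]
  rfl

theorem Simp.vertex_apply (k : ℕ) (i j : Fin k) :
    Simp.vertex k i j = if j = i then 1 else 0 :=
  Pi.single_apply i (1 : ℝ) j

theorem Simp.aff_val {m k : ℕ} (p : Fin m → Simp k) (t : Simp m) :
    (Simp.aff p t).1 = ∑ i, t.1 i • (p i).1 := rfl

theorem Simp.aff_vertex {m k : ℕ} (p : Fin m → Simp k) (i : Fin m) :
    Simp.aff p (Simp.vertex m i) = p i := by
  ext j
  simp [Simp.aff_apply, Simp.vertex_apply]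

theorem Simp.aff_comp_vertex {m k : ℕ} (p : Fin m → Simp k) :
    Simp.aff p ∘ Simp.vertex m = p :=
  funext (Simp.aff_vertex p)

theorem Simp.aff_vertices (k : ℕ) : Simp.aff (Simp.vertex k) = ContinuousMap.id _ := by
  ext t j
  simp [Simp.aff_apply, Simp.vertex_apply]

theorem Simp.aff_comp {l m k : ℕ} (p : Fin m → Simp k) (q : Fin l → Simp m) :
    (Simp.aff p).comp (Simp.aff q) = Simp.aff (Simp.aff p ∘ q) := by
  ext t j
  simp only [ContinuousMap.comp_apply, Simp.aff_apply, Function.comp_apply, Finset.sum_mul,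
    Finset.mul_sum]
  rw [Finset.sum_comm]
  exact Finset.sum_congr rfl fun _ _ => Finset.sum_congr rfl fun _ _ => by ring

/-- The barycentre of the standard simplex. -/
def Simp.centre (k : ℕ) : Simp (k + 1) :=
  ⟨fun _ => ((k : ℝ) + 1)⁻¹, fun _ => by positivity, by
    simp only [Finset.sum_const, Finset.card_univ, Fintype.card_fin, nsmul_eq_mul, Nat.cast_add,
      Nat.cast_one]
    exact mul_inv_cancel₀ (by positivity)⟩

/-- The barycentre of a tuple of points of a simplex. -/
def Simp.bary (l k : ℕ) (p : Fin (k + 1) → Simp l) : Simp l := Simp.aff p (Simp.centre k)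

theorem Simp.aff_bary {l m k : ℕ} (q : Fin l → Simp m) (p : Fin (k + 1) → Simp l) :
    Simp.aff q (Simp.bary l k p) = Simp.bary m k (Simp.aff q ∘ p) := by
  simp only [Simp.bary, ← Simp.aff_comp, ContinuousMap.comp_apply]

theorem Simp.dist_aff_le {m k : ℕ} (p : Fin m → Simp k) (t : Simp m) (x : Simp k) :
    dist (Simp.aff p t) x ≤ ∑ i, t.1 i * dist (p i) x := by
  have h : (Simp.aff p t).1 - x.1 = ∑ i, t.1 i • ((p i).1 - x.1) := by
    simp only [smul_sub, Finset.sum_sub_distrib, ← Finset.sum_smul, t.2.2, one_smul, Simp.aff_val]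
  rw [Subtype.dist_eq, dist_eq_norm, h]
  refine (norm_sum_le _ _).trans (Finset.sum_le_sum fun i _ => ?_)
  rw [norm_smul, Real.norm_of_nonneg (t.2.1 i), Subtype.dist_eq, dist_eq_norm]

theorem Simp.dist_aff_le_of_forall {m k : ℕ} (p : Fin m → Simp k) (t : Simp m) (x : Simp k)
    {R : ℝ} (h : ∀ i, dist (p i) x ≤ R) : dist (Simp.aff p t) x ≤ R :=
  calc dist (Simp.aff p t) x ≤ ∑ i, t.1 i * dist (p i) x := Simp.dist_aff_le p t x
    _ ≤ ∑ i, t.1 i * R := Finset.sum_le_sum fun i _ => mul_le_mul_of_nonneg_left (h i) (t.2.1 i)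
    _ = R := by rw [← Finset.sum_mul, t.2.2, one_mul]

/-- The barycentre averages k + 1 points, and the one at distance zero from `p j` contributes
nothing. -/
theorem Simp.dist_bary_le {l k : ℕ} (p : Fin (k + 1) → Simp l) {r : ℝ}
    (h : ∀ i j, dist (p i) (p j) ≤ r) (j : Fin (k + 1)) :
    dist (Simp.bary l k p) (p j) ≤ k / (k + 1) * r := by
  refine (Simp.dist_aff_le p _ _).trans ?_
  rw [Fin.sum_univ_succAbove _ j, dist_self, mul_zero, zero_add]
  calc ∑ i, (Simp.centre k).1 (j.succAbove i) * dist (p (j.succAbove i)) (p j)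
      ≤ ∑ _i : Fin k, ((k : ℝ) + 1)⁻¹ * r :=
        Finset.sum_le_sum fun i _ => mul_le_mul_of_nonneg_left (h _ _) ((Simp.centre k).2.1 _)
    _ = k / (k + 1) * r := by
        rw [Finset.sum_const, Finset.card_univ, Fintype.card_fin, nsmul_eq_mul]
        ring

-- The two properties are proved together. The first is convexity: subdivision never leaves a ball
-- that contains the vertices. Applied to balls around the barycentre, it bounds the edges at the
-- new apex, while induction bounds the others. The factor is not optimal (k points would allow (k −
-- 1)/k), but a factor below 1 suffices.
open Finsupp in
theorem Simp.subdiv_single_mem {l : ℕ} (k : ℕ) (p : Fin k → Simp l) :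
    tupleSubdiv (Simp.bary l) k (single p 1) ∈ supported ℤ ℤ {q : Fin k → Simp l |
      (∀ x R, (∀ i, dist (p i) x ≤ R) → ∀ i, dist (q i) x ≤ R) ∧
      ∀ r, (∀ i j, dist (p i) (p j) ≤ r) → ∀ i j, dist (q i) (q j) ≤ k / (k + 1) * r} := by
  induction k with
  | zero =>
    intro q _
    exact ⟨fun _ _ _ i => i.elim0, fun _ _ i => i.elim0⟩
  | succ k ih =>
    rw [tupleSubdiv_single, tupleBoundary_single, map_sum, map_sum]
    refine Submodule.sum_mem _ fun i _ => ?_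
    rw [map_zsmul, map_zsmul]
    refine Submodule.smul_mem _ _ ?_
    refine (Submodule.map_le_iff_le_comap.2 ?_) (Submodule.mem_map_of_mem (ih (p ∘ i.succAbove)))
    rw [supported_eq_span_single, Submodule.span_le]
    rintro _ ⟨q, ⟨hq1, hq2⟩, rfl⟩
    simp only [Submodule.comap_coe, Set.mem_preimage, SetLike.mem_coe, tupleCone_single]
    refine single_mem_supported _ _ ⟨fun x R h j => ?_, fun r h => ?_⟩
    · refine Fin.cases ?_ (fun j => ?_) j
      · exact Simp.dist_aff_le_of_forall _ _ _ h
      · exact hq1 x R (fun i => h _) j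
    · have hr : 0 ≤ r := dist_nonneg.trans (h 0 0)
      have hb : ∀ j, dist (q j) (Simp.bary l k p) ≤ ((k + 1 : ℕ) : ℝ) / ((k + 1 : ℕ) + 1) * r := by
        refine hq1 _ _ fun j => ?_
        rw [dist_comm]
        refine (Simp.dist_bary_le p h _).trans (mul_le_mul_of_nonneg_right ?_ hr)
        rw [div_le_div_iff₀ (by positivity) (by positivity)]
        push_cast
        nlinarith
      intro a c
      refine Fin.cases ?_ (fun a => ?_) a <;> refine Fin.cases ?_ (fun c => ?_) c
      · rw [dist_self]
        positivity
      · rw [dist_comm]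
        exact hb c
      · exact hb a
      · refine (hq2 r (fun _ _ => h _ _) a c).trans (mul_le_mul_of_nonneg_right ?_ hr)
        rw [div_le_div_iff₀ (by positivity) (by positivity)]
        push_cast
        nlinarith

open Finsupp in
theorem Simp.subdiv_iterate_mem {l : ℕ} (k : ℕ) (r : ℝ) (n : ℕ) (c : TupleChain (Simp l) k)
    (hc : c ∈ supported ℤ ℤ {q : Fin k → Simp l | ∀ i j, dist (q i) (q j) ≤ r}) :
    ((tupleSubdiv (Simp.bary l) k)^[n]) c ∈ supported ℤ ℤ
      {q : Fin k → Simp l | ∀ i j, dist (q i) (q j) ≤ ((k : ℝ) / (k + 1)) ^ n * r} := by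
  induction n with
  | zero => simpa using hc
  | succ n ih =>
    rw [Function.iterate_succ_apply']
    refine (Submodule.map_le_iff_le_comap.2 ?_) (Submodule.mem_map_of_mem ih)
    rw [supported_eq_span_single, Submodule.span_le]
    rintro _ ⟨q, hq, rfl⟩
    refine supported_mono ?_ (Simp.subdiv_single_mem k q)
    rintro q' ⟨-, h⟩ i j
    refine (h _ hq i j).trans_eq ?_
    ring

end AffineSimplex

end

noncomputable section

/-! ### Augmented singular chains -/

section SingularChains

open Finsupp Filter

variable {X : Type*} [TopologicalSpace X]

/-- Singular chains on `X`, indexed by the number of vertices. -/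
abbrev SChain (X : Type*) [TopologicalSpace X] (k : ℕ) : Type _ := C(Simp k, X) →₀ ℤ

/-- The `i`-th face map. -/
def Simp.face (k : ℕ) (i : Fin (k + 1)) : C(Simp k, Simp (k + 1)) :=
  Simp.aff (Simp.vertex (k + 1) ∘ i.succAbove)

/-- The boundary operator of the augmented singular chain complex. -/
def sBoundary (X : Type*) [TopologicalSpace X] (k : ℕ) : SChain X (k + 1) →ₗ[ℤ] SChain X k :=
  linearCombination ℤ fun σ => ∑ i : Fin (k + 1), (-1 : ℤ) ^ (i : ℕ) • single (σ.comp (Simp.face k i)) 1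

theorem sBoundary_single (k : ℕ) (σ : C(Simp (k + 1), X)) :
    sBoundary X k (single σ 1) =
      ∑ i : Fin (k + 1), (-1 : ℤ) ^ (i : ℕ) • single (σ.comp (Simp.face k i)) 1 := by
  simp [sBoundary]

/-- The singular chain obtained from a singular simplex `σ` and a chain of affine simplices in its
domain. -/
def sPush {l : ℕ} (σ : C(Simp l, X)) (k : ℕ) : TupleChain (Simp l) k →ₗ[ℤ] SChain X k :=
  lmapDomain ℤ ℤ fun p => σ.comp (Simp.aff p)

theorem sPush_single {l : ℕ} (σ : C(Simp l, X)) (k : ℕ) (p : Fin k → Simp l) :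
    sPush σ k (single p 1) = single (σ.comp (Simp.aff p)) 1 := by
  simp [sPush]

/-- Every singular simplex is the push-forward of the tuple of vertices of the standard simplex.
Together with the naturality of `sPush`, this transfers each identity for tuples to singular chains.
-/
theorem sPush_vertices {k : ℕ} (σ : C(Simp k, X)) :
    sPush σ k (single (Simp.vertex k) 1) = single σ 1 := by
  rw [sPush_single, Simp.aff_vertices, ContinuousMap.comp_id]

theorem sBoundary_push {l : ℕ} (σ : C(Simp l, X)) (k : ℕ) (c : TupleChain (Simp l) (k + 1)) :
    sBoundary X k (sPush σ (k + 1) c) = sPush σ k (tupleBoundary _ k c) := by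
  suffices h : (sBoundary X k).comp (sPush σ (k + 1)) =
      (sPush σ k).comp (tupleBoundary _ k) from LinearMap.congr_fun h c
  ext1 p
  ext1
  simp only [LinearMap.comp_apply, lsingle_apply, sPush_single, sBoundary_single,
    tupleBoundary_single, map_sum, map_zsmul, ContinuousMap.comp_assoc, Simp.face, Simp.aff_comp,
    ← Function.comp_assoc, Simp.aff_comp_vertex]

theorem sPush_comp_aff {l m : ℕ} (σ : C(Simp l, X)) (p : Fin m → Simp l) (k : ℕ)
    (c : TupleChain (Simp m) k) :
    sPush (σ.comp (Simp.aff p)) k c = sPush σ k (tupleMap (Simp.aff p) k c) := by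
  suffices h : sPush (σ.comp (Simp.aff p)) k = (sPush σ k).comp (tupleMap (Simp.aff p) k) from
    LinearMap.congr_fun h c
  ext1 q
  ext1
  simp only [LinearMap.comp_apply, lsingle_apply, sPush_single, tupleMap_single,
    ContinuousMap.comp_assoc, Simp.aff_comp]

/-- Barycentric subdivision of singular chains. -/
def sSubdiv (X : Type*) [TopologicalSpace X] (k : ℕ) : SChain X k →ₗ[ℤ] SChain X k :=
  linearCombination ℤ fun σ => sPush σ k (tupleSubdiv (Simp.bary k) k (single (Simp.vertex k) 1))

/-- The chain homotopy from the identity to barycentric subdivision. -/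
def sHomotopy (X : Type*) [TopologicalSpace X] (k : ℕ) : SChain X k →ₗ[ℤ] SChain X (k + 1) :=
  linearCombination ℤ fun σ =>
    sPush σ (k + 1) (tupleHomotopy (Simp.bary k) k (single (Simp.vertex k) 1))

theorem sSubdiv_single (k : ℕ) (σ : C(Simp k, X)) : sSubdiv X k (single σ 1) =
    sPush σ k (tupleSubdiv (Simp.bary k) k (single (Simp.vertex k) 1)) := by
  simp [sSubdiv]

theorem sHomotopy_single (k : ℕ) (σ : C(Simp k, X)) : sHomotopy X k (single σ 1) =
    sPush σ (k + 1) (tupleHomotopy (Simp.bary k) k (single (Simp.vertex k) 1)) := by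
  simp [sHomotopy]

theorem sSubdiv_push {l : ℕ} (σ : C(Simp l, X)) (k : ℕ) (c : TupleChain (Simp l) k) :
    sSubdiv X k (sPush σ k c) = sPush σ k (tupleSubdiv (Simp.bary l) k c) := by
  suffices h : (sSubdiv X k).comp (sPush σ k) = (sPush σ k).comp (tupleSubdiv (Simp.bary l) k) from
    LinearMap.congr_fun h c
  ext1 p
  ext1
  simp only [LinearMap.comp_apply, lsingle_apply, sPush_single, sSubdiv_single, sPush_comp_aff,
    tupleMap_subdiv (fun _ v => Simp.aff_bary p v), tupleMap_single, Simp.aff_comp_vertex]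

theorem sHomotopy_push {l : ℕ} (σ : C(Simp l, X)) (k : ℕ) (c : TupleChain (Simp l) k) :
    sHomotopy X k (sPush σ k c) = sPush σ (k + 1) (tupleHomotopy (Simp.bary l) k c) := by
  suffices h : (sHomotopy X k).comp (sPush σ k) =
      (sPush σ (k + 1)).comp (tupleHomotopy (Simp.bary l) k) from LinearMap.congr_fun h c
  ext1 p
  ext1
  simp only [LinearMap.comp_apply, lsingle_apply, sPush_single, sHomotopy_single, sPush_comp_aff,
    tupleMap_homotopy (fun _ v => Simp.aff_bary p v), tupleMap_single, Simp.aff_comp_vertex]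

theorem sBoundary_boundary (k : ℕ) (c : SChain X (k + 2)) :
    sBoundary X k (sBoundary X (k + 1) c) = 0 := by
  suffices h : (sBoundary X k).comp (sBoundary X (k + 1)) = 0 from LinearMap.congr_fun h c
  ext1 σ
  ext1
  simp only [LinearMap.comp_apply, lsingle_apply, LinearMap.zero_apply]
  rw [← sPush_vertices, sBoundary_push, sBoundary_push, tupleBoundary_boundary, map_zero]

theorem sBoundary_subdiv (k : ℕ) (c : SChain X (k + 1)) :
    sBoundary X k (sSubdiv X (k + 1) c) = sSubdiv X k (sBoundary X k c) := by
  suffices h : (sBoundary X k).comp (sSubdiv X (k + 1)) = (sSubdiv X k).comp (sBoundary X k) from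
    LinearMap.congr_fun h c
  ext1 σ
  ext1
  simp only [LinearMap.comp_apply, lsingle_apply]
  rw [← sPush_vertices, sSubdiv_push, sBoundary_push, sBoundary_push, sSubdiv_push,
    tupleBoundary_subdiv]

theorem sBoundary_homotopy (k : ℕ) (c : SChain X (k + 1)) :
    sBoundary X (k + 1) (sHomotopy X (k + 1) c) =
      c - sSubdiv X (k + 1) c - sHomotopy X k (sBoundary X k c) := by
  suffices h : (sBoundary X (k + 1)).comp (sHomotopy X (k + 1)) =
      LinearMap.id - sSubdiv X (k + 1) - (sHomotopy X k).comp (sBoundary X k) from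
    LinearMap.congr_fun h c
  ext1 σ
  ext1
  simp only [LinearMap.comp_apply, lsingle_apply, LinearMap.sub_apply, LinearMap.id_apply]
  rw [← sPush_vertices, sSubdiv_push, sHomotopy_push, sBoundary_push, sBoundary_push,
    sHomotopy_push, tupleBoundary_homotopy, map_sub, map_sub]

/-- The chains all of whose simplices lie in `U`. -/
def chainsIn (U : Set X) (k : ℕ) : Submodule ℤ (SChain X k) :=
  supported ℤ ℤ {σ : C(Simp k, X) | Set.range σ ⊆ U}

theorem single_mem_chainsIn {U : Set X} {k : ℕ} {σ : C(Simp k, X)} (h : Set.range σ ⊆ U) :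
    single σ 1 ∈ chainsIn U k :=
  single_mem_supported ℤ _ h

theorem chainsIn_induction {U : Set X} {k : ℕ} {M : Submodule ℤ (SChain X k)}
    (h : ∀ σ : C(Simp k, X), Set.range σ ⊆ U → single σ 1 ∈ M) : chainsIn U k ≤ M := by
  rw [chainsIn, supported_eq_span_single, Submodule.span_le]
  rintro _ ⟨σ, hσ, rfl⟩
  exact h σ hσ

theorem sPush_mem_chainsIn {U : Set X} {l : ℕ} {σ : C(Simp l, X)} (h : Set.range σ ⊆ U) (k : ℕ)
    (c : TupleChain (Simp l) k) : sPush σ k c ∈ chainsIn U k := by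
  induction c using Finsupp.induction_linear with
  | zero => simp
  | add f g hf hg =>
    rw [map_add]
    exact add_mem hf hg
  | single p a =>
    rw [← mul_one a, ← smul_eq_mul, ← smul_single, map_zsmul, sPush_single]
    refine Submodule.smul_mem _ _ (single_mem_chainsIn ?_)
    rw [ContinuousMap.coe_comp]
    exact (Set.range_comp_subset_range _ _).trans h

theorem sBoundary_mem_chainsIn {U : Set X} {k : ℕ} {c : SChain X (k + 1)}
    (hc : c ∈ chainsIn U (k + 1)) : sBoundary X k c ∈ chainsIn U k :=
  chainsIn_induction (M := (chainsIn U k).comap (sBoundary X k)) (fun σ hσ => by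
    rw [Submodule.mem_comap, ← sPush_vertices, sBoundary_push]
    exact sPush_mem_chainsIn hσ _ _) hc

theorem sSubdiv_mem_chainsIn {U : Set X} {k : ℕ} {c : SChain X k}
    (hc : c ∈ chainsIn U k) : sSubdiv X k c ∈ chainsIn U k :=
  chainsIn_induction (M := (chainsIn U k).comap (sSubdiv X k)) (fun σ hσ => by
    rw [Submodule.mem_comap, ← sPush_vertices, sSubdiv_push]
    exact sPush_mem_chainsIn hσ _ _) hc

theorem sHomotopy_mem_chainsIn {U : Set X} {k : ℕ} {c : SChain X k}
    (hc : c ∈ chainsIn U k) : sHomotopy X k c ∈ chainsIn U (k + 1) :=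
  chainsIn_induction (M := (chainsIn U (k + 1)).comap (sHomotopy X k)) (fun σ hσ => by
    rw [Submodule.mem_comap, ← sPush_vertices, sHomotopy_push]
    exact sPush_mem_chainsIn hσ _ _) hc

/-- On a cycle the homotopy formula reads ∂D z = z − Sd z; the bounding chains of successive
subdivisions add up, and none of them leaves `U`. -/
theorem exists_sBoundary_eq_sub_iterate_sSubdiv {U : Set X} {k : ℕ} {z : SChain X (k + 1)}
    (hz : z ∈ chainsIn U (k + 1)) (hd : sBoundary X k z = 0) (n : ℕ) :
    (sSubdiv X (k + 1))^[n] z ∈ chainsIn U (k + 1) ∧ sBoundary X k ((sSubdiv X (k + 1))^[n] z) = 0 ∧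
    ∃ w ∈ chainsIn U (k + 2), sBoundary X (k + 1) w = z - (sSubdiv X (k + 1))^[n] z := by
  induction n with
  | zero => exact ⟨hz, hd, 0, zero_mem _, by simp⟩
  | succ n ih =>
    obtain ⟨h1, h2, w, hw, hdw⟩ := ih
    rw [Function.iterate_succ_apply']
    refine ⟨sSubdiv_mem_chainsIn h1, by rw [sBoundary_subdiv, h2, map_zero],
      w + sHomotopy X (k + 1) ((sSubdiv X (k + 1))^[n] z),
      add_mem hw (sHomotopy_mem_chainsIn h1), ?_⟩
    rw [map_add, hdw, sBoundary_homotopy, h2, map_zero]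
    abel

theorem iterate_sSubdiv_push {l : ℕ} (σ : C(Simp l, X)) (k : ℕ) (c : TupleChain (Simp l) k)
    (n : ℕ) : (sSubdiv X k)^[n] (sPush σ k c) =
      sPush σ k ((tupleSubdiv (Simp.bary l) k)^[n] c) := by
  induction n with
  | zero => rfl
  | succ n ih => rw [Function.iterate_succ_apply', ih, sSubdiv_push, Function.iterate_succ_apply']

/-- Iterated subdivisions of a singular simplex become small with respect to an open cover. -/
theorem eventually_iterate_sSubdiv_single_mem {U V : Set X} (hU : IsOpen U) (hV : IsOpen V) (k : ℕ)
    (σ : C(Simp k, X)) (hσ : Set.range σ ⊆ U ∪ V) :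
    ∀ᶠ n in atTop, (sSubdiv X k)^[n] (single σ 1) ∈ chainsIn U k ⊔ chainsIn V k := by
  -- The pulled-back cover of the compact simplex has a Lebesgue number δ; subdivisions with
  -- vertices less than δ apart are subordinate to it.
  obtain ⟨δ, hδ, h⟩ := lebesgue_number_lemma_of_metric (s := (Set.univ : Set (Simp k)))
    (c := fun b : Bool => σ ⁻¹' (if b then U else V)) isCompact_univ
    (fun b => by
      cases b
      · exact hV.preimage σ.continuous
      · exact hU.preimage σ.continuous)
    (fun x _ => by
      rcases hσ (Set.mem_range_self x) with h | h
      · exact Set.mem_iUnion.2 ⟨true, h⟩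
      · exact Set.mem_iUnion.2 ⟨false, h⟩)
  obtain ⟨D, hD⟩ := Metric.isBounded_iff.1 (isCompact_univ (X := Simp k)).isBounded
  have hlim : Tendsto (fun n : ℕ => ((k : ℝ) / (k + 1)) ^ n * D) atTop (nhds (0 * D)) :=
    (tendsto_pow_atTop_nhds_zero_of_lt_one (by positivity)
      ((div_lt_one (by positivity)).2 (lt_add_one _))).mul_const D
  rw [zero_mul] at hlim
  filter_upwards [hlim.eventually (gt_mem_nhds hδ)] with n hn
  rw [← sPush_vertices, iterate_sSubdiv_push]
  have hmem := Simp.subdiv_iterate_mem k D n (single (Simp.vertex k) 1)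
    (single_mem_supported ℤ _ fun i j => hD (Set.mem_univ _) (Set.mem_univ _))
  refine (Submodule.map_le_iff_le_comap.2 ?_) (Submodule.mem_map_of_mem hmem)
  rw [supported_eq_span_single, Submodule.span_le]
  rintro _ ⟨q, hq, rfl⟩
  simp only [Submodule.comap_coe, Set.mem_preimage, SetLike.mem_coe, sPush_single]
  -- The simplex without vertices is empty, since its coordinates would sum to 0 instead of 1. It
  -- must be treated apart because `q 0` serves as the centre of the ball otherwise.
  rcases k with _ | k
  · refine Submodule.mem_sup_left (single_mem_chainsIn ?_)
    rintro _ ⟨t, rfl⟩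
    have := t.2.2
    simp at this
  · obtain ⟨b, hb⟩ := h (q 0) (Set.mem_univ _)
    have hr : Set.range (σ.comp (Simp.aff q)) ⊆ if b then U else V := by
      rintro _ ⟨t, rfl⟩
      refine hb (Metric.mem_ball.2 ?_)
      exact (Simp.dist_aff_le_of_forall q t (q 0) fun i => hq i 0).trans_lt hn
    cases b
    · exact Submodule.mem_sup_right (single_mem_chainsIn hr)
    · exact Submodule.mem_sup_left (single_mem_chainsIn hr)

theorem exists_iterate_sSubdiv_mem {U V : Set X} (hU : IsOpen U) (hV : IsOpen V) (k : ℕ)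
    {c : SChain X k} (hc : c ∈ chainsIn (U ∪ V) k) :
    ∃ n, (sSubdiv X k)^[n] c ∈ chainsIn U k ⊔ chainsIn V k := by
  -- Asking for all large n, rather than for some n, makes the condition stable under sums, so it
  -- may be checked on single simplices.
  let M : Submodule ℤ (SChain X k) :=
    { carrier := {c | ∀ᶠ n in atTop, (sSubdiv X k)^[n] c ∈ chainsIn U k ⊔ chainsIn V k}
      add_mem' := fun {a b} ha hb => by
        filter_upwards [ha, hb] with n h1 h2
        rw [iterate_map_add]
        exact add_mem h1 h2
      zero_mem' := Eventually.of_forall fun n => by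
        rw [iterate_map_zero]
        exact zero_mem _
      smul_mem' := fun m a ha => by
        filter_upwards [ha] with n h1
        rw [iterate_map_zsmul]
        exact Submodule.smul_mem _ _ h1 }
  exact (chainsIn_induction (M := M)
    (eventually_iterate_sSubdiv_single_mem hU hV k) hc).exists

/-- The reduced singular homology of the subspace `U` vanishes in degree `k`. -/
def AcyclicIn (U : Set X) (k : ℕ) : Prop :=
  ∀ z ∈ chainsIn U (k + 1), sBoundary X k z = 0 → ∃ y ∈ chainsIn U (k + 2), sBoundary X (k + 1) y = z

theorem acyclicIn_empty : AcyclicIn (∅ : Set X) 0 := by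
  intro z hz _
  refine ⟨0, zero_mem _, ?_⟩
  have h : {σ : C(Simp (0 + 1), X) | Set.range σ ⊆ ∅} = ∅ := by
    ext σ
    simp only [Set.mem_ofPred_eq, Set.mem_empty_iff_false, iff_false, Set.subset_empty_iff]
    exact (Set.range_nonempty_iff_nonempty.2 ⟨Simp.vertex 1 0⟩).ne_empty
  rw [chainsIn, h, supported_empty, Submodule.mem_bot] at hz
  rw [hz, map_zero]

/-- Vanishing of homology from the Mayer–Vietoris sequence. -/
theorem AcyclicIn.union {U V : Set X} (hU : IsOpen U) (hV : IsOpen V) {k : ℕ}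
    (h1 : AcyclicIn U (k + 1)) (h2 : AcyclicIn V (k + 1)) (h12 : AcyclicIn (U ∩ V) k) :
    AcyclicIn (U ∪ V) (k + 1) := by
  intro z hz hd
  obtain ⟨n, hn⟩ := exists_iterate_sSubdiv_mem hU hV _ hz
  obtain ⟨-, hd', w, hw, hdw⟩ := exists_sBoundary_eq_sub_iterate_sSubdiv hz hd n
  obtain ⟨u, hu, v, hv, huv⟩ := Submodule.mem_sup.1 hn
  rw [← huv, map_add, add_eq_zero_iff_eq_neg] at hd'
  -- The boundary of `u` equals minus that of `v`, so it lies in both subcomplexes. If x bounds it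
  -- inside the intersection, then u − x and v + x are cycles in `U` and `V` with the same sum as u
  -- and v.
  have hmem : sBoundary X (k + 1) u ∈ chainsIn (U ∩ V) (k + 1) := by
    have ha := sBoundary_mem_chainsIn hu
    have hb : sBoundary X (k + 1) u ∈ chainsIn V (k + 1) := by
      rw [hd']
      exact neg_mem (sBoundary_mem_chainsIn hv)
    rw [chainsIn, mem_supported] at ha hb ⊢
    exact fun σ hσ => Set.subset_inter (ha hσ) (hb hσ)
  have hmono : ∀ {W W' : Set X} (k : ℕ), W ⊆ W' → chainsIn W k ≤ chainsIn W' k := fun k h =>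
    supported_mono fun σ (hσ : Set.range σ ⊆ _) => hσ.trans h
  obtain ⟨x, hx, hdx⟩ := h12 _ hmem (sBoundary_boundary _ _)
  obtain ⟨a, ha, hda⟩ := h1 (u - x) (sub_mem hu (hmono _ Set.inter_subset_left hx))
    (by rw [map_sub, hdx, sub_self])
  obtain ⟨b, hb, hdb⟩ := h2 (v + x) (add_mem hv (hmono _ Set.inter_subset_right hx))
    (by rw [map_add, hdx, hd', add_neg_cancel])
  refine ⟨w + a + b, add_mem (add_mem hw (hmono _ Set.subset_union_left ha))
    (hmono _ Set.subset_union_right hb), ?_⟩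
  rw [map_add, map_add, hdw, hda, hdb, ← huv]
  abel

/-- Homology is invariant under embeddings. -/
theorem AcyclicIn.image {Y : Type*} [TopologicalSpace Y] {A : Set X} {k : ℕ} (h : AcyclicIn A k)
    {j : C(X, Y)} (hj : Topology.IsEmbedding j) : AcyclicIn (j '' A) k := by
  let J : ∀ k, SChain X k →ₗ[ℤ] SChain Y k := fun k => lmapDomain ℤ ℤ fun σ => j.comp σ
  have hJs : ∀ k (σ : C(Simp k, X)), J k (single σ 1) = single (j.comp σ) 1 := fun k σ => by
    simp [J]
  have hJd : ∀ k c, sBoundary Y k (J (k + 1) c) = J k (sBoundary X k c) := fun k c => by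
    suffices h : (sBoundary Y k).comp (J (k + 1)) = (J k).comp (sBoundary X k) from
      LinearMap.congr_fun h c
    ext1 σ
    ext1
    simp only [LinearMap.comp_apply, lsingle_apply, hJs, sBoundary_single, map_sum, map_zsmul,
      ContinuousMap.comp_assoc]
  have hJi : ∀ k, Function.Injective (J k) := fun k => mapDomain_injective fun σ τ hστ =>
    ContinuousMap.ext fun t => hj.injective (DFunLike.congr_fun hστ t)
  -- A simplex in the image lifts pointwise, and the lift is continuous because `j` is an embedding.
  have hJsurj : ∀ k, chainsIn (j '' A) k ≤ (chainsIn A k).map (J k) := fun k =>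
    chainsIn_induction fun σ hσ => by
      have hlift : ∀ t, ∃ x ∈ A, j x = σ t := fun t => hσ (Set.mem_range_self t)
      choose τ hτA hτ using hlift
      have hcont : Continuous τ := by
        rw [hj.continuous_iff]
        convert! σ.continuous using 1
        exact funext hτ
      refine ⟨single ⟨τ, hcont⟩ 1, single_mem_chainsIn (Set.range_subset_iff.2 hτA), ?_⟩
      rw [hJs]
      congr 1
      exact ContinuousMap.ext hτ
  intro z hz hd
  obtain ⟨w, hw, rfl⟩ := hJsurj _ hz
  rw [hJd, ← map_zero (J k)] at hd
  obtain ⟨y, hy, rfl⟩ := h w hw (hJi _ hd)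
  refine ⟨J _ y, ?_, hJd _ _⟩
  exact chainsIn_induction (M := (chainsIn (j '' A) _).comap (J _)) (fun σ hσ => by
    rw [Submodule.mem_comap, hJs]
    refine single_mem_chainsIn ?_
    rw [ContinuousMap.coe_comp, Set.range_comp]
    exact Set.image_mono hσ) hy

end SingularChains

end

noncomputable section

/-! ### Star-shaped sets are acyclic -/

section StarShaped

open Finsupp

variable {V : Type*} [NormedAddCommGroup V]

theorem Simp.face_apply_succAbove {k : ℕ} (i : Fin (k + 1)) (t : Simp k) (j : Fin k) :
    Simp.face k i t (i.succAbove j) = t j := by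
  simp [Simp.face, Simp.aff_apply, Simp.vertex_apply]

theorem Simp.face_apply_self {k : ℕ} (i : Fin (k + 1)) (t : Simp k) : Simp.face k i t i = 0 := by
  simp [Simp.face, Simp.aff_apply, Simp.vertex_apply, Fin.ne_succAbove]

theorem Simp.face_zero_apply_succ {k : ℕ} (t : Simp k) (j : Fin k) :
    Simp.face k 0 t j.succ = t j := by
  simpa using Simp.face_apply_succAbove 0 t j

theorem Simp.face_succ_apply_zero {k : ℕ} (i : Fin (k + 1)) (t : Simp (k + 1)) :
    Simp.face (k + 1) i.succ t 0 = t 0 := by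
  simpa using Simp.face_apply_succAbove i.succ t 0

/-- Extension by zero of a map on the standard simplex. -/
def Simp.extend {k : ℕ} (σ : C(Simp k, V)) (y : Fin k → ℝ) : V :=
  open Classical in if h : y ∈ stdSimplex ℝ (Fin k) then σ ⟨y, h⟩ else 0

theorem Simp.extend_coe {k : ℕ} (σ : C(Simp k, V)) (y : Simp k) : Simp.extend σ y.1 = σ y :=
  dif_pos y.2

theorem Simp.continuousOn_extend {k : ℕ} (σ : C(Simp k, V)) :
    ContinuousOn (Simp.extend σ) (stdSimplex ℝ (Fin k)) := by
  rw [continuousOn_iff_continuous_domRestrict]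
  convert! σ.continuous using 1
  funext y
  exact Simp.extend_coe σ y

/-- The normalized projection of a simplex to the face opposite to the first vertex. -/
def Simp.proj {k : ℕ} (t : Simp (k + 1)) : Fin k → ℝ := fun j => (1 - t 0)⁻¹ * t j.succ

theorem Simp.sum_tail {k : ℕ} (t : Simp (k + 1)) : ∑ j : Fin k, t j.succ = 1 - t 0 := by
  have h : ∑ j, t j = 1 := t.2.2
  rw [Fin.sum_univ_succ] at h
  linarith

theorem Simp.apply_zero_le {k : ℕ} (t : Simp (k + 1)) : 0 ≤ 1 - t 0 := by
  rw [← Simp.sum_tail]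
  exact Finset.sum_nonneg fun j _ => t.2.1 _

theorem Simp.proj_mem {k : ℕ} {t : Simp (k + 1)} (h : 1 - t 0 ≠ 0) :
    Simp.proj t ∈ stdSimplex ℝ (Fin k) := by
  refine ⟨fun j => mul_nonneg (inv_nonneg.2 (Simp.apply_zero_le t)) (t.2.1 _), ?_⟩
  simp only [Simp.proj]
  rw [← Finset.mul_sum, Simp.sum_tail, inv_mul_cancel₀ h]

theorem Simp.continuous_apply {k : ℕ} (j : Fin k) : Continuous fun t : Simp k => t j :=
  (_root_.continuous_apply j).comp continuous_subtype_val

variable [NormedSpace ℝ V]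

/-- The cone over a singular simplex in a vector space. -/
def Simp.cone (c : V) {k : ℕ} (σ : C(Simp k, V)) : C(Simp (k + 1), V) where
  toFun t := t 0 • c + (1 - t 0) • Simp.extend σ (Simp.proj t)
  continuous_toFun := by
    refine ((Simp.continuous_apply 0).smul continuous_const).add ?_
    rw [continuous_iff_continuousAt]
    intro t
    have h0 : Continuous fun t : Simp (k + 1) => 1 - t 0 :=
      continuous_const.sub (Simp.continuous_apply 0)
    by_cases ht : 1 - t 0 = 0
    -- At the apex the projection to the base need not converge, but σ is bounded on a compact
    -- simplex and the factor 1 − t₀ tends to 0.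
    · obtain ⟨M, hM⟩ := Metric.isBounded_iff_subset_closedBall (0 : V) |>.1
        (isCompact_range σ.continuous).isBounded
      have hb : ∀ s : Simp (k + 1), ‖(1 - s 0) • Simp.extend σ (Simp.proj s)‖ ≤ (1 - s 0) * M := by
        intro s
        rw [norm_smul, Real.norm_of_nonneg (Simp.apply_zero_le s)]
        by_cases hs : 1 - s 0 = 0
        · rw [hs, zero_mul, zero_mul]
        · refine mul_le_mul_of_nonneg_left ?_ (Simp.apply_zero_le s)
          have := hM (Set.mem_range_self (f := σ) ⟨_, Simp.proj_mem hs⟩)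
          rw [mem_closedBall_zero_iff] at this
          rwa [Simp.extend, dif_pos (Simp.proj_mem hs)]
      rw [ContinuousAt, ht, zero_smul]
      refine squeeze_zero_norm hb ?_
      have := (h0.tendsto t).mul_const M
      rwa [ht, zero_mul] at this
    · refine h0.continuousAt.smul ?_
      have hU : IsOpen {s : Simp (k + 1) | 1 - s 0 ≠ 0} := isOpen_ne_fun h0 continuous_const
      have hp : ContinuousOn (Simp.proj : Simp (k + 1) → Fin k → ℝ)
          {s : Simp (k + 1) | 1 - s 0 ≠ 0} :=
        continuousOn_pi.2 fun j => (h0.continuousOn.inv₀ fun s hs => hs).mul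
          (Simp.continuous_apply _).continuousOn
      exact ((Simp.continuousOn_extend σ).comp hp fun s hs => Simp.proj_mem hs).continuousAt
        (hU.mem_nhds ht)

theorem Simp.cone_apply (c : V) {k : ℕ} (σ : C(Simp k, V)) (t : Simp (k + 1)) :
    Simp.cone c σ t = t 0 • c + (1 - t 0) • Simp.extend σ (Simp.proj t) := rfl

theorem Simp.cone_comp_face_zero (c : V) {k : ℕ} (σ : C(Simp k, V)) :
    (Simp.cone c σ).comp (Simp.face k 0) = σ := by
  ext t
  have h : Simp.proj (Simp.face k 0 t) = t.1 := by
    funext j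
    rw [Simp.proj, Simp.face_apply_self, sub_zero, inv_one, one_mul, Simp.face_zero_apply_succ]
    rfl
  rw [ContinuousMap.comp_apply, Simp.cone_apply, Simp.face_apply_self, h, Simp.extend_coe,
    zero_smul, sub_zero, one_smul, zero_add]

/-- Away from the apex, taking this face commutes with projecting to the base; at the apex both
sides equal `c`. -/
theorem Simp.cone_comp_face_succ (c : V) {k : ℕ} (σ : C(Simp (k + 1), V)) (i : Fin (k + 1)) :
    (Simp.cone c σ).comp (Simp.face (k + 1) i.succ) = Simp.cone c (σ.comp (Simp.face k i)) := by
  ext t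
  rw [ContinuousMap.comp_apply, Simp.cone_apply, Simp.cone_apply, Simp.face_succ_apply_zero]
  by_cases ht : 1 - t 0 = 0
  · rw [ht, zero_smul, zero_smul]
  · have h : Simp.proj (Simp.face (k + 1) i.succ t) =
        (Simp.face k i ⟨Simp.proj t, Simp.proj_mem ht⟩).1 := by
      funext j
      change _ = Simp.face k i ⟨Simp.proj t, Simp.proj_mem ht⟩ j
      rw [Simp.proj, Simp.face_succ_apply_zero]
      refine Fin.succAboveCases i ?_ (fun j => ?_) j
      · rw [Simp.face_apply_self, Simp.face_apply_self, mul_zero]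
      · rw [Simp.face_apply_succAbove, ← Fin.succ_succAbove_succ, Simp.face_apply_succAbove]
        rfl
    rw [h, Simp.extend_coe, Simp.extend, dif_pos (Simp.proj_mem ht)]
    rfl

/-- Coning off with apex `c` is a contraction of the augmented chain complex, and star-convexity
keeps the cones inside `A`. -/
theorem acyclicIn_of_starConvex {A : Set V} {c : V} (hA : StarConvex ℝ c A) (hc : c ∈ A) (k : ℕ) :
    AcyclicIn A k := by
  let K : ∀ k, SChain V k →ₗ[ℤ] SChain V (k + 1) := fun k => lmapDomain ℤ ℤ (Simp.cone c)
  have hK : ∀ k (σ : C(Simp k, V)), K k (single σ 1) = single (Simp.cone c σ) 1 := fun k σ => by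
    simp [K]
  have hd : ∀ z, sBoundary V (k + 1) (K (k + 1) z) = z - K k (sBoundary V k z) := fun z => by
    suffices h : (sBoundary V (k + 1)).comp (K (k + 1)) =
        LinearMap.id - (K k).comp (sBoundary V k) from LinearMap.congr_fun h z
    ext1 σ
    ext1
    simp only [LinearMap.comp_apply, lsingle_apply, hK, sBoundary_single, LinearMap.sub_apply,
      LinearMap.id_apply, map_sum, map_zsmul]
    rw [Fin.sum_univ_succ, sub_eq_add_neg, ← Finset.sum_neg_distrib]
    congr 1
    · rw [Simp.cone_comp_face_zero, Fin.val_zero, pow_zero, one_smul]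
    · refine Finset.sum_congr rfl fun i _ => ?_
      rw [Simp.cone_comp_face_succ, Fin.val_succ, pow_succ, mul_neg_one, neg_smul]
  intro z hz hdz
  refine ⟨K _ z, ?_, by rw [hd, hdz, map_zero, sub_zero]⟩
  refine chainsIn_induction (M := (chainsIn A _).comap (K _)) (fun σ hσ => ?_) hz
  rw [Submodule.mem_comap, hK]
  refine single_mem_chainsIn ?_
  rintro _ ⟨t, rfl⟩
  rw [Simp.cone_apply]
  by_cases ht : 1 - t 0 = 0
  · rw [ht, zero_smul, add_zero, ← sub_eq_zero.1 ht, one_smul]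
    exact hc
  · rw [Simp.extend, dif_pos (Simp.proj_mem ht)]
    exact hA (hσ (Set.mem_range_self _)) (t.2.1 0) (Simp.apply_zero_le t) (by ring)

end StarShaped

/-! ### The third homology of the projective line -/

/-- The degree falls by one at each Mayer–Vietoris step: degree 2 for the punctured plane, degree 1
for the two half-planes in which opposite slit planes meet, degree 0 for the empty intersection of
these. -/
theorem acyclicIn_compl_zero : AcyclicIn ({0}ᶜ : Set ℂ) 2 := by
  have hs : StarConvex ℝ (1 : ℂ) Complex.slitPlane := Complex.starConvex_one_slitPlane
  have hs' : StarConvex ℝ (-1 : ℂ) (-Complex.slitPlane) := by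
    intro y hy a b ha hb hab
    have := hs (Set.mem_neg.1 hy) ha hb hab
    rw [Set.mem_neg]
    convert! this using 1
    simp [add_comm]
  have hup : AcyclicIn {z : ℂ | 0 < z.im} 1 :=
    acyclicIn_of_starConvex ((convex_halfSpace_im_gt 0).starConvex (x := Complex.I) (by simp))
      (by simp) _
  have hdown : AcyclicIn {z : ℂ | z.im < 0} 1 :=
    acyclicIn_of_starConvex ((convex_halfSpace_im_lt 0).starConvex (x := -Complex.I) (by simp))
      (by simp) _
  have hint : AcyclicIn (Complex.slitPlane ∩ -Complex.slitPlane) 1 := by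
    have h : Complex.slitPlane ∩ -Complex.slitPlane = {z : ℂ | 0 < z.im} ∪ {z : ℂ | z.im < 0} := by
      ext z
      simp only [Set.mem_inter_iff, Complex.mem_slitPlane_iff, Set.mem_neg, Complex.neg_re,
        Complex.neg_im, Set.mem_union, Set.mem_ofPred_eq]
      constructor
      · rintro ⟨h1 | h1, h2 | h2⟩
        · linarith
        · exact (lt_or_gt_of_ne (neg_ne_zero.1 h2)).symm
        · exact (lt_or_gt_of_ne h1).symm
        · exact (lt_or_gt_of_ne h1).symm
      · rintro (h | h)
        · exact ⟨Or.inr h.ne', Or.inr (neg_ne_zero.2 h.ne')⟩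
        · exact ⟨Or.inr h.ne, Or.inr (neg_ne_zero.2 h.ne)⟩
    rw [h]
    refine AcyclicIn.union (isOpen_lt continuous_const Complex.continuous_im)
      (isOpen_lt Complex.continuous_im continuous_const) hup hdown ?_
    have he : {z : ℂ | 0 < z.im} ∩ {z : ℂ | z.im < 0} = ∅ := by
      ext z
      simp only [Set.mem_inter_iff, Set.mem_ofPred_eq, Set.mem_empty_iff_false, iff_false, not_and,
        not_lt]
      exact le_of_lt
    rw [he]
    exact acyclicIn_empty
  have h : ({0}ᶜ : Set ℂ) = Complex.slitPlane ∪ -Complex.slitPlane := by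
    ext z
    simp only [Set.mem_compl_iff, Set.mem_singleton_iff, Set.mem_union, Complex.mem_slitPlane_iff,
      Set.mem_neg, Complex.neg_re, Complex.neg_im, Complex.ext_iff, Complex.zero_re,
      Complex.zero_im]
    constructor
    · intro h
      by_cases him : z.im = 0
      · rcases lt_or_gt_of_ne (fun hre => h ⟨hre, him⟩ : z.re ≠ 0) with h | h
        · exact Or.inr (Or.inl (by linarith))
        · exact Or.inl (Or.inl h)
      · exact Or.inl (Or.inr him)
    · rintro ((h | h) | (h | h)) ⟨h1, h2⟩ <;> simp_all
  rw [h]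
  exact AcyclicIn.union Complex.isOpen_slitPlane Complex.isOpen_slitPlane.neg
    (acyclicIn_of_starConvex hs (by simp) _) (acyclicIn_of_starConvex hs' (by simp) _) hint

theorem P1.isOpenEmbedding_affineChart_symm (i : Fin 2) :
    Topology.IsOpenEmbedding (P1.affineChart i).symm :=
  (P1.affineChart i).symm.isOpenEmbedding rfl

/-- The affine space in the projective line. -/
def P1.affineMap (i : Fin 2) : C(ℂ, P1) :=
  ⟨(P1.affineChart i).symm, (P1.isOpenEmbedding_affineChart_symm i).continuous⟩

theorem P1.range_affineMap (i : Fin 2) : P1.affineMap i '' Set.univ = P1.affineSet i :=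
  (P1.affineChart i).symm_image_target_eq_source

theorem P1.affineSet_union : P1.affineSet 0 ∪ P1.affineSet 1 = Set.univ := by
  refine Set.eq_univ_of_forall fun p => ?_
  by_contra h
  simp only [Set.mem_union, P1.affineSet, Set.mem_ofPred_eq, not_or, not_not] at h
  exact p.rep_nonzero (funext fun k => by
    fin_cases k
    · exact h.1
    · exact h.2)

theorem P1.affineMap_image_compl : P1.affineMap 0 '' {0}ᶜ = P1.affineSet 0 ∩ P1.affineSet 1 := by
  have hmem : ∀ z : ℂ, P1.affineMap 0 z ∈ P1.affineSet 1 ↔ z ≠ 0 := fun z => by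
    rw [show P1.affineMap 0 z = Projectivization.mk ℂ (P1.affineVec 0 z)
      (P1.affineVec_ne_zero 0 z) from rfl, P1.mk_mem_affineSet]
    rw [show (1 : Fin 2) = 0 + 1 from rfl, P1.affineVec_other]
  rw [← P1.range_affineMap 0]
  ext p
  constructor
  · rintro ⟨z, hz, rfl⟩
    exact ⟨⟨z, trivial, rfl⟩, (hmem z).2 hz⟩
  · rintro ⟨⟨z, -, rfl⟩, h⟩
    exact ⟨z, (hmem z).1 h, rfl⟩

/-- The two affine lines are contractible and meet in a punctured plane, so degree 3 is reduced to
degree 2 there. -/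
theorem P1.acyclicIn_univ : AcyclicIn (Set.univ : Set P1) 3 := by
  have hc : ∀ i, AcyclicIn (P1.affineSet i) 3 := fun i => by
    rw [← P1.range_affineMap i]
    exact (acyclicIn_of_starConvex ((convex_univ (𝕜 := ℝ) (E := ℂ)).starConvex (x := 0) trivial)
      trivial 3).image
      (P1.isOpenEmbedding_affineChart_symm i).isEmbedding
  rw [← P1.affineSet_union]
  refine AcyclicIn.union (P1.isOpen_affineSet 0) (P1.isOpen_affineSet 1) (hc 0) (hc 1) ?_
  rw [← P1.affineMap_image_compl]
  exact acyclicIn_compl_zero.image (P1.isOpenEmbedding_affineChart_symm 0).isEmbedding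

end

noncomputable section

/-! ### Comparison with the singular homology of Mathlib -/

section Comparison

open CategoryTheory Limits AlgebraicTopology Finsupp Simplicial

universe v

variable (X : TopCat.{v})

/-- The integers, as a coefficient module. -/
abbrev coeffZ : ModuleCat.{v} ℤ := ModuleCat.of ℤ (ULift.{v} ℤ)

/-- The comparison from concrete singular chains. -/
def singularComparison (n : ℕ) :
    SChain X (n + 1) →ₗ[ℤ] ((TopCat.toSSet.obj X).chainComplex coeffZ.{v}).X n :=
  linearCombination ℤ fun σ =>
    ((TopCat.toSSet.obj X).ιChainComplex (n := n) (R := coeffZ.{v})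
      ((X.toSSetObjEquiv (.op ⦋n⦌)).symm σ)).hom ⟨1⟩

theorem singularComparison_single (n : ℕ) (σ : C(Simp (n + 1), X)) :
    singularComparison X n (single σ 1) =
    ((TopCat.toSSet.obj X).ιChainComplex (n := n) (R := coeffZ.{v})
      ((X.toSSetObjEquiv (.op ⦋n⦌)).symm σ)).hom ⟨1⟩ := by
  rw [singularComparison, linearCombination_single]
  exact @one_smul ℤ _ _ (ModuleCat.isModule _).toMulAction _

/-- The inverse of the comparison. -/
def singularComparisonInv (n : ℕ) :
    ((TopCat.toSSet.obj X).chainComplex coeffZ.{v}).X n ⟶ ModuleCat.of ℤ (SChain X (n + 1)) :=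
  ((TopCat.toSSet.obj X).isColimitChainComplexXCofan coeffZ.{v} n).desc
    (Cofan.mk _ fun x => ModuleCat.ofHom
      ((lsingle (X.toSSetObjEquiv (.op ⦋n⦌) x)).comp ULift.moduleEquiv.toLinearMap))

theorem singularComparisonInv_ι (n : ℕ) (x : (TopCat.toSSet.obj X) _⦋n⦌) :
    (TopCat.toSSet.obj X).ιChainComplex x ≫ singularComparisonInv X n =
    ModuleCat.ofHom
      ((lsingle (X.toSSetObjEquiv (.op ⦋n⦌) x)).comp ULift.moduleEquiv.toLinearMap) :=
  ((TopCat.toSSet.obj X).isColimitChainComplexXCofan coeffZ.{v} n).fac _ ⟨x⟩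

theorem singularComparisonInv_comparison (n : ℕ) (c : SChain X (n + 1)) :
    (singularComparisonInv X n).hom (singularComparison X n c) = c := by
  suffices h : (singularComparisonInv X n).hom.comp (singularComparison X n) = LinearMap.id from
    LinearMap.congr_fun h c
  ext1 σ
  ext1
  simp only [LinearMap.comp_apply, lsingle_apply, singularComparison_single, LinearMap.id_apply]
  have h := congrArg (fun f => f.hom ⟨1⟩)
    (singularComparisonInv_ι X n ((X.toSSetObjEquiv (.op ⦋n⦌)).symm σ))
  refine h.trans ?_
  simp

theorem singularComparison_comparisonInv (n : ℕ)
    (c : ((TopCat.toSSet.obj X).chainComplex coeffZ.{v}).X n) :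
    singularComparison X n ((singularComparisonInv X n).hom c) = c := by
  suffices h : singularComparisonInv X n ≫ ModuleCat.ofHom (singularComparison X n) = 𝟙 _ from
    congrArg (fun f => f.hom c) h
  refine SSet.chainComplex_hom_ext fun x => ?_
  rw [← Category.assoc, singularComparisonInv_ι, Category.comp_id]
  ext a
  obtain ⟨a⟩ := a
  simp only [ModuleCat.hom_comp, ModuleCat.hom_ofHom, LinearMap.comp_apply]
  have h : lsingle (R := ℤ) (M := ℤ) (X.toSSetObjEquiv (.op ⦋n⦌) x)
      (ULift.moduleEquiv.toLinearMap (R := ℤ) (⟨a⟩ : ULift.{v} ℤ)) =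
      a • single (X.toSSetObjEquiv (.op ⦋n⦌) x) 1 := by
    rw [smul_single, smul_eq_mul, mul_one]
    rfl
  refine (congrArg _ h).trans ?_
  rw [map_zsmul, singularComparison_single, Equiv.symm_apply_apply, ← map_zsmul]
  congr 1
  exact congrArg ULift.up (by simp)

/-- Both face maps are given by the same push-forward of barycentric coordinates, one as a sum over
a fibre and the other as an affine combination of vertices. -/
theorem toSSetObjEquiv_symm_δ (n : ℕ) (σ : C(Simp (n + 2), X)) (i : Fin (n + 2)) :
    (TopCat.toSSet.obj X).δ i ((X.toSSetObjEquiv (.op ⦋n + 1⦌)).symm σ) =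
      (X.toSSetObjEquiv (.op ⦋n⦌)).symm (σ.comp (Simp.face (n + 1) i)) := by
  rw [Equiv.eq_symm_apply]
  ext t
  change σ _ = σ _
  congr 1
  ext j
  change stdSimplex.map _ t j = _
  rw [stdSimplex.map_coe, FunOnFinite.linearMap_apply_apply, Simp.face, Simp.aff_apply,
    Finset.sum_filter]
  refine Finset.sum_congr rfl fun a _ => ?_
  rw [Function.comp_apply, Simp.vertex_apply, mul_ite, mul_one, mul_zero]
  exact if_congr eq_comm rfl rfl

theorem singularComparison_d (n : ℕ) (c : SChain X (n + 2)) :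
    (((TopCat.toSSet.obj X).chainComplex coeffZ.{v}).d (n + 1) n).hom
      (singularComparison X (n + 1) c) = singularComparison X n (sBoundary X (n + 1) c) := by
  suffices h : (((TopCat.toSSet.obj X).chainComplex coeffZ.{v}).d (n + 1) n).hom.comp
      (singularComparison X (n + 1)) = (singularComparison X n).comp (sBoundary X (n + 1)) from
    LinearMap.congr_fun h c
  ext1 σ
  ext1
  simp only [LinearMap.comp_apply, lsingle_apply, singularComparison_single, sBoundary_single,
    map_sum, map_zsmul]
  have h := congrArg (fun f => f.hom ⟨1⟩) ((TopCat.toSSet.obj X).ιChainComplex_d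
    (R := coeffZ.{v}) ((X.toSSetObjEquiv (.op ⦋n + 1⦌)).symm σ))
  refine h.trans ?_
  simp only [toSSetObjEquiv_symm_δ]
  rw [ModuleCat.hom_sum, LinearMap.sum_apply]
  rfl

/-- The augmented complex agrees with the ordinary one near positive degrees, so exactness at degree
n + 1 transfers through the comparison isomorphisms. -/
theorem isZero_singularHomology_of_acyclicIn {n : ℕ} (h : AcyclicIn (Set.univ : Set X) (n + 1)) :
    IsZero (((singularHomologyFunctor (ModuleCat.{v} ℤ) (n + 1)).obj coeffZ.{v}).obj X) := by
  have hex : ((TopCat.toSSet.obj X).chainComplex coeffZ.{v}).ExactAt (n + 1) := by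
    rw [HomologicalComplex.exactAt_iff' _ (n + 2) (n + 1) n (by simp) (by simp),
      ShortComplex.moduleCat_exact_iff]
    suffices key : ∀ z : ((TopCat.toSSet.obj X).chainComplex coeffZ.{v}).X (n + 1),
        (((TopCat.toSSet.obj X).chainComplex coeffZ.{v}).d (n + 1) n).hom z = 0 →
        ∃ y, (((TopCat.toSSet.obj X).chainComplex coeffZ.{v}).d (n + 2) (n + 1)).hom y = z from
      fun z hz => key z hz
    intro z hz
    obtain ⟨y, -, hy⟩ := h ((singularComparisonInv X (n + 1)).hom z) (by
        rw [chainsIn]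
        intro σ _
        exact Set.subset_univ _) (by
        have := singularComparison_d X n ((singularComparisonInv X (n + 1)).hom z)
        rw [singularComparison_comparisonInv] at this
        have h2 := singularComparisonInv_comparison X n
          (sBoundary X (n + 1) ((singularComparisonInv X (n + 1)).hom z))
        rw [← this] at h2
        rw [← h2, hz]
        exact map_zero _)
    refine ⟨singularComparison X (n + 2) y, ?_⟩
    refine (singularComparison_d X (n + 1) y).trans ?_
    rw [hy, singularComparison_comparisonInv]
  exact hex.isZero_homology

end Comparison

end

/-! ### Null-homologous maps into a product with the projective line. -/

noncomputable section

section NullHomologous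

open CategoryTheory Limits AlgebraicTopology

universe v

theorem isZero_singularHomology_P1 :
    IsZero (((singularHomologyFunctor (ModuleCat.{v} ℤ) 3).obj coeffZ.{v}).obj
      (TopCat.of (ULift.{v} P1))) := by
  refine isZero_singularHomology_of_acyclicIn (TopCat.of (ULift.{v} P1)) (n := 2) ?_
  have h := P1.acyclicIn_univ.image (j := (⟨ULift.up, continuous_uliftUp⟩ : C(P1, ULift.{v} P1)))
    Homeomorph.ulift.symm.isEmbedding
  rw [Set.image_univ] at h
  convert! h using 1
  exact (Set.range_eq_univ.2 ULift.up_surjective).symm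

/-- A map to a product with the projective line whose second component is null-homotopic is
null-homologous. -/
theorem isNullHomologous_of_homotopic {X : Type v} [TopologicalSpace X] (f : C(S3, P1 × X))
    (g : C(S3, P1)) (x : X) (h : f.Homotopic (g.prodMk (ContinuousMap.const _ x))) :
    IsNullHomologous f := by
  obtain ⟨H⟩ := h.comp (ContinuousMap.Homotopic.refl
    (⟨ULift.down, continuous_uliftDown⟩ : C(ULift.{v} S3, S3)))
  let a : TopCat.of (ULift.{v} S3) ⟶ TopCat.of (ULift.{v} P1) :=
    TopCat.ofHom ⟨fun p => ULift.up (g p.down), by fun_prop⟩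
  let b : TopCat.of (ULift.{v} P1) ⟶ TopCat.of (P1 × X) :=
    TopCat.ofHom ⟨fun p => (p.down, x), by fun_prop⟩
  have hab : TopCat.ofHom ((g.prodMk (ContinuousMap.const _ x)).comp
      (⟨ULift.down, continuous_uliftDown⟩ : C(ULift.{v} S3, S3))) = a ≫ b := rfl
  have h1 := TopCat.Homotopy.congr_homologyMap_singularChainComplexFunctor
    (X := TopCat.of (ULift.{v} S3)) (Y := TopCat.of (P1 × X))
    (f := TopCat.ofHom _) (g := TopCat.ofHom _) H coeffZ.{v} 3
  refine h1.trans ?_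
  change ((singularHomologyFunctor (ModuleCat.{v} ℤ) 3).obj coeffZ.{v}).map (TopCat.ofHom _) = 0
  -- The deformed map factors through ℙ¹, so its effect on third homology factors through a zero
  -- module.
  have ha : ((singularHomologyFunctor (ModuleCat.{v} ℤ) 3).obj coeffZ.{v}).map a = 0 :=
    isZero_singularHomology_P1.eq_of_tgt _ _
  rw [hab, Functor.map_comp, ha, zero_comp]

end NullHomologous

end

noncomputable section

/-! ### Calculus in spaces of continuous maps -/

section CompositionOperator

open Set Filter Topology

universe v

variable {K : Type*} [TopologicalSpace K] [CompactSpace K]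
  {V : Type v} [NormedAddCommGroup V] [NormedSpace ℝ V]
  {W : Type v} [NormedAddCommGroup W] [NormedSpace ℝ W]

/-- Pointwise application of a continuous family of linear maps. -/
def pointwiseApply (K : Type*) [TopologicalSpace K] [CompactSpace K]
    (V W : Type*) [NormedAddCommGroup V] [NormedSpace ℝ V] [NormedAddCommGroup W]
    [NormedSpace ℝ W] : C(K, V →L[ℝ] W) →L[ℝ] C(K, V) →L[ℝ] C(K, W) :=
  LinearMap.mkContinuous₂
    (LinearMap.mk₂ ℝ (fun (A : C(K, V →L[ℝ] W)) (γ : C(K, V)) =>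
        (⟨fun t => A t (γ t), A.continuous.clm_apply γ.continuous⟩ : C(K, W)))
      (fun _ _ _ => rfl) (fun _ _ _ => rfl) (fun A γ γ' => by ext t; exact map_add (A t) _ _)
      (fun c A γ => by ext t; exact map_smul (A t) _ _)) 1 (fun A γ => by
        rw [one_mul, ContinuousMap.norm_le _ (by positivity)]
        intro t
        exact (A t).le_of_opNorm_le_of_le (A.norm_coe_le_norm t) (γ.norm_coe_le_norm t))

/-- The derivative of a continuously differentiable map, as a continuous map. -/
def fderivC (f : C(V, W)) (hf : ContDiff ℝ 1 f) : C(V, V →L[ℝ] W) :=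
  ⟨fderiv ℝ f, hf.continuous_fderiv one_ne_zero⟩

/-- The mean value inequality on the segment from γ(t) to γ(t) + h(t) bounds the remainder uniformly
in t, because γ ↦ Df ∘ γ is continuous for the sup norm. -/
theorem hasFDerivAt_comp_left (f : C(V, W)) (hf : ContDiff ℝ 1 f) (γ : C(K, V)) :
    HasFDerivAt (fun γ : C(K, V) => f.comp γ) (pointwiseApply K V W ((fderivC f hf).comp γ)) γ := by
  rw [hasFDerivAt_iff_isLittleO_nhds_zero, Asymptotics.isLittleO_iff]
  intro ε hε
  have hc : Continuous fun h : C(K, V) => (fderivC f hf).comp (γ + h) :=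
    (ContinuousMap.continuous_postcomp _).comp (continuous_const.add continuous_id)
  obtain ⟨δ, hδ, hball⟩ := Metric.mem_nhds_iff.1
    ((hc.continuousAt (x := 0)).preimage_mem_nhds (Metric.ball_mem_nhds ((fderivC f hf).comp (γ + 0)) hε))
  filter_upwards [Metric.ball_mem_nhds (0 : C(K, V)) hδ] with h hh
  rw [mem_ball_zero_iff] at hh
  rw [ContinuousMap.norm_le _ (by positivity)]
  intro t
  have key := Convex.norm_image_sub_le_of_norm_hasFDerivWithin_le' (f := f)
    (f' := fderiv ℝ f) (φ := fderiv ℝ f (γ t)) (s := segment ℝ (γ t) (γ t + h t)) (C := ε)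
    (fun x _ => ((hf.differentiable one_ne_zero) x).hasFDerivAt.hasFDerivWithinAt)
    (fun x hx => by
      rw [segment_eq_image'] at hx
      obtain ⟨θ, ⟨hθ0, hθ1⟩, rfl⟩ := hx
      have hθ : ‖θ • h‖ < δ := by
        rw [norm_smul, Real.norm_of_nonneg hθ0]
        exact (mul_le_of_le_one_left (norm_nonneg _) hθ1).trans_lt hh
      have := (ContinuousMap.dist_apply_le_dist t).trans_lt
        (hball (by rwa [mem_ball_zero_iff]) : dist ((fderivC f hf).comp (γ + θ • h))
          ((fderivC f hf).comp (γ + 0)) < ε)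
      rw [dist_eq_norm, add_zero] at this
      simpa [fderivC] using this.le)
    (convex_segment _ _) (left_mem_segment _ _ _) (right_mem_segment _ _ _)
  rw [add_sub_cancel_left] at key
  exact key.trans (mul_le_mul_of_nonneg_left (h.norm_coe_le_norm t) hε.le)

/-- The derivative of composition with f is built from composition with Df, one order less smooth.
The induction replaces `W` by `V →L[ℝ] W`, which is why both spaces live in the same universe. -/
theorem contDiff_comp_left_nat (n : ℕ) (f : C(V, W)) (hf : ContDiff ℝ n f) :
    ContDiff ℝ n fun γ : C(K, V) => f.comp γ := by
  induction n generalizing W with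
  | zero => exact contDiff_zero.2 (ContinuousMap.continuous_postcomp f)
  | succ n ih =>
    have h1 : ContDiff ℝ 1 f := hf.of_le (by exact_mod_cast Nat.le_add_left 1 n)
    have hd : fderiv ℝ (fun γ : C(K, V) => f.comp γ) =
        fun γ => pointwiseApply K V W ((fderivC f h1).comp γ) :=
      funext fun γ => (hasFDerivAt_comp_left f h1 γ).fderiv
    rw [Nat.cast_add, Nat.cast_one] at hf ⊢
    rw [contDiff_succ_iff_fderiv] at hf ⊢
    refine ⟨fun γ => (hasFDerivAt_comp_left f h1 γ).differentiableAt, by simp, ?_⟩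
    rw [hd]
    exact (pointwiseApply K V W).contDiff.comp (ih (fderivC f h1) hf.2.2)

/-- Composition with a smooth map is a smooth operation on continuous maps. -/
theorem contDiff_comp_left (f : C(V, W)) (hf : ContDiff ℝ ∞ f) :
    ContDiff ℝ ∞ fun γ : C(K, V) => f.comp γ :=
  contDiff_infty.2 fun n => contDiff_comp_left_nat n f (contDiff_infty.1 hf n)

end CompositionOperator

/-! ### Integration of paths on the unit interval. -/

section Primitive

open Set unitInterval

variable {V : Type*} [NormedAddCommGroup V]

theorem continuous_comp_projIcc (ξ : C(I, V)) :
    Continuous fun s : ℝ => ξ (projIcc 0 1 zero_le_one s) :=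
  ξ.continuous.comp continuous_projIcc

variable [NormedSpace ℝ V]

/-- The primitive of a path on the unit interval, extended to the real line. -/
def primFun (ξ : C(I, V)) (t : ℝ) : V := ∫ s in (0 : ℝ)..t, ξ (projIcc 0 1 zero_le_one s)

theorem primFun_zero (ξ : C(I, V)) : primFun ξ 0 = 0 := intervalIntegral.integral_same

theorem hasDerivAt_primFun [CompleteSpace V] (ξ : C(I, V)) (t : ℝ) :
    HasDerivAt (primFun ξ) (ξ (projIcc 0 1 zero_le_one t)) t :=
  (continuous_comp_projIcc ξ).integral_hasStrictDerivAt 0 t |>.hasDerivAt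

theorem primFun_add (ξ ξ' : C(I, V)) (t : ℝ) : primFun (ξ + ξ') t = primFun ξ t + primFun ξ' t :=
  intervalIntegral.integral_add ((continuous_comp_projIcc ξ).intervalIntegrable _ _)
    ((continuous_comp_projIcc ξ').intervalIntegrable _ _)

theorem primFun_smul (c : ℝ) (ξ : C(I, V)) (t : ℝ) : primFun (c • ξ) t = c • primFun ξ t :=
  intervalIntegral.integral_smul c _

theorem norm_primFun_le (ξ : C(I, V)) (t : ℝ) : ‖primFun ξ t‖ ≤ ‖ξ‖ * |t| := by
  have h := intervalIntegral.norm_integral_le_of_norm_le_const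
    (a := 0) (b := t) (C := ‖ξ‖) fun s _ => ξ.norm_coe_le_norm (projIcc 0 1 zero_le_one s)
  rwa [sub_zero] at h

theorem continuous_primFun [CompleteSpace V] (ξ : C(I, V)) : Continuous (primFun ξ) :=
  continuous_iff_continuousAt.2 fun t => (hasDerivAt_primFun ξ t).continuousAt

/-- The primitive at a fixed time as a continuous linear map. -/
def primAt (V : Type*) [NormedAddCommGroup V] [NormedSpace ℝ V] (t : ℝ) : C(I, V) →L[ℝ] V :=
  LinearMap.mkContinuous
    { toFun := fun ξ => primFun ξ t
      map_add' := fun ξ ξ' => primFun_add ξ ξ' t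
      map_smul' := fun c ξ => primFun_smul c ξ t } |t| fun ξ => by
    rw [mul_comm]
    exact norm_primFun_le ξ t

/-- The primitive as an operator on paths. -/
def primCLM (V : Type*) [NormedAddCommGroup V] [NormedSpace ℝ V] [CompleteSpace V] :
    C(I, V) →L[ℝ] C(I, V) :=
  LinearMap.mkContinuous
    { toFun := fun ξ => ⟨fun t => primFun ξ t, (continuous_primFun ξ).comp continuous_subtype_val⟩
      map_add' := fun ξ ξ' => by ext t; exact primFun_add ξ ξ' t
      map_smul' := fun c ξ => by ext t; exact primFun_smul c ξ t } 1 fun ξ => by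
    rw [one_mul, ContinuousMap.norm_le _ (norm_nonneg _)]
    intro t
    refine (norm_primFun_le ξ t).trans (mul_le_of_le_one_right (norm_nonneg _) ?_)
    rw [abs_of_nonneg t.2.1]
    exact t.2.2

/-- Constant paths. -/
def constCLM (V : Type*) [NormedAddCommGroup V] [NormedSpace ℝ V] : V →L[ℝ] C(I, V) :=
  LinearMap.mkContinuous
    { toFun := fun v => ContinuousMap.const _ v
      map_add' := fun _ _ => rfl
      map_smul' := fun _ _ => rfl } 1 fun v => by
    rw [one_mul, ContinuousMap.norm_le _ (norm_nonneg _)]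
    exact fun _ => le_rfl

/-- Multiplication of a path by the time parameter. -/
def timeMul (V : Type*) [NormedAddCommGroup V] [NormedSpace ℝ V] : C(I, V) →L[ℝ] C(I, V) :=
  pointwiseApply I V V ⟨fun t => (t : ℝ) • ContinuousLinearMap.id ℝ V,
    continuous_subtype_val.smul continuous_const⟩

end Primitive

end

noncomputable section

/-! ### The implicit function theorem near a point -/

section Implicit

open Filter Topology

/-- Being C^∞ at a point only gives, for each finite order, a neighbourhood depending on that order.
To get C^∞ at all nearby points, the theorem is applied anew at each of them, where the partial
derivative is still invertible, and uniqueness identifies the new solution with the old. -/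
theorem exists_implicit_contDiffAt {E₁ E₂ F : Type*}
    [NormedAddCommGroup E₁] [NormedSpace ℝ E₁] [CompleteSpace E₁]
    [NormedAddCommGroup E₂] [NormedSpace ℝ E₂] [CompleteSpace E₂]
    [NormedAddCommGroup F] [NormedSpace ℝ F] [CompleteSpace F]
    {G : E₁ × E₂ → F} (hG : ContDiff ℝ ∞ G) {u : E₁ × E₂} (hu : G u = 0)
    (hinv : (fderiv ℝ G u ∘L .inr ℝ E₁ E₂).IsInvertible) :
    ∃ ψ : E₁ → E₂, ψ u.1 = u.2 ∧ ∀ᶠ x in 𝓝 u.1, ContDiffAt ℝ ∞ ψ x ∧ G (x, ψ x) = 0 := by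
  have hn : (∞ : ℕ∞ω) ≠ 0 := by simp
  have hGat : ∀ v, ContDiffAt ℝ ∞ G v := fun v => hG.contDiffAt
  let ψ := (hGat u).implicitFunction hn hinv
  have hψ0 : ψ u.1 = u.2 := (hGat u).implicitFunction_apply_self hn hinv
  refine ⟨ψ, hψ0, ?_⟩
  have hψ : ContDiffAt ℝ 1 ψ u.1 :=
    ((hGat u).contDiffAt_implicitFunction hn hinv).of_le (by norm_cast)
  have hev : ∀ᶠ x in 𝓝 u.1, G (x, ψ x) = 0 := by
    simpa only [hu] using (hGat u).eventually_apply_implicitFunction hn hinv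
  have hcont : ∀ᶠ x in 𝓝 u.1, ContinuousAt ψ x :=
    (hψ.eventually (by simp)).mono fun x hx => hx.continuousAt
  have hinv' : ∀ᶠ x in 𝓝 u.1, (fderiv ℝ G (x, ψ x) ∘L .inr ℝ E₁ E₂).IsInvertible := by
    have hc : ContinuousAt (fun x => fderiv ℝ G (x, ψ x) ∘L .inr ℝ E₁ E₂) u.1 := by
      have h1 : Continuous fun v => fderiv ℝ G v ∘L .inr ℝ E₁ E₂ :=
        (hG.continuous_fderiv hn).clm_comp continuous_const
      exact h1.continuousAt.comp (continuousAt_id.prodMk hψ.continuousAt)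
    refine hc.eventually ((ContinuousLinearEquiv.isOpen (𝕜 := ℝ)).mem_nhds ?_)
    change (fderiv ℝ G (u.1, ψ u.1) ∘L .inr ℝ E₁ E₂).IsInvertible
    rw [hψ0]
    exact hinv
  filter_upwards [eventually_eventually_nhds.2 hev, hcont, hinv'] with x hx hcx hix
  refine ⟨?_, hx.self_of_nhds⟩
  refine ((hGat (x, ψ x)).contDiffAt_implicitFunction hn hix).congr_of_eventuallyEq ?_
  have huniq := (hGat (x, ψ x)).eventually_apply_eq_iff_implicitFunction hn hix
  have htend : Tendsto (fun y => (y, ψ y)) (𝓝 x) (𝓝 (x, ψ x)) :=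
    (continuousAt_id.prodMk hcx : ContinuousAt (fun y => (y, ψ y)) x)
  filter_upwards [htend.eventually huniq, hx] with y hy hGy
  exact (hy.1 (by rw [hGy, hx.self_of_nhds])).symm

end Implicit

/-! ### The radial primitive of a closed 2-form -/

section Radial

open Set unitInterval

universe v

variable {V : Type v} [NormedAddCommGroup V] [NormedSpace ℝ V]
  {W : Type v} [NormedAddCommGroup W] [NormedSpace ℝ W]

/-- Continuous bilinear forms. -/
abbrev Bilin (V : Type v) [NormedAddCommGroup V] [NormedSpace ℝ V] : Type v := V →L[ℝ] V →L[ℝ] ℝ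

/-- The cyclic identity which expresses that a bilinear-form-valued map is closed at a point. -/
def IsClosedAt (β : V → V →L[ℝ] V →L[ℝ] ℝ) (x : V) : Prop :=
  ∀ a b c, fderiv ℝ β x a b c - fderiv ℝ β x b a c + fderiv ℝ β x c a b = 0

/-- The ray through a point. -/
def rayCLM (V : Type*) [NormedAddCommGroup V] [NormedSpace ℝ V] : V →L[ℝ] C(I, V) :=
  (timeMul V).comp (constCLM V)

/-- The operator `∫₀¹ s f(s x) ds`. -/
def radialOp (f : C(V, W)) (x : V) : W :=
  primAt W 1 (timeMul W (f.comp (rayCLM V x)))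

theorem contDiff_radialOp {f : C(V, W)} (hf : ContDiff ℝ ∞ f) : ContDiff ℝ ∞ (radialOp f) :=
  (primAt W 1).contDiff.comp ((timeMul W).contDiff.comp
    ((contDiff_comp_left f hf).comp (rayCLM V).contDiff))

theorem radialOp_zero {f : C(V, W)} (h0 : f 0 = 0) : radialOp f 0 = 0 := by
  have h : f.comp (rayCLM V 0) = 0 := by
    ext1 s
    rw [ContinuousMap.comp_apply, map_zero]
    exact h0
  rw [radialOp, h, map_zero, map_zero]

/-- The derivative of `radialOp`. -/
def radialOpDeriv (f : C(V, W)) (hf : ContDiff ℝ 1 f) (x : V) : V →L[ℝ] W :=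
  (primAt W 1).comp ((timeMul W).comp
    ((pointwiseApply I V W ((fderivC f hf).comp (rayCLM V x))).comp (rayCLM V)))

theorem hasFDerivAt_radialOp {f : C(V, W)} (hf : ContDiff ℝ 1 f) (x : V) :
    HasFDerivAt (radialOp f) (radialOpDeriv f hf x) x :=
  (primAt W 1).hasFDerivAt.comp x ((timeMul W).hasFDerivAt.comp x
    ((hasFDerivAt_comp_left f hf (rayCLM V x)).comp x (rayCLM V).hasFDerivAt))

theorem primAt_comp_clm [CompleteSpace W] {W' : Type*} [NormedAddCommGroup W'] [NormedSpace ℝ W']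
    [CompleteSpace W'] (L : W →L[ℝ] W') (t : ℝ) (ξ : C(I, W)) :
    L (primAt W t ξ) = primAt W' t (ContinuousLinearMap.compLeftContinuous ℝ I L ξ) :=
  (L.intervalIntegral_comp_comm ((continuous_comp_projIcc ξ).intervalIntegrable _ _)).symm

theorem primAt_one_eq_sub {P : C(I, ℝ)} {g : ℝ → ℝ} (hg : ∀ s : I, HasDerivAt g (P s) s) :
    primAt ℝ 1 P = g 1 - g 0 := by
  refine intervalIntegral.integral_eq_sub_of_hasDerivAt (fun s hs => ?_)
    ((continuous_comp_projIcc P).intervalIntegrable _ _)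
  rw [uIcc_of_le zero_le_one] at hs
  have := hg ⟨s, hs⟩
  rwa [projIcc_of_mem _ hs]

/-- The path `s ↦ s L(f(s x))`. -/
def radialPath (L : W →L[ℝ] ℝ) (f : C(V, W)) (x : V) : C(I, ℝ) :=
  ⟨fun s => s * L (f ((s : ℝ) • x)), by fun_prop⟩

theorem apply_radialOp [CompleteSpace W] (L : W →L[ℝ] ℝ) (f : C(V, W)) (x : V) :
    L (radialOp f x) = primAt ℝ 1 (radialPath L f x) := by
  rw [radialOp, primAt_comp_clm]
  congr 1
  ext s
  exact map_smul L _ _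

/-- The path `s ↦ s² L(Df(s x) a)`. -/
def radialDerivPath (L : W →L[ℝ] ℝ) (f : C(V, W)) (hf : ContDiff ℝ 1 f) (x a : V) : C(I, ℝ) :=
  ⟨fun s => s ^ 2 * L (fderivC f hf ((s : ℝ) • x) a), by fun_prop⟩

theorem apply_radialOpDeriv [CompleteSpace W] (L : W →L[ℝ] ℝ) (f : C(V, W)) (hf : ContDiff ℝ 1 f)
    (x a : V) : L (radialOpDeriv f hf x a) = primAt ℝ 1 (radialDerivPath L f hf x a) := by
  change L (primAt W 1 _) = _
  rw [primAt_comp_clm]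
  congr 1
  ext s
  change L ((s : ℝ) • fderivC f hf ((s : ℝ) • x) ((s : ℝ) • a)) = _
  rw [map_smul, map_smul, map_smul, smul_eq_mul, smul_eq_mul, ← mul_assoc, ← pow_two]
  rfl

/-- The radial primitive of a 2-form. -/
def radialPrimitive (β : C(V, V →L[ℝ] V →L[ℝ] ℝ)) (x : V) : V →L[ℝ] ℝ :=
  radialOp (W := Bilin V) β x x

theorem contDiff_radialPrimitive {β : C(V, V →L[ℝ] V →L[ℝ] ℝ)} (hβ : ContDiff ℝ ∞ β) :
    ContDiff ℝ ∞ (radialPrimitive β) :=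
  (contDiff_radialOp (W := Bilin V) hβ).clm_apply contDiff_id

theorem radialPrimitive_zero (β : C(V, V →L[ℝ] V →L[ℝ] ℝ)) : radialPrimitive β 0 = 0 :=
  map_zero (radialOp (W := Bilin V) β 0)

variable {β : C(V, V →L[ℝ] V →L[ℝ] ℝ)}

theorem fderiv_radialPrimitive (hβ : ContDiff ℝ 1 β) (x a : V) : fderiv ℝ (radialPrimitive β) x a =
    radialOp (W := Bilin V) β x a + radialOpDeriv (W := Bilin V) β hβ x a x := by
  have h := (hasFDerivAt_radialOp (W := Bilin V) hβ x).clm_apply (hasFDerivAt_id x)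
  exact congrArg (fun L => L a) h.fderiv

theorem fderiv_radialPrimitive_zero (hβ : ContDiff ℝ 1 β) (h0 : β 0 = 0) :
    fderiv ℝ (radialPrimitive β) 0 = 0 := by
  ext1 a
  rw [fderiv_radialPrimitive hβ, radialOp_zero (W := Bilin V) h0, map_zero, add_zero]

/-- Evaluation of a bilinear form on a pair of vectors. -/
def bilinEval (a b : V) : (V →L[ℝ] V →L[ℝ] ℝ) →L[ℝ] ℝ :=
  (ContinuousLinearMap.apply ℝ ℝ b).comp (ContinuousLinearMap.apply ℝ (V →L[ℝ] ℝ) a)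

/-- The Poincaré lemma for 2-forms. -/
theorem fderiv_radialPrimitive_sub (hβ : ContDiff ℝ 1 β) (hskew : ∀ x a b, β x a b = -β x b a)
    {x : V} (hx : ∀ s : I, IsClosedAt β ((s : ℝ) • x)) (a b : V) :
    fderiv ℝ (radialPrimitive β) x a b - fderiv ℝ (radialPrimitive β) x b a = β x a b := by
  have hval : ∀ a b, fderiv ℝ (radialPrimitive β) x a b =
      primAt ℝ 1 (radialPath (W := Bilin V) (bilinEval a b) β x +
        radialDerivPath (W := Bilin V) (bilinEval x b) β hβ x a) := by
    intro a b
    rw [fderiv_radialPrimitive hβ, map_add, ← apply_radialOp, ← apply_radialOpDeriv]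
    rfl
  rw [hval, hval, ← map_sub]
  have hline : ∀ s : ℝ, HasDerivAt (fun s : ℝ => s • x) x s := fun s => by
    simpa using (hasDerivAt_id s).smul_const x
  -- The integrand is the derivative of s² β(sx)(a, b): closedness turns the two derivative terms in
  -- the directions a and b into the single one in the direction x.
  rw [primAt_one_eq_sub (g := fun s => s ^ 2 * β (s • x) a b)]
  · simp
  · intro s
    have h0 : HasDerivAt (fun s : ℝ => β (s • x)) (fderiv ℝ β ((s : ℝ) • x) x) s :=
      (hβ.differentiable one_ne_zero _).hasFDerivAt.comp_hasDerivAt (s : ℝ) (hline s)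
    have h1 : HasDerivAt (fun s : ℝ => β (s • x) a b) (fderiv ℝ β ((s : ℝ) • x) x a b) s := by
      have h := (h0.clm_apply (hasDerivAt_const (s : ℝ) a)).clm_apply (hasDerivAt_const (s : ℝ) b)
      simpa using h
    have h2 := ((hasDerivAt_id (s : ℝ)).pow 2).mul h1
    convert! h2 using 1
    have hc := hx s x a b
    have hs := hskew ((s : ℝ) • x) b a
    change (s : ℝ) * β ((s : ℝ) • x) a b + (s : ℝ) ^ 2 * fderiv ℝ β ((s : ℝ) • x) a x b -
      ((s : ℝ) * β ((s : ℝ) • x) b a + (s : ℝ) ^ 2 * fderiv ℝ β ((s : ℝ) • x) b x a) = _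
    simp only [id, Pi.pow_apply]
    rw [hs]
    push_cast
    linear_combination (-(s : ℝ) ^ 2) * hc

end Radial

end

noncomputable section

/-! ### Moser's method -/

section Moser

open Set Filter Topology unitInterval

universe v

/-! ### Differentiation of pointwise operations on continuous maps. -/

section PointwiseApply

variable {K : Type*} [TopologicalSpace K] [CompactSpace K]
  {E V W : Type*} [NormedAddCommGroup E] [NormedSpace ℝ E] [NormedAddCommGroup V] [NormedSpace ℝ V]
  [NormedAddCommGroup W] [NormedSpace ℝ W]

theorem contDiff_pointwiseApply {A : E → C(K, V →L[ℝ] W)} {ξ : E → C(K, V)} {n : ℕ∞ω}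
    (hA : ContDiff ℝ n A) (hξ : ContDiff ℝ n ξ) :
    ContDiff ℝ n fun x => pointwiseApply K V W (A x) (ξ x) :=
  ContDiff.clm_apply (f := fun x => pointwiseApply K V W (A x))
    (ContDiff.comp (g := pointwiseApply K V W) (ContinuousLinearMap.contDiff _) hA) hξ

theorem hasFDerivAt_pointwiseApply {A : E → C(K, V →L[ℝ] W)} {ξ : E → C(K, V)}
    {A' : E →L[ℝ] C(K, V →L[ℝ] W)} {ξ' : E →L[ℝ] C(K, V)} {x : E}
    (hA : HasFDerivAt A A' x) (hξ : HasFDerivAt ξ ξ' x) :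
    HasFDerivAt (fun x => pointwiseApply K V W (A x) (ξ x))
      ((pointwiseApply K V W (A x)).comp ξ' + ((pointwiseApply K V W).comp A').flip (ξ x)) x :=
  HasFDerivAt.clm_apply (c := fun x => pointwiseApply K V W (A x))
    (HasFDerivAt.comp (g := pointwiseApply K V W) x (ContinuousLinearMap.hasFDerivAt _) hA) hξ

theorem ContDiff.continuousMap_comp {V W : Type v} [NormedAddCommGroup V] [NormedSpace ℝ V]
    [NormedAddCommGroup W] [NormedSpace ℝ W] {f : C(V, W)} (hf : ContDiff ℝ ∞ f)
    {g : E → C(K, V)} (hg : ContDiff ℝ ∞ g) : ContDiff ℝ ∞ fun x => f.comp (g x) :=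
  (contDiff_comp_left f hf).comp hg

theorem HasFDerivAt.continuousMap_comp {V W : Type v} [NormedAddCommGroup V] [NormedSpace ℝ V]
    [NormedAddCommGroup W] [NormedSpace ℝ W] {f : C(V, W)} (hf : ContDiff ℝ 1 f)
    {g : E → C(K, V)} {g' : E →L[ℝ] C(K, V)} {x : E} (hg : HasFDerivAt g g' x) :
    HasFDerivAt (fun x => f.comp (g x))
      ((pointwiseApply K V W ((fderivC f hf).comp (g x))).comp g') x :=
  (hasFDerivAt_comp_left f hf (g x)).comp x hg

/-- Composition with a continuous linear map. -/
def postCLM (K : Type*) [TopologicalSpace K] [CompactSpace K] (L : V →L[ℝ] W) :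
    C(K, V) →L[ℝ] C(K, W) :=
  pointwiseApply K V W (ContinuousMap.const K L)

end PointwiseApply


variable {V : Type v} [NormedAddCommGroup V] [NormedSpace ℝ V] [CompleteSpace V]

/-- The path with initial point `x` and velocity `ξ`. -/
def pathCLM (V : Type*) [NormedAddCommGroup V] [NormedSpace ℝ V] [CompleteSpace V] :
    V × C(I, V) →L[ℝ] C(I, V) :=
  (constCLM V).comp (ContinuousLinearMap.fst ℝ V C(I, V)) +
    (primCLM V).comp (ContinuousLinearMap.snd ℝ V C(I, V))

theorem pathCLM_apply (x : V) (ξ : C(I, V)) (t : I) :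
    pathCLM V (x, ξ) t = x + primFun ξ t := rfl

variable {W : Type v} [NormedAddCommGroup W] [NormedSpace ℝ W]

/-- Moser's equation `(B₀ + t β(γ)) γ' + α(γ) = 0` for the path `γ` with initial point `x` and
velocity `ξ`. -/
def moserEq (B₀ : V →L[ℝ] W) (β : C(V, V →L[ℝ] W)) (α : C(V, W)) (p : V × C(I, V)) : C(I, W) :=
  postCLM I B₀ p.2 + timeMul W (pointwiseApply I V W (β.comp (pathCLM V p)) p.2) +
    α.comp (pathCLM V p)

variable {B₀ : V →L[ℝ] W} {β : C(V, V →L[ℝ] W)} {α : C(V, W)}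

theorem contDiff_moserEq (hβ : ContDiff ℝ ∞ β) (hα : ContDiff ℝ ∞ α) :
    ContDiff ℝ ∞ (moserEq B₀ β α) := by
  refine ContDiff.add (ContDiff.add ?_ ?_) ?_
  · exact (postCLM I B₀).contDiff.comp contDiff_snd
  · refine (timeMul W).contDiff.comp ?_
    exact contDiff_pointwiseApply
      (ContDiff.continuousMap_comp (W := V →L[ℝ] W) hβ (pathCLM V).contDiff) contDiff_snd
  · exact ContDiff.continuousMap_comp hα (pathCLM V).contDiff

theorem fderiv_moserEq (hβ : ContDiff ℝ ∞ β) (hα : ContDiff ℝ ∞ α) (p q : V × C(I, V)) (t : I) :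
    fderiv ℝ (moserEq B₀ β α) p q t = B₀ (q.2 t) +
      (t : ℝ) • (β (pathCLM V p t) (q.2 t) + fderiv ℝ β (pathCLM V p t) (pathCLM V q t) (p.2 t)) +
      fderiv ℝ α (pathCLM V p t) (pathCLM V q t) := by
  have hβ1 : ContDiff ℝ 1 β := hβ.of_le (by norm_cast)
  have hα1 : ContDiff ℝ 1 α := hα.of_le (by norm_cast)
  have h1 := (postCLM I B₀).hasFDerivAt.comp p (hasFDerivAt_snd (𝕜 := ℝ) (p := p))
  have h2 := HasFDerivAt.continuousMap_comp (W := V →L[ℝ] W) hβ1 (pathCLM V).hasFDerivAt (x := p)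
  have h3 := HasFDerivAt.continuousMap_comp hα1 (pathCLM V).hasFDerivAt (x := p)
  have h4 := (timeMul W).hasFDerivAt.comp p
    (hasFDerivAt_pointwiseApply h2 (hasFDerivAt_snd (𝕜 := ℝ) (p := p)))
  have h5 := HasFDerivAt.fderiv (f := moserEq B₀ β α) ((h1.add h4).add h3)
  rw [h5]
  rfl

/-- This is the variational equation: Moser's equation differentiated with respect to the initial
point. -/
theorem moserEq_linearized (hβ : ContDiff ℝ ∞ β) (hα : ContDiff ℝ ∞ α) {ψ : V → C(I, V)} {x : V}
    (hψ : DifferentiableAt ℝ ψ x) (h : ∀ᶠ y in 𝓝 x, moserEq B₀ β α (y, ψ y) = 0) (u : V) (t : I) :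
    B₀ (fderiv ℝ ψ x u t) + (t : ℝ) • (β (pathCLM V (x, ψ x) t) (fderiv ℝ ψ x u t) +
        fderiv ℝ β (pathCLM V (x, ψ x) t) (pathCLM V (u, fderiv ℝ ψ x u) t) (ψ x t)) +
      fderiv ℝ α (pathCLM V (x, ψ x) t) (pathCLM V (u, fderiv ℝ ψ x u) t) = 0 := by
  have h1 := (hasFDerivAt_id x).prodMk hψ.hasFDerivAt
  have h2 := HasFDerivAt.comp (g := moserEq B₀ β α) x
    (((contDiff_moserEq hβ hα).differentiable (by simp) (x, ψ x)).hasFDerivAt) h1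
  have h3 := h2.unique ((hasFDerivAt_const (0 : C(I, W)) x).congr_of_eventuallyEq h)
  have h4 := congrArg (fun L => L u t) h3
  exact (fderiv_moserEq hβ hα (x, ψ x) (u, fderiv ℝ ψ x u) t).symm.trans h4

/-- At (0, 0) the derivative of the equation in the velocity is pointwise application of `B₀`, since
β, α and Dα vanish at the origin; it is invertible on continuous paths. The implicit function
theorem then yields solutions on all of [0, 1], depending smoothly on the initial point, with no
flow to construct. -/
theorem exists_moser_velocity [CompleteSpace W] (B₀ : V ≃L[ℝ] W) (hβ : ContDiff ℝ ∞ β)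
    (hβ0 : β 0 = 0) (hα : ContDiff ℝ ∞ α) (hα0 : α 0 = 0) (hα0' : fderiv ℝ α 0 = 0) :
    ∃ ψ : V → C(I, V), ψ 0 = 0 ∧ ∀ᶠ x in 𝓝 0, ContDiffAt ℝ ∞ ψ x ∧
      moserEq (B₀ : V →L[ℝ] W) β α (x, ψ x) = 0 := by
  have hpath : ∀ t, pathCLM V (0, 0) t = 0 := fun t => by
    rw [pathCLM_apply, zero_add]
    exact map_zero (primAt V t)
  refine exists_implicit_contDiffAt (u := ((0 : V), (0 : C(I, V)))) (contDiff_moserEq hβ hα) ?_ ?_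
  · ext1 t
    change B₀ 0 + (t : ℝ) • β (pathCLM V (0, 0) t) 0 + α (pathCLM V (0, 0) t) = 0
    rw [hpath, hα0, map_zero, map_zero, smul_zero, add_zero, add_zero]
  · let e : C(I, V) ≃L[ℝ] C(I, W) := ContinuousLinearEquiv.equivOfInverse
      (postCLM I (B₀ : V →L[ℝ] W)) (postCLM I (B₀.symm : W →L[ℝ] V))
      (fun ξ => by ext1 t; exact B₀.symm_apply_apply _)
      (fun ξ => by ext1 t; exact B₀.apply_symm_apply _)
    refine ⟨e, ?_⟩
    ext1 k
    ext1 t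
    rw [ContinuousLinearMap.comp_apply, fderiv_moserEq hβ hα, hpath, hβ0, hα0']
    change B₀ (k t) = B₀ (k t) + (t : ℝ) • (0 + fderiv ℝ β 0 (pathCLM V (0, k) t) 0) + 0
    rw [map_zero, add_zero, add_zero, smul_zero, add_zero]

/-- Moser's theorem: a closed 2-form which is nondegenerate at the origin has constant
coefficients in suitable local coordinates. -/
theorem exists_constant_coordinates {Ω : V → Bilin V} (hΩ : ContDiff ℝ ∞ Ω)
    (hskew : ∀ x a b, Ω x a b = -Ω x b a) (B₀ : V ≃L[ℝ] (V →L[ℝ] ℝ)) (h0 : Ω 0 = B₀)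
    (hclosed : ∀ᶠ x in 𝓝 0, IsClosedAt Ω x) :
    ∃ φ : V → V, φ 0 = 0 ∧ HasStrictFDerivAt φ (ContinuousLinearMap.id ℝ V) 0 ∧
      ∀ᶠ x in 𝓝 0, ContDiffAt ℝ ∞ φ x ∧
        ∀ u v, Ω (φ x) (fderiv ℝ φ x u) (fderiv ℝ φ x v) = B₀ u v := by
  let β : C(V, Bilin V) := ⟨fun x => Ω x - Ω 0, (hΩ.sub contDiff_const).continuous⟩
  have hβ : ContDiff ℝ ∞ β := hΩ.sub contDiff_const
  have hβ1 : ContDiff ℝ 1 β := hβ.of_le (by norm_cast)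
  have hβ0 : β 0 = 0 := sub_self (Ω 0)
  have hβfd : ∀ x, fderiv ℝ β x = fderiv ℝ Ω x := fun x =>
    ((hΩ.differentiable (by simp) x).hasFDerivAt.sub_const (Ω 0)).fderiv
  have hβskew : ∀ x a b, β x a b = -β x b a := fun x a b => by
    change Ω x a b - Ω 0 a b = -(Ω x b a - Ω 0 b a)
    rw [hskew x, hskew 0]
    ring
  let α : C(V, V →L[ℝ] ℝ) := ⟨radialPrimitive β, (contDiff_radialPrimitive hβ).continuous⟩
  have hα : ContDiff ℝ ∞ α := contDiff_radialPrimitive hβ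
  obtain ⟨ψ, hψ0, hψ⟩ := exists_moser_velocity B₀ hβ hβ0 hα (radialPrimitive_zero β)
    (fderiv_radialPrimitive_zero hβ1 hβ0)
  obtain ⟨r, hr, hball⟩ := Metric.eventually_nhds_iff_ball.1 hclosed
  have hψc : ContinuousAt ψ 0 := hψ.self_of_nhds.1.continuousAt
  -- The whole path must remain in the ball where Ω is closed; as balls are star-shaped, the
  -- Poincaré lemma then applies at each of its points.
  have hsmall : ∀ᶠ x in 𝓝 0, ‖pathCLM V (x, ψ x)‖ < r := by
    have hc : ContinuousAt (fun x => ‖pathCLM V (x, ψ x)‖) 0 :=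
      ContinuousAt.comp (f := fun x => (x, ψ x)) (g := fun p => ‖pathCLM V p‖)
        (pathCLM V).continuous.norm.continuousAt (continuousAt_id.prodMk hψc)
    refine hc.eventually (gt_mem_nhds ?_)
    change ‖pathCLM V (0, ψ 0)‖ < r
    rw [hψ0, show pathCLM V (0, (0 : C(I, V))) = 0 from map_zero (pathCLM V), norm_zero]
    exact hr
  let D : V → V → C(I, V) := fun x u => fderiv ℝ ψ x u
  have hφ : ∀ x, ContDiffAt ℝ ∞ ψ x → HasFDerivAt (fun x => x + primAt V 1 (ψ x))
      (ContinuousLinearMap.id ℝ V + (primAt V 1).comp (fderiv ℝ ψ x)) x := fun x hx =>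
    (hasFDerivAt_id x).add ((primAt V 1).hasFDerivAt.comp x
      (hx.differentiableAt (by simp)).hasFDerivAt)
  have hlin : ∀ x, ContDiffAt ℝ ∞ ψ x →
      (∀ᶠ y in 𝓝 x, moserEq (B₀ : V →L[ℝ] V →L[ℝ] ℝ) β α (y, ψ y) = 0) →
      ∀ u t, B₀ (D x u t) +
      (t : ℝ) • (β (pathCLM V (x, ψ x) t) (D x u t) +
        fderiv ℝ Ω (pathCLM V (x, ψ x) t) (pathCLM V (u, D x u) t) (ψ x t)) +
      fderiv ℝ α (pathCLM V (x, ψ x) t) (pathCLM V (u, D x u) t) = 0 := by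
    intro x hx hev u t
    rw [← hβfd]
    exact moserEq_linearized hβ hα (hx.differentiableAt (by simp)) hev u t
  refine ⟨fun x => x + primAt V 1 (ψ x), ?_, ?_, ?_⟩
  · change 0 + primAt V 1 (ψ 0) = 0
    rw [hψ0, map_zero, add_zero]
  · have hψx := hψ.self_of_nhds.1
    -- At the origin the variational equation reduces to `B₀` applied to the variation, so the
    -- variation of the velocity vanishes and the time-one map has derivative the identity.
    have hD0 : fderiv ℝ ψ 0 = 0 := by
      ext1 u
      ext1 t
      have h := hlin 0 hψx (hψ.mono fun _ h => h.2) u t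
      have hp : pathCLM V (0, ψ 0) t = 0 := by
        rw [hψ0]
        exact congrArg (fun ξ : C(I, V) => ξ t) (map_zero (pathCLM V))
      have hα0 : fderiv ℝ α 0 = 0 := fderiv_radialPrimitive_zero hβ1 hβ0
      rw [hp, hβ0, hα0, hψ0] at h
      simp only [ContinuousMap.zero_apply, map_zero, zero_apply, add_zero,
        smul_zero] at h
      exact B₀.map_eq_zero_iff.1 h
    have hφ0 := hφ 0 hψx
    rw [hD0, ContinuousLinearMap.comp_zero, add_zero] at hφ0
    refine ContDiffAt.hasStrictFDerivAt' (n := ∞) ?_ hφ0 (by simp)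
    exact contDiffAt_id.add ((primAt V 1).contDiff.contDiffAt.comp 0 hψx)
  · filter_upwards [eventually_eventually_nhds.2 hψ, hsmall] with x hx hxr
    have hψx := hx.self_of_nhds.1
    refine ⟨contDiffAt_id.add ((primAt V 1).contDiff.contDiffAt.comp x hψx), fun u v => ?_⟩
    rw [(hφ x hψx).fderiv]
    have hL := hlin x hψx (hx.mono fun _ h => h.2)
    let γ : ℝ → V := fun t => x + primFun (ψ x) t
    let η : V → ℝ → V := fun u t => u + primFun (D x u) t
    have hγ : ∀ t : I, HasDerivAt γ (ψ x t) t := fun t => by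
      have := (hasDerivAt_primFun (ψ x) t).const_add x
      rwa [projIcc_val] at this
    have hη : ∀ u, ∀ t : I, HasDerivAt (η u) (D x u t) t := fun u t => by
      have := (hasDerivAt_primFun (D x u) t).const_add u
      rwa [projIcc_val] at this
    -- This is the interpolating form B₀ + tβ along the path, evaluated on the variations of the
    -- path in the directions u and v. It equals `B₀ u v` at t = 0 and the pulled-back form at t =
    -- 1.
    let F : ℝ → ℝ := fun t => B₀ (η u t) (η v t) + t * β (γ t) (η u t) (η v t)
    have hF : ∀ t : I, HasDerivAt F 0 t := by
      intro t
      have hγr : γ t ∈ Metric.ball (0 : V) r := by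
        rw [mem_ball_zero_iff]
        exact ((pathCLM V (x, ψ x)).norm_coe_le_norm t).trans_lt hxr
      have hcl := hball _ hγr (ψ x t) (η u t) (η v t)
      have hαd := fderiv_radialPrimitive_sub hβ1 hβskew (x := γ t) (fun s => by
        intro a b c
        rw [hβfd]
        refine hball _ ?_ a b c
        rw [mem_ball_zero_iff, norm_smul, Real.norm_of_nonneg s.2.1] at *
        exact (mul_le_of_le_one_left (norm_nonneg _) s.2.2).trans_lt hγr) (η u t) (η v t)
      have hu := congrArg (fun L => L (η v t)) (hL u t)
      have hv := congrArg (fun L => L (η u t)) (hL v t)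
      have hβγ : HasDerivAt (fun t => β (γ t)) (fderiv ℝ Ω (γ t) (ψ x t)) t := by
        rw [← hβfd]
        exact ((hβ1.differentiable one_ne_zero _).hasFDerivAt).comp_hasDerivAt (t : ℝ) (hγ t)
      have h1 := ((B₀ : V →L[ℝ] V →L[ℝ] ℝ).hasFDerivAt.comp_hasDerivAt (t : ℝ) (hη u t)).clm_apply
        (hη v t)
      have h2 := (hasDerivAt_id (t : ℝ)).mul ((hβγ.clm_apply (hη u t)).clm_apply (hη v t))
      have h3 : HasDerivAt F _ t := h1.add h2
      convert! h3 using 1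
      change (0 : ℝ) = B₀ (D x u t) (η v t) + B₀ (η u t) (D x v t) +
        (1 * β (γ t) (η u t) (η v t) + t * ((fderiv ℝ Ω (γ t) (ψ x t) (η u t) +
          β (γ t) (D x u t)) (η v t) + β (γ t) (η u t) (D x v t)))
      change B₀ (D x u t) (η v t) + t * (β (γ t) (D x u t) (η v t) +
        fderiv ℝ Ω (γ t) (η u t) (ψ x t) (η v t)) + fderiv ℝ α (γ t) (η u t) (η v t) = 0 at hu
      change B₀ (D x v t) (η u t) + t * (β (γ t) (D x v t) (η u t) +
        fderiv ℝ Ω (γ t) (η v t) (ψ x t) (η u t)) + fderiv ℝ α (γ t) (η v t) (η u t) = 0 at hv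
      change fderiv ℝ α (γ t) (η u t) (η v t) - fderiv ℝ α (γ t) (η v t) (η u t) =
        β (γ t) (η u t) (η v t) at hαd
      have hB : B₀ (η u t) (D x v t) = -B₀ (D x v t) (η u t) := by
        have := hskew 0 (η u t) (D x v t)
        rwa [h0] at this
      have hb := hβskew (γ t) (η u t) (D x v t)
      rw [add_apply, hB, hb]
      -- The two variational equations remove the derivatives of the variations; what remains
      -- cancels by dα = β and dΩ = 0.
      linear_combination hv - hu + hαd - (t : ℝ) * hcl
    have hconst := constant_of_has_deriv_right_zero (f := F) (a := 0) (b := 1)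
      (fun t ht => (hF ⟨t, ht⟩).continuousAt.continuousWithinAt)
      (fun t ht => (hF ⟨t, Ico_subset_Icc_self ht⟩).hasDerivWithinAt) 1 (right_mem_Icc.2 zero_le_one)
    simp only [F, η, γ, primFun_zero, add_zero, zero_mul, one_mul] at hconst
    rw [← hconst]
    change Ω (x + primFun (ψ x) 1) (u + primFun (D x u) 1) (v + primFun (D x v) 1) =
      B₀ _ _ + (Ω (x + primFun (ψ x) 1) - Ω 0) _ _
    rw [h0]
    simp

end Moser

end

noncomputable section

/-! ### Complex manifolds as real manifolds, and the local form of immersions -/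

open Topology

/-- A complex manifold is a smooth real manifold. -/
theorem isManifold_real {E : Type*} [NormedAddCommGroup E] [NormedSpace ℂ E]
    {M : Type*} [TopologicalSpace M] [ChartedSpace E M] [IsManifold 𝓘(ℂ, E) ω M] :
    IsManifold 𝓘(ℝ, E) ∞ M := by
  refine isManifold_of_contDiffOn 𝓘(ℝ, E) ∞ M fun e e' he he' => ?_
  have h := HasGroupoid.compatible (G := contDiffGroupoid ω 𝓘(ℂ, E)) he he'
  rw [contDiffGroupoid, mem_groupoid_of_pregroupoid] at h
  have h1 : ContDiffOn ℂ ω (𝓘(ℂ, E) ∘ (e.symm ≫ₕ e') ∘ 𝓘(ℂ, E).symm)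
    (𝓘(ℂ, E).symm ⁻¹' (e.symm ≫ₕ e').source ∩ Set.range 𝓘(ℂ, E)) := h.1
  exact (h1.restrict_scalars ℝ).of_le le_top

/-- The inverse function theorem, with smoothness of the inverse on its whole domain. -/
theorem exists_openPartialHomeomorph_of_hasFDerivAt {X Y : Type*} [NormedAddCommGroup X]
    [NormedSpace ℝ X] [CompleteSpace X] [NormedAddCommGroup Y] [NormedSpace ℝ Y]
    {f : X → Y} {U : Set X} (hU : IsOpen U) {a : X} (ha : a ∈ U) (hf : ContDiffOn ℝ ∞ f U)
    (T : X ≃L[ℝ] Y) (hT : HasFDerivAt f (T : X →L[ℝ] Y) a) :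
    ∃ κ : OpenPartialHomeomorph X Y, (κ : X → Y) = f ∧ a ∈ κ.source ∧ κ.source ⊆ U ∧
      ContDiffOn ℝ ∞ κ κ.source ∧ ContDiffOn ℝ ∞ κ.symm κ.target := by
  have hfa : ContDiffAt ℝ ∞ f a := hf.contDiffAt (hU.mem_nhds ha)
  let κ := hfa.toOpenPartialHomeomorph f hT (by simp)
  have hfd : ContinuousOn (fderiv ℝ f) U := hf.continuousOn_fderiv_of_isOpen hU (by simp)
  -- Invertibility of the derivative is an open condition; restricting to where it holds makes the
  -- inverse smooth on its entire domain.
  have hev : ∀ᶠ x in 𝓝 a, fderiv ℝ f x ∈ Set.range ((↑) : (X ≃L[ℝ] Y) → X →L[ℝ] Y) := by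
    have h1 := hfd.continuousAt (hU.mem_nhds ha)
    refine h1.eventually ?_
    rw [hT.fderiv]
    exact ContinuousLinearEquiv.nhds T
  obtain ⟨W, hW, hWo, haW⟩ := eventually_nhds_iff.1 hev
  have hO : IsOpen (U ∩ W) := hU.inter hWo
  have hsrc : (κ.restr (U ∩ W)).source = κ.source ∩ (U ∩ W) := by
    rw [OpenPartialHomeomorph.restr_source, hO.interior_eq]
  refine ⟨κ.restr (U ∩ W), rfl, ?_, ?_, ?_, ?_⟩
  · rw [hsrc]
    exact ⟨hfa.mem_toOpenPartialHomeomorph_source hT (by simp), ha, haW⟩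
  · rw [hsrc]
    exact fun x hx => hx.2.1
  · rw [hsrc]
    exact hf.mono fun x hx => hx.2.1
  · intro y hy
    have hx := (κ.restr (U ∩ W)).map_target hy
    have hy' := (κ.restr (U ∩ W)).right_inv hy
    rw [hsrc] at hx
    obtain ⟨T', hT'⟩ := hW _ hx.2.2
    have hfx : ContDiffAt ℝ ∞ f ((κ.restr (U ∩ W)).symm y) :=
      hf.contDiffAt (hU.mem_nhds hx.2.1)
    refine ((κ.restr (U ∩ W)).contDiffAt_symm (f₀' := T') hy ?_ hfx).contDiffWithinAt
    rw [hT']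
    exact (hfx.differentiableAt (by simp)).hasFDerivAt

section

variable {E : Type*} [NormedAddCommGroup E] [NormedSpace ℝ E] {H : Type*} [TopologicalSpace H]
  {I : ModelWithCorners ℝ E H} {M : Type*} [TopologicalSpace M] [ChartedSpace H M]

/-- Composing a chart with a smooth local change of coordinates of the model vector space. -/
def OpenPartialHomeomorph.changeCoordinates [I.Boundaryless] (c : OpenPartialHomeomorph M H)
    (κ : OpenPartialHomeomorph E E) : OpenPartialHomeomorph M H :=
  c.trans ((I.toHomeomorph.toOpenPartialHomeomorph.trans κ).trans
    I.toHomeomorph.symm.toOpenPartialHomeomorph)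

/-- Read in the model space, the change of coordinates belongs to the smooth groupoid, which is
closed under composition. -/
theorem OpenPartialHomeomorph.changeCoordinates_mem_maximalAtlas [I.Boundaryless]
    [IsManifold I ∞ M]
    {c : OpenPartialHomeomorph M H} (hc : c ∈ IsManifold.maximalAtlas I ∞ M)
    {κ : OpenPartialHomeomorph E E} (h1 : ContDiffOn ℝ ∞ κ κ.source)
    (h2 : ContDiffOn ℝ ∞ κ.symm κ.target) :
    c.changeCoordinates (I := I) κ ∈ IsManifold.maximalAtlas I ∞ M := by
  have hI : ∀ y, I (I.symm y) = y := fun y => I.right_inv (by rw [I.range_eq_univ]; trivial)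
  have hκ : ((I.toHomeomorph.toOpenPartialHomeomorph.trans κ).trans
      I.toHomeomorph.symm.toOpenPartialHomeomorph) ∈ contDiffGroupoid ∞ I := by
    rw [contDiffGroupoid, mem_groupoid_of_pregroupoid]
    constructor
    · change ContDiffOn ℝ ∞ (I ∘ _ ∘ I.symm) (I.symm ⁻¹' _ ∩ Set.range I)
      refine (h1.congr_mono (fun x hx => ?_) (fun x hx => ?_))
      · simp [hI]
      · simpa [hI] using hx.1
    · change ContDiffOn ℝ ∞ (I ∘ _ ∘ I.symm) (I.symm ⁻¹' _ ∩ Set.range I)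
      refine (h2.congr_mono (fun x hx => ?_) (fun x hx => ?_))
      · simp [hI]
      · simpa [hI] using hx.1
  rw [IsManifold.mem_maximalAtlas_iff, mem_maximalAtlas_iff] at hc ⊢
  intro e he
  have := hc e he
  constructor
  · rw [OpenPartialHomeomorph.changeCoordinates, OpenPartialHomeomorph.trans_symm_eq_symm_trans_symm,
      OpenPartialHomeomorph.trans_assoc]
    exact StructureGroupoid.trans _ (StructureGroupoid.symm _ hκ) this.1
  · rw [OpenPartialHomeomorph.changeCoordinates, ← OpenPartialHomeomorph.trans_assoc]
    exact StructureGroupoid.trans _ this.2 hκ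


/-- An injective linear map between finite-dimensional spaces is, up to an isomorphism, the
inclusion of a factor. -/
theorem exists_prod_equiv_of_injective {E F E' : Type*} [NormedAddCommGroup E] [NormedSpace ℝ E]
    [FiniteDimensional ℝ E] [NormedAddCommGroup F] [NormedSpace ℝ F] [FiniteDimensional ℝ F]
    [NormedAddCommGroup E'] [NormedSpace ℝ E'] [FiniteDimensional ℝ E']
    (hdim : Module.finrank ℝ E + Module.finrank ℝ F = Module.finrank ℝ E')
    (A : E →L[ℝ] E') (hA : Function.Injective A) :
    ∃ T : (E × F) ≃L[ℝ] E', ∀ u, T (u, 0) = A u := by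
  obtain ⟨q, hq⟩ := A.toLinearMap.range.exists_isCompl
  have h1 := Submodule.finrank_add_eq_of_isCompl hq
  rw [LinearMap.finrank_range_of_inj hA] at h1
  have e : F ≃ₗ[ℝ] q := LinearEquiv.ofFinrankEq F q (by omega)
  let T := ((LinearEquiv.ofInjective A.toLinearMap hA).prodCongr e).trans
    (Submodule.prodEquivOfIsCompl _ q hq)
  exact ⟨T.toContinuousLinearEquiv, fun u => by simp [T]⟩

/-! ### Immersions recognised by their differentials. -/

section

variable {E : Type*} [NormedAddCommGroup E] [NormedSpace ℝ E] {H : Type*} [TopologicalSpace H]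
  {I : ModelWithCorners ℝ E H} {M : Type*} [TopologicalSpace M] [ChartedSpace H M]
  {E' : Type*} [NormedAddCommGroup E'] [NormedSpace ℝ E'] {H' : Type*} [TopologicalSpace H']
  {J : ModelWithCorners ℝ E' H'} {N : Type*} [TopologicalSpace N] [ChartedSpace H' N]
  {F : Type*} [NormedAddCommGroup F] [NormedSpace ℝ F]

/-- A smooth map with injective differential at `x` is an immersion at `x`. -/
theorem isImmersionAtOfComplement_of_injective_mfderiv [I.Boundaryless] [J.Boundaryless]
    [IsManifold I ∞ M] [IsManifold J ∞ N] [FiniteDimensional ℝ E] [FiniteDimensional ℝ F]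
    [FiniteDimensional ℝ E']
    (hdim : Module.finrank ℝ E + Module.finrank ℝ F = Module.finrank ℝ E')
    {f : M → N} (hf : ContMDiff I J ∞ f) {x : M} (hx : Function.Injective (mfderiv I J f x)) :
    Manifold.IsImmersionAtOfComplement F I J ∞ f x := by
  let g : E → E' := writtenInExtChartAt I J x f
  let U : Set E := (extChartAt I x).target ∩ (extChartAt I x).symm ⁻¹'
    (f ⁻¹' (extChartAt J (f x)).source)
  have hU : IsOpen U := (continuousOn_extChartAt_symm x).isOpen_inter_preimage
    (isOpen_extChartAt_target x) ((isOpen_extChartAt_source (f x)).preimage hf.continuous)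
  have hxU : extChartAt I x x ∈ U := by
    refine ⟨mem_extChartAt_target x, ?_⟩
    simp
  have hg : ContDiffOn ℝ ∞ g U := by
    rw [← contMDiffOn_iff_contDiffOn]
    exact (contMDiffOn_extChartAt (n := ∞)).comp
      (hf.comp_contMDiffOn ((contMDiffOn_extChartAt_symm x).mono fun u hu => hu.1))
      fun u hu => by simpa using hu.2
  obtain ⟨T, hT⟩ := exists_prod_equiv_of_injective (F := F) hdim
    (show E →L[ℝ] E' from mfderiv I J f x) hx
  have hgd : HasFDerivAt g (show E →L[ℝ] E' from mfderiv I J f x) (extChartAt I x x) := by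
    have := (hf.mdifferentiable (by simp) x).hasMFDerivAt.2
    rw [I.range_eq_univ] at this
    exact this.hasFDerivAt_of_univ
  -- The local expression g is thickened in the directions complementary to its differential, so
  -- that DΦ at the base point is exactly `T`.
  let Φ : E × F → E' := fun p => g p.1 + T (0, p.2)
  have hΦ : ContDiffOn ℝ ∞ Φ (U ×ˢ Set.univ) :=
    (hg.comp contDiffOn_fst fun p hp => hp.1).add
      (T.contDiff.comp (contDiff_const.prodMk contDiff_snd)).contDiffOn
  have hΦd : HasFDerivAt Φ (T : E × F →L[ℝ] E') (extChartAt I x x, 0) := by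
    have h1 : HasFDerivAt (fun p : E × F => g p.1) _ (extChartAt I x x, (0 : F)) :=
      HasFDerivAt.comp (g := g) (f := Prod.fst) (extChartAt I x x, (0 : F)) hgd hasFDerivAt_fst
    have h2 : HasFDerivAt (fun p : E × F => T (0, p.2)) _ (extChartAt I x x, (0 : F)) :=
      ((T : E × F →L[ℝ] E').comp ((ContinuousLinearMap.inr ℝ E F).comp
        (ContinuousLinearMap.snd ℝ E F))).hasFDerivAt
    refine (h1.add h2).congr_fderiv ?_
    refine ContinuousLinearMap.ext fun p => ?_
    change (show E →L[ℝ] E' from mfderiv I J f x) p.1 + T (0, p.2) = T p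
    rw [← hT, ← map_add]
    simp
  obtain ⟨κ, hκΦ, hκx, -, hκ1, hκ2⟩ := exists_openPartialHomeomorph_of_hasFDerivAt
    (U := U ×ˢ (Set.univ : Set F)) (hU.prod isOpen_univ) (Set.mk_mem_prod hxU (Set.mem_univ _))
    hΦ T hΦd
  let O : Set E := (fun u : E => (u, (0 : F))) ⁻¹' κ.source
  have hO : IsOpen O := κ.open_source.preimage (by fun_prop)
  -- Undoing Φ and then applying `T` sends g(u) = Φ(u, 0) to T(u, 0), the linear normal form of an
  -- immersion.
  let κ' : OpenPartialHomeomorph E' E' := κ.symm.trans T.toHomeomorph.toOpenPartialHomeomorph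
  have hsrc : κ'.source = κ.target := by simp [κ']
  have htgt : κ'.target = T.symm ⁻¹' κ.source := by simp [κ']
  have hI : ∀ y, I (I.symm y) = y := fun y => I.right_inv (by rw [I.range_eq_univ]; trivial)
  have hJ : ∀ y, J (J.symm y) = y := fun y => J.right_inv (by rw [J.range_eq_univ]; trivial)
  refine Manifold.IsImmersionAtOfComplement.mk_of_continuousAt hf.continuous.continuousAt T
    ((chartAt H x).changeCoordinates (I := I) (OpenPartialHomeomorph.ofSet O hO))
    ((chartAt H' (f x)).changeCoordinates (I := J) κ') ?_ ?_ ?_ ?_ ?_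
  · simpa [OpenPartialHomeomorph.changeCoordinates, O] using hκx
  · have h1 := κ.map_source hκx
    rw [hκΦ] at h1
    have h2 : Φ (extChartAt I x x, 0) = extChartAt J (f x) (f x) := by
      simp [Φ, g, writtenInExtChartAt]
    rw [h2] at h1
    simpa [OpenPartialHomeomorph.changeCoordinates, hsrc] using h1
  · exact OpenPartialHomeomorph.changeCoordinates_mem_maximalAtlas
      (IsManifold.chart_mem_maximalAtlas x) contDiffOn_id contDiffOn_id
  · refine OpenPartialHomeomorph.changeCoordinates_mem_maximalAtlas
      (IsManifold.chart_mem_maximalAtlas (f x)) ?_ ?_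
    · rw [hsrc]
      exact T.contDiff.comp_contDiffOn hκ2
    · rw [htgt]
      exact hκ1.comp T.symm.contDiff.contDiffOn fun y hy => hy
  · intro u hu
    have hu' : u ∈ O := by
      have : (∃ y, I y = u) ∧ (u, (0 : F)) ∈ κ.source ∧ I.symm u ∈ (chartAt H x).target := by
        simpa [OpenPartialHomeomorph.changeCoordinates, hI, O] using hu
      exact this.2.1
    have h1 : g u = κ (u, 0) := by
      rw [hκΦ]
      simp [Φ]
    have h2 : κ.symm (g u) = (u, 0) := by
      rw [h1, κ.left_inv hu']
    change J _ = T (u, 0)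
    rw [← h2]
    simp [OpenPartialHomeomorph.changeCoordinates, hJ, κ', g, writtenInExtChartAt]

/-- An injective smooth map with injective differentials from a compact manifold is a smooth
embedding. -/
theorem isSmoothEmbedding_of_injective_mfderiv {E' : Type u} [NormedAddCommGroup E']
    [NormedSpace ℝ E'] {J : ModelWithCorners ℝ E' H'} [I.Boundaryless] [J.Boundaryless]
    [IsManifold I ∞ M] [IsManifold J ∞ N] [FiniteDimensional ℝ E] [FiniteDimensional ℝ F]
    [FiniteDimensional ℝ E']
    (hdim : Module.finrank ℝ E + Module.finrank ℝ F = Module.finrank ℝ E')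
    {f : M → N} (hf : ContMDiff I J ∞ f) (hx : ∀ x, Function.Injective (mfderiv I J f x))
    (hemb : IsEmbedding f) :
    Manifold.IsSmoothEmbedding I J ∞ f :=
  ⟨Manifold.IsImmersionOfComplement.isImmersion (F := F) fun x =>
    isImmersionAtOfComplement_of_injective_mfderiv hdim hf (hx x), hemb⟩

end
end

noncomputable section

/-! ### Darboux's theorem -/

open Topology

section Alternating

variable {V : Type*} [NormedAddCommGroup V] [NormedSpace ℝ V]

theorem ContinuousAlternatingMap.apply_pair_add_left (θ : V [⋀^Fin 2]→L[ℝ] ℝ) (a a' b : V) :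
    θ ![a + a', b] = θ ![a, b] + θ ![a', b] := by
  have h := θ.map_update_add ![0, b] 0 a a'
  have h2 : ∀ c, Function.update ![(0 : V), b] 0 c = ![c, b] := fun c => by
    ext i; fin_cases i <;> simp
  simpa only [h2] using h

theorem ContinuousAlternatingMap.apply_pair_smul_left (θ : V [⋀^Fin 2]→L[ℝ] ℝ) (c : ℝ) (a b : V) :
    θ ![c • a, b] = c * θ ![a, b] := by
  have h := θ.map_update_smul ![0, b] 0 c a
  have h2 : ∀ c, Function.update ![(0 : V), b] 0 c = ![c, b] := fun c => by
    ext i; fin_cases i <;> simp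
  simpa only [h2, smul_eq_mul] using h

theorem ContinuousAlternatingMap.apply_pair_swap (θ : V [⋀^Fin 2]→L[ℝ] ℝ) (a b : V) :
    θ ![a, b] = -θ ![b, a] := by
  have h := θ.toAlternatingMap.map_swap ![b, a] (i := 0) (j := 1) (by decide)
  have h2 : ![b, a] ∘ Equiv.swap (0 : Fin 2) 1 = ![a, b] := by
    ext i; fin_cases i <;> simp
  rw [h2] at h
  exact h

theorem ContinuousAlternatingMap.apply_pair_self (θ : V [⋀^Fin 2]→L[ℝ] ℝ) (a : V) :
    θ ![a, a] = 0 := by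
  have := θ.apply_pair_swap a a
  linarith

theorem ContinuousAlternatingMap.apply_pair_add_right (θ : V [⋀^Fin 2]→L[ℝ] ℝ) (a b b' : V) :
    θ ![a, b + b'] = θ ![a, b] + θ ![a, b'] := by
  rw [θ.apply_pair_swap, θ.apply_pair_add_left, θ.apply_pair_swap a b, θ.apply_pair_swap a b']
  ring

theorem ContinuousAlternatingMap.apply_pair_smul_right (θ : V [⋀^Fin 2]→L[ℝ] ℝ) (c : ℝ) (a b : V) :
    θ ![a, c • b] = c * θ ![a, b] := by
  rw [θ.apply_pair_swap, θ.apply_pair_smul_left, θ.apply_pair_swap a b]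
  ring

theorem ContinuousAlternatingMap.ext_pair {V : Type*} [AddCommGroup V] [Module ℝ V]
    [TopologicalSpace V] {θ θ' : V [⋀^Fin 2]→L[ℝ] ℝ}
    (h : ∀ a b, θ ![a, b] = θ' ![a, b]) : θ = θ' := by
  ext v
  have hv : v = ![v 0, v 1] := by
    ext i; fin_cases i <;> rfl
  rw [hv, h]

theorem ContinuousAlternatingMap.compContinuousLinearMap_pair {V W : Type*} [AddCommGroup V]
    [Module ℝ V] [TopologicalSpace V] [AddCommGroup W] [Module ℝ W] [TopologicalSpace W] (θ : V [⋀^Fin 2]→L[ℝ] ℝ) (f : W →L[ℝ] V) (a b : W) :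
    θ.compContinuousLinearMap f ![a, b] = θ ![f a, f b] := by
  rw [ContinuousAlternatingMap.compContinuousLinearMap_apply]
  congr 1
  ext i
  fin_cases i <;> rfl

/-- The bilinear form underlying an alternating form. -/
def bilinOfAlternating [FiniteDimensional ℝ V] (θ : V [⋀^Fin 2]→L[ℝ] ℝ) : Bilin V :=
  LinearMap.toContinuousLinearMap
    { toFun := fun a => LinearMap.toContinuousLinearMap
        { toFun := fun b => θ ![a, b]
          map_add' := θ.apply_pair_add_right a
          map_smul' := fun c b => θ.apply_pair_smul_right c a b }
      map_add' := fun a a' => by ext b; exact θ.apply_pair_add_left a a' b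
      map_smul' := fun c a => by ext b; exact θ.apply_pair_smul_left c a b }

@[simp]
theorem bilinOfAlternating_apply [FiniteDimensional ℝ V] (θ : V [⋀^Fin 2]→L[ℝ] ℝ) (a b : V) :
    bilinOfAlternating θ a b = θ ![a, b] := rfl

end Alternating

theorem fderiv_apply_apply {V X Y W : Type*} [NormedAddCommGroup V] [NormedSpace ℝ V]
    [NormedAddCommGroup X] [NormedSpace ℝ X] [NormedAddCommGroup Y] [NormedSpace ℝ Y]
    [NormedAddCommGroup W] [NormedSpace ℝ W] {β : V → X →L[ℝ] Y →L[ℝ] W} {x : V}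
    (hβ : DifferentiableAt ℝ β x) (a : V) (b : X) (c : Y) :
    fderiv ℝ (fun y => β y b c) x a = fderiv ℝ β x a b c := by
  have h := (hβ.hasFDerivAt.clm_apply (hasFDerivAt_const b x)).clm_apply (hasFDerivAt_const c x)
  rw [h.fderiv]
  simp

theorem standardSymplecticForm_apply (v : Fin 2 → EuclideanSpace ℝ (Fin 4)) :
    standardSymplecticForm v = v 0 0 * v 1 1 - v 0 1 * v 1 0 + (v 0 2 * v 1 3 - v 0 3 * v 1 2) := by
  rfl

theorem eq_zero_of_standardSymplecticForm {a : EuclideanSpace ℝ (Fin 4)}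
    (h : ∀ b, standardSymplecticForm ![a, b] = 0) : a = 0 := by
  have h0 := h (EuclideanSpace.single 0 1)
  have h1 := h (EuclideanSpace.single 1 1)
  have h2 := h (EuclideanSpace.single 2 1)
  have h3 := h (EuclideanSpace.single 3 1)
  simp [standardSymplecticForm_apply] at h0 h1 h2 h3
  ext i
  fin_cases i <;> simp [*]

/-- The isomorphism of `ℝ⁴` with its dual given by the standard symplectic form. -/
theorem exists_standardSymplectic_equiv :
    ∃ B : EuclideanSpace ℝ (Fin 4) ≃L[ℝ] (EuclideanSpace ℝ (Fin 4) →L[ℝ] ℝ),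
      (B : EuclideanSpace ℝ (Fin 4) →L[ℝ] _) = bilinOfAlternating standardSymplecticForm := by
  let V := EuclideanSpace ℝ (Fin 4)
  let b : V →L[ℝ] V →L[ℝ] ℝ := bilinOfAlternating standardSymplecticForm
  have hinj : Function.Injective b.toLinearMap := by
    rw [injective_iff_map_eq_zero]
    intro a ha
    exact eq_zero_of_standardSymplecticForm fun c => DFunLike.congr_fun ha c
  have hdim : Module.finrank ℝ V = Module.finrank ℝ (V →L[ℝ] ℝ) := by
    rw [← (LinearMap.toContinuousLinearMap (𝕜 := ℝ) (E := V) (F' := ℝ)).finrank_eq]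
    exact (Subspace.dual_finrank_eq (K := ℝ) (V := V)).symm
  exact ⟨(LinearEquiv.ofBijective b.toLinearMap
    ⟨hinj, (LinearMap.injective_iff_surjective_of_finrank_eq_finrank hdim).1 hinj⟩).toContinuousLinearEquiv,
    rfl⟩

/-- Darboux's theorem near the origin of `ℝ⁴`, for a closed 2-form which is already standard at the
origin. -/
theorem exists_darboux_coordinates {U : Set (EuclideanSpace ℝ (Fin 4))} (hU : IsOpen U)
    (h0U : 0 ∈ U)
    {η : EuclideanSpace ℝ (Fin 4) → EuclideanSpace ℝ (Fin 4) [⋀^Fin 2]→L[ℝ] ℝ}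
    (hη : ContDiffOn ℝ ∞ η U) (hclosed : ∀ x ∈ U, extDeriv η x = 0)
    (h0 : η 0 = standardSymplecticForm) :
    ∃ φ : EuclideanSpace ℝ (Fin 4) → EuclideanSpace ℝ (Fin 4), φ 0 = 0 ∧
      HasStrictFDerivAt φ (ContinuousLinearMap.id ℝ _) 0 ∧
      ∀ᶠ x in 𝓝 0, ContDiffAt ℝ ∞ φ x ∧
        (η (φ x)).compContinuousLinearMap (fderiv ℝ φ x) = standardSymplecticForm := by
  obtain ⟨r, hr, hball⟩ := Metric.isOpen_iff.1 hU 0 h0U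
  -- The cutoff makes the form globally smooth, as Moser's argument requires. The product is closed
  -- near the origin, where the cutoff is 1, and that is enough.
  let χ : ContDiffBump (0 : EuclideanSpace ℝ (Fin 4)) :=
    ⟨r / 3, r / 2, by positivity, by linarith⟩
  let Ω : EuclideanSpace ℝ (Fin 4) → Bilin (EuclideanSpace ℝ (Fin 4)) := fun x =>
    bilinOfAlternating (χ x • η x)
  have hη' : ContDiff ℝ ∞ fun x => χ x • η x := by
    rw [contDiff_iff_contDiffAt]
    intro x
    by_cases hx : x ∈ U
    · exact χ.contDiff.contDiffAt.smul (hη.contDiffAt (hU.mem_nhds hx))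
    · have hx' : x ∉ tsupport χ := by
        intro h
        rw [χ.tsupport_eq] at h
        exact hx (hball (Metric.closedBall_subset_ball (by change r / 2 < r; linarith) h))
      refine contDiffAt_const (c := 0) |>.congr_of_eventuallyEq ?_
      filter_upwards [notMem_tsupport_iff_eventuallyEq.1 hx'] with y hy
      rw [hy]
      exact zero_smul ℝ _
  have hΩ : ContDiff ℝ ∞ Ω := by
    refine contDiff_clm_apply_iff.2 fun a => contDiff_clm_apply_iff.2 fun b => ?_
    exact (ContinuousAlternatingMap.apply ℝ (EuclideanSpace ℝ (Fin 4)) ℝ ![a, b]).contDiff.comp hη'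
  have hone : ∀ᶠ x in 𝓝 0, Ω x = bilinOfAlternating (η x) := by
    filter_upwards [χ.eventuallyEq_one] with x hx
    change bilinOfAlternating (χ x • η x) = _
    rw [hx, Pi.one_apply, one_smul]
  obtain ⟨B₀, hB₀⟩ := exists_standardSymplectic_equiv
  have hcl : ∀ᶠ x in 𝓝 0, IsClosedAt Ω x := by
    filter_upwards [hone.eventually_nhds, hU.mem_nhds h0U] with x hx hxU a b c
    have hηd : DifferentiableAt ℝ η x := (hη.contDiffAt (hU.mem_nhds hxU)).differentiableAt (by simp)
    have key : ∀ a b c, fderiv ℝ Ω x a b c = fderiv ℝ (fun y => η y ![b, c]) x a := by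
      intro a b c
      have h1 : (fun y => η y ![b, c]) =ᶠ[𝓝 x] fun y => Ω y b c := by
        filter_upwards [hx] with y hy
        rw [hy]
        rfl
      rw [h1.fderiv_eq, fderiv_apply_apply (hΩ.differentiable (by simp) x)]
    have h := DFunLike.congr_fun (hclosed x hxU) ![a, b, c]
    rw [extDeriv_apply hηd, Fin.sum_univ_three] at h
    rw [key, key, key]
    have r0 : Fin.removeNth (0 : Fin 3) ![a, b, c] = ![b, c] := by
      ext i; fin_cases i <;> rfl
    have r1 : Fin.removeNth (1 : Fin 3) ![a, b, c] = ![a, c] := by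
      ext i; fin_cases i <;> rfl
    have r2 : Fin.removeNth (2 : Fin 3) ![a, b, c] = ![a, b] := by
      ext i; fin_cases i <;> rfl
    rw [r0, r1, r2] at h
    simpa [sub_eq_add_neg] using h
  obtain ⟨φ, hφ0, hφd, hφ⟩ := exists_constant_coordinates hΩ
    (fun x a b => (χ x • η x).apply_pair_swap a b) B₀
    (by rw [hone.self_of_nhds, h0, hB₀]) hcl
  refine ⟨φ, hφ0, hφd, ?_⟩
  have hc : ContinuousAt φ 0 := hφd.continuousAt
  have hone' := hc.eventually (by rw [hφ0]; exact hone)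
  filter_upwards [hφ, hone'] with x hx hx'
  refine ⟨hx.1, ContinuousAlternatingMap.ext_pair fun a b => ?_⟩
  rw [ContinuousAlternatingMap.compContinuousLinearMap_pair]
  have := hx.2 a b
  rw [hx'] at this
  rw [← bilinOfAlternating_apply, this]
  exact DFunLike.congr_fun (DFunLike.congr_fun hB₀ a) b

end

/-! ### Symplectic frames and Darboux balls on a Kähler surface. -/

noncomputable section

open Topology

/-- A 2-form on a complex plane which is positive and of type `(1,1)` is standard in suitable real
coordinates. -/
theorem exists_symplectic_frame {E : Type*} [NormedAddCommGroup E] [NormedSpace ℂ E]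
    (hE : Module.finrank ℂ E = 2) (θ : E [⋀^Fin 2]→L[ℝ] ℝ)
    (hJ : ∀ u v : E, θ ![Complex.I • u, Complex.I • v] = θ ![u, v])
    (hpos : ∀ u : E, u ≠ 0 → 0 < θ ![u, Complex.I • u]) :
    ∃ L : EuclideanSpace ℝ (Fin 4) →L[ℝ] E,
      θ.compContinuousLinearMap L = standardSymplecticForm := by
  have hcomm : ∀ (c : ℝ) (u : E), Complex.I • (c • u) = c • (Complex.I • u) := fun c u =>
    smul_comm _ _ _
  have hII : ∀ u : E, Complex.I • (Complex.I • u) = (-1 : ℝ) • u := fun u => by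
    rw [smul_smul, Complex.I_mul_I, neg_smul, one_smul, neg_smul, one_smul]
  have hnorm : ∀ u : E, u ≠ 0 → ∃ c : ℝ, θ ![c • u, Complex.I • (c • u)] = 1 := by
    intro u hu
    refine ⟨(Real.sqrt (θ ![u, Complex.I • u]))⁻¹, ?_⟩
    rw [hcomm, θ.apply_pair_smul_left, θ.apply_pair_smul_right]
    have h := Real.sq_sqrt (hpos u hu).le
    have h' := (Real.sqrt_pos.2 (hpos u hu)).ne'
    field_simp
    exact h.symm
  have : Nontrivial E := Module.nontrivial_of_finrank_pos (R := ℂ) (by omega)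
  obtain ⟨u₀, hu₀⟩ := exists_ne (0 : E)
  obtain ⟨c, hc⟩ := hnorm u₀ hu₀
  generalize c • u₀ = u at hc
  obtain ⟨w, hw⟩ : ∃ w : E, ∀ a : ℂ, a • u ≠ w := by
    by_contra! h
    have := finrank_le_one (R := ℂ) u h
    omega
  -- Symplectic Gram–Schmidt: the added terms make the vector θ-orthogonal to u and iu. It is
  -- nonzero because w is not a complex multiple of u.
  have hv₀ : w + ((-θ ![w, Complex.I • u]) • u + θ ![w, u] • (Complex.I • u)) ≠ 0 := by
    intro h
    refine hw (((θ ![w, Complex.I • u] : ℝ) : ℂ) - (θ ![w, u] : ℝ) * Complex.I) ?_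
    rw [sub_smul, mul_smul, Complex.coe_smul, Complex.coe_smul]
    rw [neg_smul] at h
    refine (eq_neg_of_add_eq_zero_left h).trans ?_ |>.symm
    abel
  have hIu : θ ![Complex.I • u, u] = -1 := by
    rw [θ.apply_pair_swap, hc]
  have h1 : θ ![w + ((-θ ![w, Complex.I • u]) • u + θ ![w, u] • (Complex.I • u)), u] = 0 := by
    rw [θ.apply_pair_add_left, θ.apply_pair_add_left, θ.apply_pair_smul_left,
      θ.apply_pair_smul_left, θ.apply_pair_self, hIu]
    ring
  have h2 : θ ![w + ((-θ ![w, Complex.I • u]) • u + θ ![w, u] • (Complex.I • u)),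
      Complex.I • u] = 0 := by
    rw [θ.apply_pair_add_left, θ.apply_pair_add_left, θ.apply_pair_smul_left,
      θ.apply_pair_smul_left, θ.apply_pair_self, hc]
    ring
  obtain ⟨d, hd⟩ := hnorm _ hv₀
  replace h1 := (θ.apply_pair_smul_left d _ u).trans (by rw [h1, mul_zero])
  replace h2 := (θ.apply_pair_smul_left d _ (Complex.I • u)).trans (by rw [h2, mul_zero])
  generalize d • (w + ((-θ ![w, Complex.I • u]) • u + θ ![w, u] • (Complex.I • u))) = v
    at hd h1 h2
  have hIv : θ ![Complex.I • v, v] = -1 := by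
    rw [θ.apply_pair_swap, hd]
  have h3 : θ ![Complex.I • v, u] = 0 := by
    rw [← hJ, hII, θ.apply_pair_smul_left, h2, mul_zero]
  have h4 : θ ![Complex.I • v, Complex.I • u] = 0 := by
    rw [hJ, h1]
  have h1' : θ ![u, v] = 0 := by rw [θ.apply_pair_swap, h1, neg_zero]
  have h2' : θ ![Complex.I • u, v] = 0 := by rw [θ.apply_pair_swap, h2, neg_zero]
  have h3' : θ ![u, Complex.I • v] = 0 := by rw [θ.apply_pair_swap, h3, neg_zero]
  have h4' : θ ![Complex.I • u, Complex.I • v] = 0 := by rw [θ.apply_pair_swap, h4, neg_zero]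
  refine ⟨(EuclideanSpace.proj (𝕜 := ℝ) 0).smulRight u + (EuclideanSpace.proj 1).smulRight (Complex.I • u) +
    (EuclideanSpace.proj 2).smulRight v + (EuclideanSpace.proj 3).smulRight (Complex.I • v),
    ContinuousAlternatingMap.ext_pair fun a b => ?_⟩
  rw [ContinuousAlternatingMap.compContinuousLinearMap_pair, standardSymplecticForm_apply]
  simp only [add_apply, ContinuousLinearMap.smulRight_apply, PiLp.proj_apply,
    θ.apply_pair_add_left, θ.apply_pair_add_right, θ.apply_pair_smul_left, θ.apply_pair_smul_right,
    θ.apply_pair_self, hc, hIu, hd, hIv, h1, h2, h3, h4, h1', h2', h3', h4']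
  simp only [Matrix.cons_val_zero, Matrix.cons_val_one]
  ring

/-- A point of a Kähler surface has a Darboux neighbourhood. -/
theorem exists_isDarbouxBall {E : Type*} [NormedAddCommGroup E] [NormedSpace ℂ E]
    (hE : Module.finrank ℂ E = 2)
    {S : Type*} [TopologicalSpace S] [Nonempty S] [ChartedSpace E S] [IsManifold 𝓘(ℂ, E) ω S]
    (ωS : TwoForm 𝓘(ℝ, E) S) (hωS : IsKahlerForm ωS) :
    ∃ (R : ℝ) (ψ : EuclideanSpace ℝ (Fin 4) → S), 0 < R ∧ IsDarbouxBall ωS R ψ := by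
  have : IsManifold 𝓘(ℝ, E) ∞ S := isManifold_real
  have : IsManifold 𝓘(ℝ, E) 1 S := IsManifold.of_le (n := ∞) (by norm_cast)
  obtain ⟨x₀⟩ := ‹Nonempty S›
  let e := chartAt E x₀
  have he : e ∈ atlas E S := chart_mem_atlas E x₀
  let y₀ : E := e x₀
  have hy₀ : y₀ ∈ e.target := e.map_source (mem_chart_source E x₀)
  obtain ⟨L₀, hL₀⟩ := exists_symplectic_frame hE (ωS (e.symm y₀))
    (hωS.compatible (e.symm y₀)) (hωS.positive (e.symm y₀))
  -- Composing the frame with the inverse of the differential of the inverse chart makes the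
  -- coordinate expression of the form standard at the origin.
  let D : E ≃L[ℝ] E := (mdifferentiable_of_mem_atlas (I := 𝓘(ℝ, E)) he).symm.mfderiv hy₀
  let L : EuclideanSpace ℝ (Fin 4) →L[ℝ] E := (D.symm : E →L[ℝ] E).comp L₀
  let k : EuclideanSpace ℝ (Fin 4) → E := fun x => y₀ + L x
  have hk : ContDiff ℝ ∞ k := contDiff_const.add L.contDiff
  have hkd : ∀ x, fderiv ℝ k x = L := fun x => (L.hasFDerivAt.const_add y₀).fderiv
  let U := k ⁻¹' e.target
  have hU : IsOpen U := e.open_target.preimage hk.continuous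
  have hk0 : k 0 = y₀ := by simp [k]
  have h0U : 0 ∈ U := by
    change k 0 ∈ e.target
    rwa [hk0]
  let η := ωS.inChart e
  have hηs := hωS.smooth e he
  have hinjL : Function.Injective L := by
    rw [injective_iff_map_eq_zero]
    intro a ha
    refine eq_zero_of_standardSymplecticForm fun b => ?_
    have h0 : L₀ a = 0 := by
      have : D.symm (L₀ a) = 0 := ha
      simpa using this
    have h1 := (ContinuousAlternatingMap.compContinuousLinearMap_pair
      (show E [⋀^Fin 2]→L[ℝ] ℝ from ωS (e.symm y₀)) L₀ a b)
    rw [h0] at h1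
    rw [← hL₀]
    refine h1.trans ?_
    have := ContinuousAlternatingMap.apply_pair_smul_left
      (show E [⋀^Fin 2]→L[ℝ] ℝ from ωS (e.symm y₀)) 0 0 (L₀ b)
    simpa using this
  have hη1 : ContDiffOn ℝ ∞ (fun x => (η (k x)).compContinuousLinearMap L) U := by
    exact (ContinuousAlternatingMap.compContinuousLinearMapCLM (F := ℝ) (ι := Fin 2) L).contDiff.comp_contDiffOn
      (hηs.comp hk.contDiffOn fun x hx => hx)
  have hη2 : ∀ x ∈ U, extDeriv (fun x => (η (k x)).compContinuousLinearMap L) x = 0 := by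
    intro x hx
    have h := extDeriv_pullback (f := k) (x := x) (r := ∞)
      (((show ContDiffOn ℝ ∞ η e.target from hηs).contDiffAt (e.open_target.mem_nhds hx)).differentiableAt (by simp)) hk.contDiffAt
      (by rw [minSmoothness_of_isRCLikeNormedField]; norm_cast)
    simp only [hkd] at h
    rw [h, hωS.closed e he _ hx]
    rfl
  have hη3 : (η (k 0)).compContinuousLinearMap L = standardSymplecticForm := by
    rw [← hL₀]
    rw [hk0]
    change ((ωS (e.symm y₀)).compContinuousLinearMap (D : E →L[ℝ] E)).compContinuousLinearMap L = _
    refine ContinuousAlternatingMap.ext fun v => ?_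
    simp only [ContinuousAlternatingMap.compContinuousLinearMap_apply]
    exact congrArg (ωS (e.symm y₀)) (funext fun i => D.apply_symm_apply _)
  obtain ⟨φ, hφ0, hφd, hφ⟩ := exists_darboux_coordinates hU h0U hη1 hη2 hη3
  have hkφ : ContinuousAt (fun x => k (φ x)) 0 := hk.continuous.continuousAt.comp hφd.continuousAt
  have htarget : ∀ᶠ x in 𝓝 0, k (φ x) ∈ e.target :=
    hkφ.eventually (e.open_target.mem_nhds (by change k (φ 0) ∈ _; rw [hφ0, hk0]; exact hy₀))
  have hφd' : HasStrictFDerivAt φ ((ContinuousLinearEquiv.refl ℝ (EuclideanSpace ℝ (Fin 4)) :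
    EuclideanSpace ℝ (Fin 4) ≃L[ℝ] EuclideanSpace ℝ (Fin 4)) :
      EuclideanSpace ℝ (Fin 4) →L[ℝ] EuclideanSpace ℝ (Fin 4)) 0 := hφd
  -- The strict derivative of φ at the origin is the identity, so φ is injective near it; with the
  -- injectivity of `L` and of the inverse chart this gives injectivity of the Darboux map.
  have hinj : ∀ᶠ x in 𝓝 0, x ∈ (hφd'.toOpenPartialHomeomorph φ).source :=
    (hφd'.toOpenPartialHomeomorph φ).open_source.mem_nhds
      hφd'.mem_toOpenPartialHomeomorph_source
  obtain ⟨R, hR, hball⟩ := Metric.eventually_nhds_iff_ball.1 ((hφ.and htarget).and hinj)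
  refine ⟨R, fun x => e.symm (k (φ x)), hR, ?_, ?_, ?_⟩
  · refine (contMDiffOn_symm_of_mem_maximalAtlas (I := 𝓘(ℝ, E)) (n := ∞)
      (IsManifold.subset_maximalAtlas he)).comp (t := e.target) ?_
      fun x hx => (hball x hx).1.2
    rw [contMDiffOn_iff_contDiffOn]
    exact fun x hx => (hk.contDiffAt.comp x (hball x hx).1.1.1).contDiffWithinAt
  · intro x hx y hy hxy
    have h1 := e.symm.injOn (hball x hx).1.2 (hball y hy).1.2 hxy
    have h2 : φ x = φ y := hinjL (add_left_cancel h1)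
    exact (hφd'.toOpenPartialHomeomorph φ).injOn (hball x hx).2 (hball y hy).2 h2
  · intro x hx
    obtain ⟨⟨⟨hφx, hφω⟩, hxt⟩, -⟩ := hball x hx
    have hφx' := hφx.differentiableAt (by simp)
    have hkφd : HasFDerivAt (fun x => k (φ x)) (L.comp (fderiv ℝ φ x)) x :=
      (L.hasFDerivAt.const_add y₀).comp x hφx'.hasFDerivAt
    have hm : mfderiv (𝓡 4) 𝓘(ℝ, E) (e.symm ∘ fun x => k (φ x)) x =
        (mfderiv 𝓘(ℝ, E) 𝓘(ℝ, E) e.symm (k (φ x))).comp (L.comp (fderiv ℝ φ x)) := by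
      have := mfderiv_comp (I := 𝓡 4) (I' := 𝓘(ℝ, E)) (I'' := 𝓘(ℝ, E)) x
        (mdifferentiableAt_atlas_symm he hxt)
        (hkφd.differentiableAt.mdifferentiableAt)
      rw [mfderiv_eq_fderiv, hkφd.fderiv] at this
      exact this
    rw [← hφω]
    change (ωS (e.symm (k (φ x)))).compContinuousLinearMap
      (mfderiv (𝓡 4) 𝓘(ℝ, E) (e.symm ∘ fun x => k (φ x)) x) = _
    rw [hm]
    rfl

end

noncomputable section

/-! ### The Hopf map and the Fubini–Study form -/

open Topology

theorem areaForm_pair (a b : ℂ) : areaForm ![a, b] = a.re * b.im - a.im * b.re := rfl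

/-- Multiplication by c scales areas by |c|². This factor compensates the Fubini–Study denominator
when the affine coordinate is expressed through a unit lift. -/
theorem areaForm_mul_pair (c a b : ℂ) :
    areaForm ![c * a, c * b] = Complex.normSq c * areaForm ![a, b] := by
  simp only [areaForm_pair, Complex.mul_re, Complex.mul_im, Complex.normSq_apply]
  ring

/-- The Fubini–Study form in an affine coordinate, in terms of a unit lift to `ℂ²`. -/
theorem fubiniStudy_affine {u₀ u₁ : ℂ} (h₀ : u₀ ≠ 0)
    (h : Complex.normSq u₀ + Complex.normSq u₁ = 1) (a₀ a₁ b₀ b₁ : ℂ) :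
    ((1 + ‖u₁ / u₀‖ ^ 2) ^ 2)⁻¹ *
        areaForm ![(a₁ - u₁ / u₀ * a₀) / u₀, (b₁ - u₁ / u₀ * b₀) / u₀] =
      areaForm ![a₁ * u₀ - u₁ * a₀, b₁ * u₀ - u₁ * b₀] := by
  have e : ∀ c₀ c₁ : ℂ, (c₁ - u₁ / u₀ * c₀) / u₀ = (u₀ ^ 2)⁻¹ * (c₁ * u₀ - u₁ * c₀) := by
    intro c₀ c₁
    field_simp
  have hn : 0 < Complex.normSq u₀ := Complex.normSq_pos.2 h₀
  have h1 : 1 + ‖u₁ / u₀‖ ^ 2 = (Complex.normSq u₀)⁻¹ := by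
    rw [← Complex.normSq_eq_norm_sq, map_div₀, eq_sub_of_add_eq' h]
    field_simp
    ring
  rw [e, e, areaForm_mul_pair, h1, map_inv₀, map_pow]
  field_simp

/-- The components of the vector `(-w̄, z̄)` as real-linear functions of `(z, w)`. -/
def antipodalCLM (k : Fin 2) : EuclideanSpace ℝ (Fin 4) →L[ℝ] ℂ :=
  LinearMap.toContinuousLinearMap
    { toFun := fun y => antipodalLift (toC2 y) k
      map_add' := fun y y' => by fin_cases k <;> simp [antipodalLift, toC2, Complex.ext_iff] <;> ring
      map_smul' := fun c y => by fin_cases k <;> simp [antipodalLift, toC2, Complex.ext_iff] }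

theorem antipodalCLM_apply (k : Fin 2) (y : EuclideanSpace ℝ (Fin 4)) :
    antipodalCLM k y = antipodalLift (toC2 y) k := rfl

theorem antipodalCLM_zero (y : EuclideanSpace ℝ (Fin 4)) : antipodalCLM 0 y = ⟨-y 2, y 3⟩ := by
  simp [antipodalCLM_apply, antipodalLift, toC2, Complex.ext_iff]

theorem antipodalCLM_one (y : EuclideanSpace ℝ (Fin 4)) : antipodalCLM 1 y = ⟨y 0, -y 1⟩ := by
  simp [antipodalCLM_apply, antipodalLift, toC2, Complex.ext_iff]

theorem antipodalLift_toC2_ne_zero (x : S3) : antipodalLift (toC2 x.1) ≠ 0 := fun h =>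
  toC2_ne_zero x (antipodalLift_injective (h.trans (map_zero _).symm))

theorem continuous_antipodal_hopf : Continuous fun x : S3 => antipodal (hopf x) := by
  have h : Continuous fun x : S3 =>
      (⟨antipodalLift (toC2 x.1), antipodalLift_toC2_ne_zero x⟩ : {v : Fin 2 → ℂ // v ≠ 0}) :=
    Continuous.subtype_mk
      (continuous_pi fun k => (antipodalCLM k).continuous.comp continuous_subtype_val) _
  exact P1.isQuotientMap_mk'.continuous.comp h

theorem affineChart_antipodal_hopf (i : Fin 2) (x : S3) :
    P1.affineChart i (antipodal (hopf x)) = antipodalCLM (i + 1) x.1 / antipodalCLM i x.1 :=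
  P1.affineCoord_mk i _ _

theorem exists_chartAt_antipodal_hopf (x : S3) : ∃ i : Fin 2,
    chartAt ℂ (antipodal (hopf x)) = P1.affineChart i ∧ antipodalCLM i x.1 ≠ 0 := by
  obtain ⟨i, hi⟩ := chart_mem_atlas ℂ (antipodal (hopf x))
  refine ⟨i, hi.symm, ?_⟩
  have h := mem_chart_source ℂ (antipodal (hopf x))
  rw [← hi] at h
  exact (P1.mk_mem_affineSet i _ (antipodalLift_toC2_ne_zero x)).1 h

theorem contDiffAt_antipodalCLM_div {i : Fin 2} {y : EuclideanSpace ℝ (Fin 4)}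
    (hy : antipodalCLM i y ≠ 0) :
    ContDiffAt ℝ ∞ (fun y => antipodalCLM (i + 1) y / antipodalCLM i y) y :=
  (antipodalCLM (i + 1)).contDiff.contDiffAt.mul ((antipodalCLM i).contDiff.contDiffAt.inv hy)

theorem fderiv_antipodalCLM_div {i : Fin 2} {y : EuclideanSpace ℝ (Fin 4)}
    (hy : antipodalCLM i y ≠ 0) (a : EuclideanSpace ℝ (Fin 4)) :
    fderiv ℝ (fun y => antipodalCLM (i + 1) y / antipodalCLM i y) y a =
      (antipodalCLM (i + 1) a - antipodalCLM (i + 1) y / antipodalCLM i y * antipodalCLM i a) /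
        antipodalCLM i y := by
  have h1 := ((contDiffAt_antipodalCLM_div hy).differentiableAt (by simp)).hasFDerivAt
  have h2 := h1.mul (antipodalCLM i).hasFDerivAt
  -- The derivative of the quotient is found by applying the product rule to quotient times
  -- denominator, which equals the numerator near y.
  have h3 : (fun y => antipodalCLM (i + 1) y / antipodalCLM i y * antipodalCLM i y) =ᶠ[𝓝 y]
      antipodalCLM (i + 1) := by
    filter_upwards [(antipodalCLM i).continuous.continuousAt.eventually_ne hy] with z hz
    exact div_mul_cancel₀ _ hz
  have h4 := DFunLike.congr_fun
    ((h2.congr_of_eventuallyEq h3.symm).unique (antipodalCLM (i + 1)).hasFDerivAt) a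
  simp only [add_apply, smul_apply, smul_eq_mul] at h4
  rw [eq_div_iff hy, ← h4]
  ring

/-- The dimension count behind the manifold structure of the 3-sphere. -/
instance : Fact (Module.finrank ℝ (EuclideanSpace ℝ (Fin 4)) = 3 + 1) := ⟨by simp⟩

theorem contMDiff_antipodal_hopf :
    ContMDiff (𝓡 3) 𝓘(ℝ, ℂ) ∞ fun x : S3 => antipodal (hopf x) := by
  intro x
  rw [contMDiffAt_iff_target]
  refine ⟨continuous_antipodal_hopf.continuousAt, ?_⟩
  obtain ⟨i, hi, hne⟩ := exists_chartAt_antipodal_hopf x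
  have h : (extChartAt 𝓘(ℝ, ℂ) (antipodal (hopf x)) ∘ fun x : S3 => antipodal (hopf x)) =
      (fun y => antipodalCLM (i + 1) y / antipodalCLM i y) ∘ (Subtype.val : S3 → _) := by
    ext y
    simp only [extChartAt, hi, mfld_simps, Function.comp_apply]
    exact affineChart_antipodal_hopf i y
  rw [h]
  exact (contDiffAt_antipodalCLM_div hne).contMDiffAt.comp x (contMDiff_coe_sphere x)

/-- The differential of the inclusion of the sphere in `ℝ⁴`. -/
def sphereIncl (x : S3) : TangentSpace (𝓡 3) x →L[ℝ] EuclideanSpace ℝ (Fin 4) :=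
  mfderiv (𝓡 3) (𝓡 4) (Subtype.val : S3 → EuclideanSpace ℝ (Fin 4)) x

theorem sphereIncl_injective (x : S3) : Function.Injective (sphereIncl x) :=
  injective_mvfderiv_subtypeVal_sphere x

theorem inner_sphereIncl (x : S3) (a : TangentSpace (𝓡 3) x) :
    x.1 0 * sphereIncl x a 0 + x.1 1 * sphereIncl x a 1 + x.1 2 * sphereIncl x a 2 +
      x.1 3 * sphereIncl x a 3 = 0 := by
  have h : sphereIncl x a ∈ (Submodule.span ℝ {x.1})ᗮ := by
    rw [← range_mvfderiv_subtypeVal (n := 3) x]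
    exact ⟨a, rfl⟩
  have h' := (Submodule.mem_orthogonal_singleton_iff_inner_right).1 h
  rw [PiLp.inner_apply, Fin.sum_univ_four] at h'
  simp only [RCLike.inner_apply, conj_trivial] at h'
  linarith

theorem sphere_sq_sum (x : S3) : x.1 0 ^ 2 + x.1 1 ^ 2 + x.1 2 ^ 2 + x.1 3 ^ 2 = 1 := by
  have h := norm_eq_of_mem_sphere x
  have h2 := EuclideanSpace.norm_sq_eq x.1
  rw [h, Fin.sum_univ_four] at h2
  simp only [Real.norm_eq_abs, sq_abs] at h2
  linarith

theorem normSq_antipodalCLM (i : Fin 2) {x : EuclideanSpace ℝ (Fin 4)}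
    (hx : x 0 ^ 2 + x 1 ^ 2 + x 2 ^ 2 + x 3 ^ 2 = 1) :
    Complex.normSq (antipodalCLM i x) + Complex.normSq (antipodalCLM (i + 1) x) = 1 := by
  fin_cases i
  · simp [antipodalCLM_zero, antipodalCLM_one, Complex.normSq_apply]
    linarith
  · simp [antipodalCLM_zero, antipodalCLM_one, Complex.normSq_apply]
    linarith

/-- For a unit vector u of ℂ², the expression a₁u₀ − u₁a₀ is the Hermitian component of a along the
unit normal to the line ℂu. Tangent vectors of the sphere differ from their normal parts by
multiples of iu, which is symplectically orthogonal to the tangent space, so the area form returns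
the standard form. The sign appears because the antipodal lift is conjugate-linear and reverses that
form. -/
theorem areaForm_antipodalCLM (i : Fin 2) {x a b : EuclideanSpace ℝ (Fin 4)}
    (hx : x 0 ^ 2 + x 1 ^ 2 + x 2 ^ 2 + x 3 ^ 2 = 1)
    (ha : x 0 * a 0 + x 1 * a 1 + x 2 * a 2 + x 3 * a 3 = 0)
    (hb : x 0 * b 0 + x 1 * b 1 + x 2 * b 2 + x 3 * b 3 = 0) :
    areaForm ![antipodalCLM (i + 1) a * antipodalCLM i x - antipodalCLM (i + 1) x * antipodalCLM i a,
        antipodalCLM (i + 1) b * antipodalCLM i x - antipodalCLM (i + 1) x * antipodalCLM i b] =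
      -(a 0 * b 1 - a 1 * b 0 + (a 2 * b 3 - a 3 * b 2)) := by
  rw [areaForm_pair]
  fin_cases i
  · simp only [Fin.zero_eta, Fin.isValue, zero_add, antipodalCLM_zero, antipodalCLM_one,
      Complex.sub_re, Complex.sub_im, Complex.mul_re, Complex.mul_im]
    linear_combination (-(a 0 * b 1 - a 1 * b 0 + (a 2 * b 3 - a 3 * b 2))) * hx +
      (x 0 * b 1 - x 1 * b 0 + x 2 * b 3 - x 3 * b 2) * ha -
      (x 0 * a 1 - x 1 * a 0 + x 2 * a 3 - x 3 * a 2) * hb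
  · simp only [Fin.mk_one, Fin.isValue, show (1 : Fin 2) + 1 = 0 from rfl, antipodalCLM_zero,
      antipodalCLM_one, Complex.sub_re, Complex.sub_im, Complex.mul_re, Complex.mul_im]
    linear_combination (-(a 0 * b 1 - a 1 * b 0 + (a 2 * b 3 - a 3 * b 2))) * hx +
      (x 0 * b 1 - x 1 * b 0 + x 2 * b 3 - x 3 * b 2) * ha -
      (x 0 * a 1 - x 1 * a 0 + x 2 * a 3 - x 3 * a 2) * hb

/-- The Fubini–Study form pulls back along the antipode of the Hopf map to the opposite of the
restriction of the standard symplectic form to the sphere. -/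
theorem pullback_fubiniStudy (x : S3) :
    TwoForm.pullback (𝓡 3) 𝓘(ℝ, ℂ) (fun x : S3 => antipodal (hopf x)) fubiniStudy x =
      -standardSymplecticForm.compContinuousLinearMap (sphereIncl x) := by
  have : IsManifold 𝓘(ℝ, ℂ) ∞ P1 := isManifold_real
  have : IsManifold 𝓘(ℝ, ℂ) 1 P1 := IsManifold.of_le (n := ∞) (by norm_cast)
  obtain ⟨i, hi, hne⟩ := exists_chartAt_antipodal_hopf x
  let f : S3 → P1 := fun x => antipodal (hopf x)
  let q : EuclideanSpace ℝ (Fin 4) → ℂ := fun y => antipodalCLM (i + 1) y / antipodalCLM i y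
  have hcomp : chartAt ℂ (f x) ∘ f = q ∘ (Subtype.val : S3 → _) := by
    ext y
    exact (congrArg (fun e : OpenPartialHomeomorph P1 ℂ => e (f y)) hi).trans
      (affineChart_antipodal_hopf i y)
  have hd1 : mfderiv (𝓡 3) 𝓘(ℝ, ℂ) (chartAt ℂ (f x) ∘ f) x =
      (mfderiv 𝓘(ℝ, ℂ) 𝓘(ℝ, ℂ) (chartAt ℂ (f x)) (f x)).comp (mfderiv (𝓡 3) 𝓘(ℝ, ℂ) f x) :=
    mfderiv_comp x (mdifferentiableAt_atlas (chart_mem_atlas ℂ (f x)) (mem_chart_source ℂ (f x)))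
      ((contMDiff_antipodal_hopf x).mdifferentiableAt (by simp))
  have hd2 : mfderiv (𝓡 3) 𝓘(ℝ, ℂ) (q ∘ (Subtype.val : S3 → _)) x =
      (fderiv ℝ q x.1).comp (sphereIncl x) := by
    have h := mfderiv_comp (I := 𝓡 3) (I' := 𝓡 4) (I'' := 𝓘(ℝ, ℂ)) (g := q)
      (f := (Subtype.val : S3 → _)) x
      ((contDiffAt_antipodalCLM_div hne).differentiableAt (by simp)).mdifferentiableAt
      ((contMDiff_coe_sphere (m := ∞) x).mdifferentiableAt (by simp))
    rw [mfderiv_eq_fderiv] at h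
    exact h
  have hval : chartAt ℂ (f x) (f x) = q x.1 := congrFun hcomp x
  -- The chart composed with the map is the quotient of linear functions restricted to the sphere,
  -- so by the chain rule the pullback is computed from ordinary derivatives in ℝ⁴.
  have key : ∀ a b : TangentSpace (𝓡 3) x,
      TwoForm.pullback (𝓡 3) 𝓘(ℝ, ℂ) f fubiniStudy x ![a, b] =
        ((1 + ‖q x.1‖ ^ 2) ^ 2)⁻¹ *
          areaForm ![fderiv ℝ q x.1 (sphereIncl x a), fderiv ℝ q x.1 (sphereIncl x b)] := by
    intro a b
    have h : ∀ c, fderiv ℝ q x.1 (sphereIncl x c) =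
        mfderiv 𝓘(ℝ, ℂ) 𝓘(ℝ, ℂ) (chartAt ℂ (f x)) (f x) (mfderiv (𝓡 3) 𝓘(ℝ, ℂ) f x c) := by
      intro c
      exact (DFunLike.congr_fun ((hd1.symm.trans (by rw [hcomp])).trans hd2) c).symm
    rw [h, h, ← hval]
    refine Eq.trans (b := ((1 + ‖chartAt ℂ (f x) (f x)‖ ^ 2) ^ 2)⁻¹ * areaForm fun i =>
      (show ℂ from mfderiv 𝓘(ℝ, ℂ) 𝓘(ℝ, ℂ) (chartAt ℂ (f x)) (f x)
        (mfderiv (𝓡 3) 𝓘(ℝ, ℂ) f x (![a, b] i)))) rfl ?_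
    exact congrArg (fun v => _ * areaForm v) (funext fun i => by fin_cases i <;> rfl)
  refine ContinuousAlternatingMap.ext_pair fun a b => ?_
  rw [key, fderiv_antipodalCLM_div hne, fderiv_antipodalCLM_div hne]
  have ha := inner_sphereIncl x a
  have hb := inner_sphereIncl x b
  have hx := sphere_sq_sum x
  have hs : -standardSymplecticForm.compContinuousLinearMap (sphereIncl x) ![a, b] =
    -(sphereIncl x a 0 * sphereIncl x b 1 - sphereIncl x a 1 * sphereIncl x b 0 +
      (sphereIncl x a 2 * sphereIncl x b 3 - sphereIncl x a 3 * sphereIncl x b 2)) := rfl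
  refine Eq.trans ?_ hs.symm
  exact (fubiniStudy_affine hne (normSq_antipodalCLM i hx) _ _ _ _).trans
    (areaForm_antipodalCLM i hx ha hb)

end

noncomputable section

/-! ### Lagrangian spheres -/

open Topology

section Spheres

variable {E : Type*} [NormedAddCommGroup E] [NormedSpace ℂ E]
  {S : Type*} [TopologicalSpace S] [ChartedSpace E S] {ωS : TwoForm 𝓘(ℝ, E) S} {R : ℝ}
  {ψ : EuclideanSpace ℝ (Fin 4) → S}

theorem IsDarbouxBall.contMDiffAt (hψ : IsDarbouxBall ωS R ψ) {v : EuclideanSpace ℝ (Fin 4)}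
    (hv : v ∈ Metric.ball 0 R) : ContMDiffAt (𝓡 4) 𝓘(ℝ, E) ∞ ψ v :=
  hψ.contMDiffOn.contMDiffAt (Metric.isOpen_ball.mem_nhds hv)

theorem IsDarbouxBall.mdifferentiableAt (hψ : IsDarbouxBall ωS R ψ)
    {v : EuclideanSpace ℝ (Fin 4)} (hv : v ∈ Metric.ball 0 R) :
    MDifferentiableAt (𝓡 4) 𝓘(ℝ, E) ψ v :=
  (hψ.contMDiffAt hv).mdifferentiableAt (by simp)

/-- A smaller ball inside a Darboux ball is a Darboux ball. -/
theorem IsDarbouxBall.translate (hψ : IsDarbouxBall ωS R ψ) {r : ℝ}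
    {c : EuclideanSpace ℝ (Fin 4)} (hc : ∀ v ∈ Metric.ball 0 r, c + v ∈ Metric.ball 0 R) :
    IsDarbouxBall ωS r fun v => ψ (c + v) where
  contMDiffOn := hψ.contMDiffOn.comp (contDiff_const.add contDiff_id).contMDiff.contMDiffOn hc
  injOn := fun v hv w hw h => add_left_cancel (hψ.injOn (hc v hv) (hc w hw) h)
  pullback_eq := fun v hv => by
    have hd : HasFDerivAt (fun v => c + v) (ContinuousLinearMap.id ℝ _) v :=
      (hasFDerivAt_id v).const_add c
    have hm := mfderiv_comp (I := 𝓡 4) (I' := 𝓡 4) (I'' := 𝓘(ℝ, E)) (g := ψ)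
      (f := fun v => c + v) v (hψ.mdifferentiableAt (hc v hv)) hd.differentiableAt.mdifferentiableAt
    rw [mfderiv_eq_fderiv, hd.fderiv] at hm
    rw [← hψ.pullback_eq _ (hc v hv)]
    change (ωS (ψ (c + v))).compContinuousLinearMap
      (mfderiv (𝓡 4) 𝓘(ℝ, E) (ψ ∘ fun v => c + v) v) = _
    rw [hm]
    rfl

theorem smul_sphere_mem_ball {r : ℝ} (hr : 0 ≤ r) (hrR : r < R) (x : S3) :
    r • x.1 ∈ Metric.ball (0 : EuclideanSpace ℝ (Fin 4)) R := by
  rw [mem_ball_zero_iff, norm_smul, norm_eq_of_mem_sphere x, mul_one, Real.norm_of_nonneg hr]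
  exact hrR

theorem contMDiff_smul_sphere (r : ℝ) :
    ContMDiff (𝓡 3) (𝓡 4) ∞ fun x : S3 => r • x.1 :=
  (contDiff_id.const_smul r).contMDiff.comp contMDiff_coe_sphere

theorem IsDarbouxBall.contMDiff_sphere (hψ : IsDarbouxBall ωS R ψ) {r : ℝ} (hr : 0 ≤ r)
    (hrR : r < R) : ContMDiff (𝓡 3) 𝓘(ℝ, E) ∞ fun x : S3 => ψ (r • x.1) := fun x =>
  (hψ.contMDiffAt (smul_sphere_mem_ball hr hrR x)).comp x (contMDiff_smul_sphere r x)

theorem IsDarbouxBall.mfderiv_sphere (hψ : IsDarbouxBall ωS R ψ) {r : ℝ} (hr : 0 ≤ r)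
    (hrR : r < R) (x : S3) : mfderiv (𝓡 3) 𝓘(ℝ, E) (fun x : S3 => ψ (r • x.1)) x =
      (mfderiv (𝓡 4) 𝓘(ℝ, E) ψ (r • x.1)).comp (r • sphereIncl x) := by
  have hd : HasFDerivAt (fun v : EuclideanSpace ℝ (Fin 4) => r • v)
      (r • ContinuousLinearMap.id ℝ _) x.1 := (hasFDerivAt_id x.1).const_smul r
  have h1 : mfderiv (𝓡 3) (𝓡 4) (fun x : S3 => r • x.1) x = r • sphereIncl x := by
    have hm := mfderiv_comp (I := 𝓡 3) (I' := 𝓡 4) (I'' := 𝓡 4)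
      (g := fun v : EuclideanSpace ℝ (Fin 4) => r • v)
      (f := (Subtype.val : S3 → _)) x hd.differentiableAt.mdifferentiableAt
      ((contMDiff_coe_sphere (m := ∞) x).mdifferentiableAt (by simp))
    rw [mfderiv_eq_fderiv, hd.fderiv] at hm
    exact hm
  have hm := mfderiv_comp (I := 𝓡 3) (I' := 𝓡 4) (I'' := 𝓘(ℝ, E)) (g := ψ)
    (f := fun x : S3 => r • x.1) x (hψ.mdifferentiableAt (smul_sphere_mem_ball hr hrR x))
    ((contMDiff_smul_sphere r x).mdifferentiableAt (by simp))
  rw [h1] at hm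
  exact hm

theorem IsDarbouxBall.pullback_sphere (hψ : IsDarbouxBall ωS R ψ) {r : ℝ} (hr : 0 ≤ r)
    (hrR : r < R) (x : S3) : TwoForm.pullback (𝓡 3) 𝓘(ℝ, E) (fun x : S3 => ψ (r • x.1)) ωS x =
      r ^ 2 • standardSymplecticForm.compContinuousLinearMap (sphereIncl x) := by
  refine ContinuousAlternatingMap.ext fun v => ?_
  change ωS (ψ (r • x.1)) (fun i => mfderiv (𝓡 3) 𝓘(ℝ, E) (fun x : S3 => ψ (r • x.1)) x (v i)) = _
  rw [hψ.mfderiv_sphere hr hrR]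
  have h := DFunLike.congr_fun (hψ.pullback_eq _ (smul_sphere_mem_ball hr hrR x))
    fun i => r • sphereIncl x (v i)
  refine Eq.trans h ?_
  have h2 := standardSymplecticForm.map_smul_univ (fun _ => r) fun i => sphereIncl x (v i)
  rw [Fin.prod_const] at h2
  exact h2

/-- A vector killed by the differential of ψ would lie in the kernel of the pulled-back form, which
is the nondegenerate standard form; the inclusion of the sphere and the scaling are injective. -/
theorem IsDarbouxBall.injective_mfderiv_sphere (hψ : IsDarbouxBall ωS R ψ) {r : ℝ} (hr : 0 < r)
    (hrR : r < R) (x : S3) :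
    Function.Injective (mfderiv (𝓡 3) 𝓘(ℝ, E) (fun x : S3 => ψ (r • x.1)) x) := by
  rw [injective_iff_map_eq_zero]
  intro a ha
  rw [hψ.mfderiv_sphere hr.le hrR] at ha
  have h0 : r • sphereIncl x a = 0 := by
    refine eq_zero_of_standardSymplecticForm fun b => ?_
    have h := DFunLike.congr_fun (hψ.pullback_eq _ (smul_sphere_mem_ball hr.le hrR x))
      ![r • sphereIncl x a, b]
    refine h.symm.trans ?_
    exact ContinuousAlternatingMap.map_coord_zero (ωS (ψ (r • x.1)))
      (m := fun i => mfderiv (𝓡 4) 𝓘(ℝ, E) ψ (r • x.1) (![r • sphereIncl x a, b] i)) 0 ha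
  exact (injective_iff_map_eq_zero _).1 (sphereIncl_injective x) a
    ((smul_eq_zero.1 h0).resolve_left hr.ne')

theorem IsDarbouxBall.injective_sphere (hψ : IsDarbouxBall ωS R ψ) {r : ℝ} (hr : 0 < r)
    (hrR : r < R) : Function.Injective fun x : S3 => ψ (r • x.1) := fun x y h =>
  Subtype.ext (smul_right_injective _ hr.ne'
    (hψ.injOn (smul_sphere_mem_ball hr.le hrR x) (smul_sphere_mem_ball hr.le hrR y) h))

/-- The product of the antipode of the Hopf map with a sphere in a Darboux ball. -/
def hopfSphere (hψ : IsDarbouxBall ωS R ψ) {r : ℝ} (hr : 0 ≤ r) (hrR : r < R) : C(S3, P1 × S) :=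
  ⟨fun x => (antipodal (hopf x), ψ (r • x.1)),
    continuous_antipodal_hopf.prodMk (hψ.contMDiff_sphere hr hrR).continuous⟩

theorem isNullHomologous_hopfSphere (hψ : IsDarbouxBall ωS R ψ) {r : ℝ} (hr : 0 ≤ r)
    (hrR : r < R) : IsNullHomologous (hopfSphere hψ hr hrR) := by
  refine isNullHomologous_of_homotopic _ ⟨_, continuous_antipodal_hopf⟩ (ψ 0) ⟨?_⟩
  -- The radius is multiplied by 1 − t, so the spheres stay in the ball while they shrink to its
  -- centre.
  have hmem : ∀ p : unitInterval × S3, ((1 - p.1 : ℝ) * r) • p.2.1 ∈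
      Metric.ball (0 : EuclideanSpace ℝ (Fin 4)) R := fun p =>
    smul_sphere_mem_ball (mul_nonneg (by linarith [p.1.2.2]) hr)
      ((mul_le_of_le_one_left hr (by linarith [p.1.2.1])).trans_lt hrR) p.2
  exact
    { toFun := fun p => (antipodal (hopf p.2), ψ (((1 - p.1 : ℝ) * r) • p.2.1))
      continuous_toFun := (continuous_antipodal_hopf.comp continuous_snd).prodMk
        (hψ.contMDiffOn.continuousOn.comp_continuous (by fun_prop) hmem)
      map_zero_left := fun x => by simp [hopfSphere]
      map_one_left := fun x => by simp }

/-- The second component determines the embedding and the injectivity of the differential. With ε =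
r², the two parts of the pulled-back form are r² times opposite forms. -/
theorem isLagrangianSphere_hopfSphere [T2Space S] [IsManifold 𝓘(ℂ, E) ω S]
    (hE : Module.finrank ℂ E = 2) (hψ : IsDarbouxBall ωS R ψ) {r : ℝ} (hr : 0 < r) (hrR : r < R) :
    IsLagrangianSphere ((𝓘(ℝ, ℂ)).prod 𝓘(ℝ, E)) (productForm ωS (r ^ 2))
      (hopfSphere hψ hr.le hrR) := by
  have : IsManifold 𝓘(ℝ, E) ∞ S := isManifold_real
  have : IsManifold 𝓘(ℝ, ℂ) ∞ P1 := isManifold_real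
  have : FiniteDimensional ℂ E := Module.finite_of_finrank_pos (by omega)
  have : FiniteDimensional ℝ E := FiniteDimensional.complexToReal E
  have hdim : Module.finrank ℝ (ℂ × E) = 6 := by
    rw [Module.finrank_prod, finrank_real_of_complex E, hE, Complex.finrank_real_complex]
  have hg := hψ.contMDiff_sphere hr.le hrR
  have hf : ContMDiff (𝓡 3) ((𝓘(ℝ, ℂ)).prod 𝓘(ℝ, E)) ∞ (hopfSphere hψ hr.le hrR) :=
    contMDiff_antipodal_hopf.prodMk hg
  have hfst : ∀ x, mfderiv (𝓡 3) 𝓘(ℝ, ℂ) (fun x : S3 => antipodal (hopf x)) x =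
      (mfderiv ((𝓘(ℝ, ℂ)).prod 𝓘(ℝ, E)) 𝓘(ℝ, ℂ) (Prod.fst : P1 × S → P1)
        (hopfSphere hψ hr.le hrR x)).comp
        (mfderiv (𝓡 3) ((𝓘(ℝ, ℂ)).prod 𝓘(ℝ, E)) (hopfSphere hψ hr.le hrR) x) := fun x =>
    mfderiv_comp (g := (Prod.fst : P1 × S → P1)) x mdifferentiableAt_fst
      ((hf x).mdifferentiableAt (by simp))
  have hsnd : ∀ x, mfderiv (𝓡 3) 𝓘(ℝ, E) (fun x : S3 => ψ (r • x.1)) x =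
      (mfderiv ((𝓘(ℝ, ℂ)).prod 𝓘(ℝ, E)) 𝓘(ℝ, E) (Prod.snd : P1 × S → S)
        (hopfSphere hψ hr.le hrR x)).comp
        (mfderiv (𝓡 3) ((𝓘(ℝ, ℂ)).prod 𝓘(ℝ, E)) (hopfSphere hψ hr.le hrR) x) := fun x =>
    mfderiv_comp (g := (Prod.snd : P1 × S → S)) x mdifferentiableAt_snd
      ((hf x).mdifferentiableAt (by simp))
  refine ⟨hdim, ?_, ?_⟩
  · refine isSmoothEmbedding_of_injective_mfderiv (F := EuclideanSpace ℝ (Fin 3)) ?_ hf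
      (fun x => ?_) ?_
    · rw [hdim]
      simp
    · have h := hψ.injective_mfderiv_sphere hr hrR x
      rw [hsnd] at h
      exact Function.Injective.of_comp h
    · exact IsEmbedding.of_comp (hopfSphere hψ hr.le hrR).continuous continuous_snd
        (hg.continuous.isClosedEmbedding (hψ.injective_sphere hr hrR)).isEmbedding
  · funext x
    have h1 := hψ.pullback_sphere hr.le hrR x
    have h2 := pullback_fubiniStudy x
    have h3 : TwoForm.pullback (𝓡 3) ((𝓘(ℝ, ℂ)).prod 𝓘(ℝ, E)) (hopfSphere hψ hr.le hrR)
        (productForm ωS (r ^ 2)) x =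
        TwoForm.pullback (𝓡 3) 𝓘(ℝ, E) (fun x : S3 => ψ (r • x.1)) ωS x +
        r ^ 2 • TwoForm.pullback (𝓡 3) 𝓘(ℝ, ℂ) (fun x : S3 => antipodal (hopf x)) fubiniStudy x := by
      rw [TwoForm.pullback, TwoForm.pullback, TwoForm.pullback, hfst, hsnd]
      rfl
    rw [h3, h1, h2, smul_neg, add_neg_cancel]
    rfl

end Spheres

theorem mainTheorem12 {E : Type*} [NormedAddCommGroup E] [NormedSpace ℂ E]
    (hE : Module.finrank ℂ E = 2)
    {S : Type*} [TopologicalSpace S] [T2Space S] [SecondCountableTopology S] [Nonempty S]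
    [ChartedSpace E S] [IsManifold 𝓘(ℂ, E) ω S]
    (ωS : TwoForm 𝓘(ℝ, E) S) (hωS : IsKahlerForm ωS) (N : ℕ) :
    ∃ ε₀ : ℝ, 0 < ε₀ ∧ ∀ ε : ℝ, 0 < ε → ε < ε₀ →
      ∃ f : Fin N → C(S3, P1 × S),
        (∀ i, IsLagrangianSphere ((𝓘(ℝ, ℂ)).prod 𝓘(ℝ, E)) (productForm ωS ε) (f i)) ∧
        (∀ i, IsNullHomologous (f i)) ∧
        (∀ i j, i ≠ j → Disjoint (Set.range (f i)) (Set.range (f j))) ∧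
        (∀ i, IsHopfSphere ωS (Real.sqrt ε) (f i)) := by
  obtain ⟨R, ψ, hR, hψ⟩ := exists_isDarbouxBall hE ωS hωS
  -- Centres 0, 2ρ, …, 2ρ(N − 1) on the first axis give disjoint balls of radius ρ, all within
  -- distance 2ρN + ρ < (2N + 2)ρ = R of the origin.
  let ρ : ℝ := R / (2 * N + 2)
  have hρ : 0 < ρ := by positivity
  have hρR : ρ * (2 * N + 2) = R := div_mul_cancel₀ R (by positivity)
  let c : Fin N → EuclideanSpace ℝ (Fin 4) := fun i => EuclideanSpace.single 0 (2 * ρ * (i : ℝ))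
  have hc : ∀ i, ∀ v ∈ Metric.ball 0 ρ, c i + v ∈ Metric.ball 0 R := by
    intro i v hv
    rw [mem_ball_zero_iff] at hv ⊢
    have hi : ((i : ℕ) : ℝ) ≤ N := by exact_mod_cast i.2.le
    have h1 : ‖c i‖ = 2 * ρ * (i : ℝ) := by
      rw [PiLp.norm_single, Real.norm_of_nonneg (by positivity)]
    calc ‖c i + v‖ ≤ ‖c i‖ + ‖v‖ := norm_add_le _ _
      _ < 2 * ρ * N + ρ := by
        rw [h1]
        exact add_lt_add_of_le_of_lt (by gcongr) hv
      _ ≤ R := by rw [← hρR]; nlinarith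
  have hψi := fun i => hψ.translate (hc i)
  refine ⟨ρ ^ 2, by positivity, fun ε hε hερ => ?_⟩
  have hr : 0 < Real.sqrt ε := Real.sqrt_pos.2 hε
  have hrρ : Real.sqrt ε < ρ := (Real.sqrt_lt' hρ).2 hερ
  refine ⟨fun i => hopfSphere (hψi i) hr.le hrρ, fun i => ?_, fun i => ?_, fun i j hij => ?_,
    fun i => ⟨ρ, _, hrρ, hψi i, fun x => rfl⟩⟩
  · have h := isLagrangianSphere_hopfSphere hE (hψi i) hr hrρ
    rwa [Real.sq_sqrt hε.le] at h
  · exact isNullHomologous_hopfSphere (hψi i) hr.le hrρ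
  · rw [Set.disjoint_left]
    rintro _ ⟨x, rfl⟩ ⟨y, hxy⟩
    have hx := smul_sphere_mem_ball hr.le hrρ x
    have hy := smul_sphere_mem_ball hr.le hrρ y
    have h := hψ.injOn (hc j _ hy) (hc i _ hx) (congrArg Prod.snd hxy)
    -- First coordinates separate the spheres: each differs from its centre by less than ρ, whereas
    -- distinct centres are at least 2ρ apart.
    have h0 : 2 * ρ * (j : ℝ) + Real.sqrt ε * y.1 0 = 2 * ρ * (i : ℝ) + Real.sqrt ε * x.1 0 := by
      simpa [c] using congrArg (fun v : EuclideanSpace ℝ (Fin 4) => v 0) h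
    rw [mem_ball_zero_iff] at hx hy
    have hx0 := (abs_lt.1 ((PiLp.norm_apply_le (Real.sqrt ε • x.1) 0).trans_lt hx))
    have hy0 := (abs_lt.1 ((PiLp.norm_apply_le (Real.sqrt ε • y.1) 0).trans_lt hy))
    simp only [PiLp.smul_apply, smul_eq_mul] at hx0 hy0
    rcases lt_or_gt_of_ne (fun h => hij (Fin.ext h) : (i : ℕ) ≠ j) with hlt | hlt
    · have : (i : ℝ) + 1 ≤ j := by exact_mod_cast hlt
      nlinarith
    · have : (j : ℝ) + 1 ≤ i := by exact_mod_cast hlt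
      nlinarith

end
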